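/- A straight line program consists of a finite set of terminal characters $\{a_1,\dots,a_m\}$, a finite ordered set of non-terminal characters $A_1,\dots,A_n$ ($n\ge 1$) disjoint from it, and, for each $i$, one production $A_i\to W_i$, where $W_i$ is a (possibly empty) word in the terminals and the non-terminals $A_j$ with $j<i$. The program produces the word $w$ over $\{a_1,\dots,a_m\}$ that results from the root $A_n$ by replacing non-terminals by their productions until only terminals are left. It is in (Chomsky) normal form if every $W_i$ is either a single terminal or a product of two non-terminals. The terminals of all programs are taken from one common supply of letters $a_1,a_2,\dots$, so that words produced by different programs can be compared. A program is encoded as the string that lists $m$ and the productions $W_1,\dots,W_n$ in order, all indices being written in binary. **Theorem.** There is a polynomial-time algorithm that, given straight line programs $\mathbb{A}$ and $\mathbb{X}$ in normal form, decides whether or not $w_{\mathbb{A}} = w_{\mathbb{X}}$. That is, there are a deterministic Turing machine with finitely many stacks as its memory, and a polynomial $q$ with natural number coefficients, such that for every pair $(\mathbb{A},\mathbb{X})$ of straight line programs in normal form, the machine, started on the encodings of $\mathbb{A}$ and $\mathbb{X}$ written one after the other, halts within $q(N)$ steps, where $N$ is the length of this input, with output $\mathtt{true}$ if $w_{\mathbb{A}}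 = w_{\mathbb{X}}$ and $\mathtt{false}$ otherwise. -/

import Mathlib

/-- A straight line program: `numTerminals = m` terminal characters `a_1, …, a_m` (the elements of
`Fin m`), `numNonterminals = n ≥ 1` non-terminal characters `A_1, …, A_n` (the elements of `Fin n`),
and for each non-terminal one production, a possibly empty word in terminals (`Sum.inl`) and
non-terminals (`Sum.inr`), in which only non-terminals of smaller index occur.
The root is the last non-terminal. -/
structure StraightLineProgram where
  numTerminals : ℕ
  numNonterminals : ℕ
  numNonterminals_pos : 0 < numNonterminals
  production : Fin numNonterminals → List (Fin numTerminals ⊕ Fin numNonterminals)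
  lt_of_mem_production : ∀ i j, Sum.inr j ∈ production i → j < i

namespace StraightLineProgram

/-- The word of terminals produced by a non-terminal: replace every non-terminal of its production
by the word which that non-terminal produces. -/
def wordOf (A : StraightLineProgram) (i : Fin A.numNonterminals) : List (Fin A.numTerminals) :=
  (A.production i).attach.flatMap fun s =>
    match h : s.1 with
    | Sum.inl a => [a]
    | Sum.inr j =>
      have : j < i := A.lt_of_mem_production i j (h ▸ s.2)
      A.wordOf j
termination_by i

theorem wordOf_eq (A : StraightLineProgram) (i : Fin A.numNonterminals) :
    A.wordOf i = (A.production i).flatMap (Sum.elim (fun a => [a]) A.wordOf) := by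
  conv_rhs => rw [← List.attach_map_subtype_val (A.production i), List.flatMap_map]
  rw [wordOf]
  congr 1
  funext s
  rcases s with ⟨a | j, hs⟩ <;> rfl

/-- The root: the last non-terminal. -/
def root (A : StraightLineProgram) : Fin A.numNonterminals :=
  ⟨A.numNonterminals - 1, Nat.sub_lt A.numNonterminals_pos Nat.one_pos⟩

/-- The word produced by the program. The terminals of all programs are taken from one common
supply of letters, indexed by the natural numbers, so that the words of two programs with possibly
different terminal alphabets can be compared. -/
def word (A : StraightLineProgram) : List ℕ :=
  (A.wordOf A.root).map Fin.val

/-- Chomsky normal form: each production is a single terminal or a pair of non-terminals. -/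
def IsNormal (A : StraightLineProgram) : Prop :=
  ∀ i, (∃ a, A.production i = [Sum.inl a]) ∨ (∃ j k, A.production i = [Sum.inr j, Sum.inr k])

/-- The tape alphabet in which programs are written: two binary digits and four markers. -/
inductive Token
  | bit (b : Bool)
  | terminal
  | nonterminal
  | rule
  | program
  deriving DecidableEq, Fintype

/-- A natural number in binary (least significant digit first). -/
def natCode (k : ℕ) : List Token :=
  (Computability.encodeNat k).map Token.bit

/-- A symbol of a production: a marker for its kind and its index in binary. -/
def symbolCode : ℕ ⊕ ℕ → List Token
  | Sum.inl a => Token.terminal :: natCode a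
  | Sum.inr j => Token.nonterminal :: natCode j

/-- A production: a marker and the symbols of the production. -/
def ruleCode (w : List (ℕ ⊕ ℕ)) : List Token :=
  Token.rule :: w.flatMap symbolCode

/-- The productions of `A_1, …, A_n` in this order, with characters replaced by their indices. -/
def rules (A : StraightLineProgram) : List (List (ℕ ⊕ ℕ)) :=
  List.ofFn fun i => (A.production i).map (Sum.map Fin.val Fin.val)

/-- The code of a program: a marker, the number of terminals in binary, and the productions.
A program in normal form with `n` non-terminals and indices of terminals below a bound polynomial
in `n` has a code of length `O(n log n)`. -/
def code (A : StraightLineProgram) : List Token :=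
  Token.program :: (natCode A.numTerminals ++ A.rules.flatMap ruleCode)

/-- Straight line programs in normal form. -/
abbrev Normal : Type := { A : StraightLineProgram // A.IsNormal }

/-- The code of a pair of programs in normal form: one code after the other. -/
def pairCode (p : Normal × Normal) : List Token :=
  p.1.1.code ++ p.2.1.code

theorem natCode_append_inj {a b : ℕ} {r s : List Token}
    (hr : ∀ c, r.head? ≠ some (Token.bit c)) (hs : ∀ c, s.head? ≠ some (Token.bit c))
    (h : natCode a ++ r = natCode b ++ s) : a = b ∧ r = s := by
  have key : ∀ l l' : List Bool, l.map Token.bit ++ r = l'.map Token.bit ++ s →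
      l = l' ∧ r = s := by
    intro l
    induction l with
    | nil =>
      rintro (_ | ⟨c, l'⟩) h
      · exact ⟨rfl, by simpa using h⟩
      · simp at h
        exact absurd (by rw [h]; rfl) (hr c)
    | cons c l ih =>
      rintro (_ | ⟨c', l'⟩) h
      · simp at h
        exact absurd (by rw [← h]; rfl) (hs c)
      · simp only [List.map_cons, List.cons_append, List.cons.injEq, Token.bit.injEq] at h
        obtain ⟨h1, h2⟩ := ih l' h.2
        exact ⟨by rw [h.1, h1], h2⟩
  obtain ⟨h1, h2⟩ := key _ _ h
  refine ⟨?_, h2⟩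
  have := congrArg Computability.decodeNat h1
  simpa using this

theorem symbols_head (w : List (ℕ ⊕ ℕ)) {r : List Token}
    (hr : r.head? = none ∨ r.head? = some Token.rule ∨ r.head? = some Token.program) (c : Bool) :
    (w.flatMap symbolCode ++ r).head? ≠ some (Token.bit c) := by
  rcases w with _ | ⟨a | j, w⟩
  · rcases hr with hr | hr | hr <;> simp [hr]
  · simp [symbolCode]
  · simp [symbolCode]

theorem symbols_append_inj {r s : List Token}
    (hr : r.head? = none ∨ r.head? = some Token.rule ∨ r.head? = some Token.program)
    (hs : s.head? = none ∨ s.head? = some Token.rule ∨ s.head? = some Token.program) :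
    ∀ w v : List (ℕ ⊕ ℕ), w.flatMap symbolCode ++ r = v.flatMap symbolCode ++ s → w = v ∧ r = s := by
  intro w
  induction w with
  | nil =>
    rintro (_ | ⟨a | j, v⟩) h
    · exact ⟨rfl, by simpa using h⟩
    · simp [symbolCode] at h
      rw [h] at hr
      simp at hr
    · simp [symbolCode] at h
      rw [h] at hr
      simp at hr
  | cons x w ih =>
    rintro (_ | ⟨y, v⟩) h
    · rcases x with a | j <;>
      · simp [symbolCode] at h
        rw [← h] at hs
        simp at hs
    · rcases x with a | j <;> rcases y with b | k <;>
        simp only [List.flatMap_cons, symbolCode, List.cons_append, List.append_assoc,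
          List.cons.injEq, reduceCtorEq, false_and, true_and] at h
      all_goals
        obtain ⟨h1, h2⟩ := natCode_append_inj (symbols_head w hr) (symbols_head v hs) h
        obtain ⟨h3, h4⟩ := ih v h2
        exact ⟨by rw [h1, h3], h4⟩

theorem rules_head (w : List (List (ℕ ⊕ ℕ))) {r : List Token}
    (hr : r.head? = none ∨ r.head? = some Token.program) :
    (w.flatMap ruleCode ++ r).head? = none ∨ (w.flatMap ruleCode ++ r).head? = some Token.rule ∨
      (w.flatMap ruleCode ++ r).head? = some Token.program := by
  rcases w with _ | ⟨a, w⟩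
  · rcases hr with hr | hr <;> simp [hr]
  · simp [ruleCode]

theorem rules_append_inj {r s : List Token}
    (hr : r.head? = none ∨ r.head? = some Token.program)
    (hs : s.head? = none ∨ s.head? = some Token.program) :
    ∀ w v : List (List (ℕ ⊕ ℕ)),
      w.flatMap ruleCode ++ r = v.flatMap ruleCode ++ s → w = v ∧ r = s := by
  intro w
  induction w with
  | nil =>
    rintro (_ | ⟨y, v⟩) h
    · exact ⟨rfl, by simpa using h⟩
    · simp [ruleCode] at h
      rw [h] at hr
      simp at hr
  | cons x w ih =>
    rintro (_ | ⟨y, v⟩) h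
    · simp [ruleCode] at h
      rw [← h] at hs
      simp at hs
    · simp only [List.flatMap_cons, ruleCode, List.cons_append, List.append_assoc,
        List.cons.injEq, true_and] at h
      obtain ⟨h1, h2⟩ := symbols_append_inj (rules_head w hr) (rules_head v hs) _ _ h
      obtain ⟨h3, h4⟩ := ih v h2
      exact ⟨by rw [h1, h3], h4⟩

theorem code_append_inj {A B : StraightLineProgram} {r s : List Token}
    (hr : r.head? = none ∨ r.head? = some Token.program)
    (hs : s.head? = none ∨ s.head? = some Token.program)
    (h : A.code ++ r = B.code ++ s) : A = B ∧ r = s := by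
  simp only [code, List.cons_append, List.append_assoc, List.cons.injEq, true_and] at h
  have aux : ∀ (C : StraightLineProgram) (t : List Token),
      (t.head? = none ∨ t.head? = some Token.program) → ∀ c,
        (C.rules.flatMap ruleCode ++ t).head? ≠ some (Token.bit c) := by
    intro C t ht c hc
    have := rules_head C.rules ht
    rw [hc] at this
    simp at this
  obtain ⟨hm, h2⟩ := natCode_append_inj (aux A r hr) (aux B s hs) h
  obtain ⟨h3, h4⟩ := rules_append_inj hr hs _ _ h2
  refine ⟨?_, h4⟩
  obtain ⟨m, n, hn, p, hp⟩ := A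
  obtain ⟨m', n', hn', p', hp'⟩ := B
  obtain rfl : m = m' := hm
  obtain rfl : n = n' := by simpa [rules] using congrArg List.length h3
  have hpp : p = p' := by
    funext i
    have := congrFun (List.ofFn_injective h3) i
    exact List.map_injective_iff.2 (Fin.val_injective.sumMap Fin.val_injective) this
  subst hpp
  rfl

/-- Different pairs of programs have different codes. -/
theorem pairCode_injective : Function.Injective pairCode := by
  rintro ⟨A, X⟩ ⟨B, Y⟩ h
  obtain ⟨h1, h2⟩ := code_append_inj (Or.inr rfl) (Or.inr rfl) h
  have h3 : X.1.code ++ [] = Y.1.code ++ [] := by simpa using h2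
  exact Prod.ext (Subtype.ext h1) (Subtype.ext (code_append_inj (Or.inl rfl) (Or.inl rfl) h3).1)

end StraightLineProgram

/-! A program with `n` non-terminals can produce a word of length `2 ^ (n - 1)`, so the words cannot
be written out; but their lengths have at most `n` binary digits, and arithmetic with them is cheap.
Both programs are put into one table. A constraint `(a, b, i)` compares the word of `a` from
position `i` on with the word of `b`, as far as they overlap. For words of equal length, equality is
the single constraint `(a, b, 0)`. Non-terminals are eliminated from the largest one downwards:
inserting the production of `k` replaces a constraint by equivalent ones between smaller
non-terminals (`agree_append_left_of_le`, `agree_append_left_of_lt`, `agree_append_right`), and each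
of these can be brought into a form that compares a suffix of one word with a prefix of another
(`normalize_spec`). In the end only terminals remain, and they are compared directly (`check_iff`).
Unchecked, the number of constraints could double at each stage. Periodicity prevents this. Fix `a`,
`b` and the binary length of the overlap, and let `m` be the largest overlap. Given the constraint
for `m`, the constraint for another overlap `o` says that the prefix of length `m` of the word of
`b` has period `m - o`, which is at most `m / 2` (`agree_suffix_iff`). By the theorem of Fine and
Wilf (`HasPeriod.gcd`) all these periods together amount to their greatest common divisor. So two
constraints suffice for each class (`compress_spec`, `compact_spec`), and a list of constraints has
polynomial size whatever happened before (`size_compact_le`). The running time is treated in a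
calculus of functions on tree-coded data, `PolyTime`, which is closed under composition, pairing,
case distinction and folds with polynomially bounded state (`PolyTime.foldl`); binary arithmetic,
the parser and the test are built from these. The underlying stack programs are compiled to jump
instructions without loss of time (`Run.steps`) and executed by a Turing machine
(`nonempty_computable`). -/

open Function (update update_apply)

/-! ### Binary trees and their preorder codes. -/

/-- Binary trees, the data on which stack programs compute. -/
inductive BinTree
  | nil
  | node (l r : BinTree)

namespace BinTree

/-- The number of inner nodes of a tree. -/
def nodes : BinTree → ℕ
  | nil => 0
  | node l r => l.nodes + r.nodes + 1

/-- The preorder code of a tree. -/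
def str : BinTree → List Bool
  | nil => [false]
  | node l r => true :: (l.str ++ r.str)

theorem length_str (x : BinTree) : x.str.length = 2 * x.nodes + 1 := by
  induction x with
  | nil => rfl
  | node l r hl hr => simp only [str, nodes, List.length_cons, List.length_append, hl, hr]; ring

/-- This lets the code of a tree serve as a loop counter in `PolyTime.iterate`. -/
theorem count_str (x : BinTree) : x.str.count true = x.nodes := by
  induction x with
  | nil => rfl
  | node l r hl hr => simp [str, nodes, hl, hr]

end BinTree

/-! ### Structured stack programs and their running times. -/

/-- The memory of a stack program: a family of stacks of bits. -/
abbrev Store := ℕ → List Bool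

/-- Structured programs on a family of stacks of bits. -/
inductive StackProg
  | skip
  | push (k : ℕ) (b : Bool)
  | seq (p q : StackProg)
  | pop (k : ℕ) (p q r : StackProg)
  | loop (k : ℕ) (p q : StackProg)

namespace StackProg

/-- `Run p S t S'`: the program `p` transforms the memory `S` into `S'` in `t` steps. The program
`pop k p q r` pops stack `k` and continues with `p` if the stack was empty, with `q` on popping
`false`, and with `r` on popping `true`; `loop k p q` pops stack `k` until it is empty and executes
`p` after each `false` and `q` after each `true`. -/
inductive Run : StackProg → Store → ℕ → Store → Prop
  | skip (S) : Run skip S 0 S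
  | push (k b S) : Run (push k b) S 1 (update S k (b :: S k))
  | seq {p q S S' S'' t t'} : Run p S t S' → Run q S' t' S'' → Run (seq p q) S (t + t') S''
  | popNil {k p q r S S' t} : S k = [] → Run p S t S' → Run (pop k p q r) S (t + 2) S'
  | popFalse {k p q r S S' t l} : S k = false :: l → Run q (update S k l) t S' →
      Run (pop k p q r) S (t + 2) S'
  | popTrue {k p q r S S' t l} : S k = true :: l → Run r (update S k l) t S' →
      Run (pop k p q r) S (t + 2) S'
  | loopNil {k p q S} : S k = [] → Run (loop k p q) S 1 S
  | loopFalse {k p q S S' S'' t t' l} : S k = false :: l → Run p (update S k l) t S' →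
      Run (loop k p q) S' t' S'' → Run (loop k p q) S (t + 2 + t') S''
  | loopTrue {k p q S S' S'' t t' l} : S k = true :: l → Run q (update S k l) t S' →
      Run (loop k p q) S' t' S'' → Run (loop k p q) S (t + 2 + t') S''

/-- A step pushes at most one bit, so running time bounds the size of the output. -/
theorem Run.length_le {p S t S'} (h : Run p S t S') (k : ℕ) :
    (S' k).length ≤ (S k).length + t := by
  have key : ∀ (S : Store) j l b, S j = b :: l → (update S j l k).length ≤ (S k).length := by
    intro S j l b h
    rw [update_apply]
    split_ifs with hk
    · subst hk; simp [h]
    · rfl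
  induction h with
  | skip S => simp
  | push j b S =>
    rw [update_apply]
    split_ifs with hk
    · subst hk; simp
    · simp
  | seq _ _ h1 h2 => omega
  | popNil _ _ h1 => omega
  | popFalse h _ h1 => have := key _ _ _ _ h; omega
  | popTrue h _ h1 => have := key _ _ _ _ h; omega
  | loopNil => simp
  | loopFalse h _ _ h1 h2 => have := key _ _ _ _ h; omega
  | loopTrue h _ _ h1 h2 => have := key _ _ _ _ h; omega

/-- The program `p` transforms the memory `S` into `S'` in at most `n` steps. -/
def Exec (p : StackProg) (S : Store) (n : ℕ) (S' : Store) : Prop :=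
  ∃ t ≤ n, Run p S t S'

theorem Exec.mono {p S n m S'} (h : Exec p S n S') (hnm : n ≤ m) : Exec p S m S' :=
  let ⟨t, ht, h⟩ := h
  ⟨t, ht.trans hnm, h⟩

theorem Exec.congr {p S n S' S''} (h : Exec p S n S') (hS : S' = S'') : Exec p S n S'' :=
  hS ▸ h

theorem Exec.length_le {p S n S'} (h : Exec p S n S') (k : ℕ) :
    (S' k).length ≤ (S k).length + n := by
  obtain ⟨t, ht, h⟩ := h
  have := h.length_le k
  omega

theorem Exec.skip {S} : Exec skip S 0 S := ⟨0, le_rfl, Run.skip S⟩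

theorem Exec.push {k b S} : Exec (push k b) S 1 (update S k (b :: S k)) :=
  ⟨1, le_rfl, Run.push k b S⟩

theorem Exec.seq {p q S S' S'' n m} (h : Exec p S n S') (h' : Exec q S' m S'') :
    Exec (seq p q) S (n + m) S'' :=
  let ⟨_, ht, h⟩ := h
  let ⟨_, ht', h'⟩ := h'
  ⟨_, add_le_add ht ht', h.seq h'⟩

theorem Exec.popFalse {k p q r S S' n l} (hk : S k = false :: l)
    (h : Exec q (update S k l) n S') : Exec (pop k p q r) S (n + 2) S' :=
  let ⟨_, ht, h⟩ := h
  ⟨_, by omega, Run.popFalse hk h⟩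

theorem Exec.popTrue {k p q r S S' n l} (hk : S k = true :: l)
    (h : Exec r (update S k l) n S') : Exec (pop k p q r) S (n + 2) S' :=
  let ⟨_, ht, h⟩ := h
  ⟨_, by omega, Run.popTrue hk h⟩

theorem Exec.loopNil {k p q S} (hk : S k = []) : Exec (loop k p q) S 1 S :=
  ⟨1, le_rfl, Run.loopNil hk⟩

theorem Exec.loopFalse {k p q S S' S'' n m l} (hk : S k = false :: l)
    (h : Exec p (update S k l) n S') (h' : Exec (loop k p q) S' m S'') :
    Exec (loop k p q) S (n + 2 + m) S'' :=
  let ⟨_, ht, h⟩ := h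
  let ⟨_, ht', h'⟩ := h'
  ⟨_, by omega, Run.loopFalse hk h h'⟩

theorem Exec.loopTrue {k p q S S' S'' n m l} (hk : S k = true :: l)
    (h : Exec q (update S k l) n S') (h' : Exec (loop k p q) S' m S'') :
    Exec (loop k p q) S (n + 2 + m) S'' :=
  let ⟨_, ht, h⟩ := h
  let ⟨_, ht', h'⟩ := h'
  ⟨_, by omega, Run.loopTrue hk h h'⟩

/-- Move stack `k` to stack `j`, in reversed order. -/
def mv (k j : ℕ) : StackProg := loop k (push j false) (push j true)

theorem exec_mv {k j : ℕ} (hkj : k ≠ j) (S : Store) :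
    Exec (mv k j) S (3 * (S k).length + 1)
      (update (update S k []) j ((S k).reverse ++ S j)) := by
  generalize hl : S k = l
  induction l generalizing S with
  | nil =>
    refine (Exec.loopNil hl).congr ?_
    funext i; simp only [update_apply]; grind
  | cons b l ih =>
    have h := ih (update (update S k l) j (b :: S j)) (by simp [hkj])
    cases b
    · refine ((Exec.loopFalse hl (Exec.push.congr ?_) h).mono ?_).congr ?_
      · funext i; simp only [update_apply]; grind
      · simp only [List.length_cons]; omega
      · funext i; simp only [update_apply]; grind
    · refine ((Exec.loopTrue hl (Exec.push.congr ?_) h).mono ?_).congr ?_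
      · funext i; simp only [update_apply]; grind
      · simp only [List.length_cons]; omega
      · funext i; simp only [update_apply]; grind

/-- Empty stack `k`. -/
def clear (k : ℕ) : StackProg := loop k skip skip

theorem exec_clear (k : ℕ) (S : Store) :
    Exec (clear k) S (2 * (S k).length + 1) (update S k []) := by
  generalize hl : S k = l
  induction l generalizing S with
  | nil =>
    refine (Exec.loopNil hl).congr ?_
    funext i; simp only [update_apply]; grind
  | cons b l ih =>
    have h := ih (update S k l) (by simp)
    cases b
    · refine ((Exec.loopFalse hl Exec.skip h).mono ?_).congr (by simp)
      simp only [List.length_cons]; omega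
    · refine ((Exec.loopTrue hl Exec.skip h).mono ?_).congr (by simp)
      simp only [List.length_cons]; omega

/-- Move stack `s` to both stacks `k` and `j`, in reversed order. -/
def mvTwo (s k j : ℕ) : StackProg :=
  loop s (seq (push k false) (push j false)) (seq (push k true) (push j true))

theorem exec_mvTwo {s k j : ℕ} (hsk : s ≠ k) (hsj : s ≠ j) (hkj : k ≠ j) (S : Store) :
    Exec (mvTwo s k j) S (4 * (S s).length + 1)
      (update (update (update S s []) k ((S s).reverse ++ S k)) j ((S s).reverse ++ S j)) := by
  generalize hl : S s = l
  induction l generalizing S with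
  | nil =>
    refine (Exec.loopNil hl).congr ?_
    funext i; simp only [update_apply]; grind
  | cons b l ih =>
    have h := ih (update (update (update S s l) k (b :: S k)) j (b :: S j)) (by simp [hsk, hsj])
    cases b
    · refine ((Exec.loopFalse hl ((Exec.push.seq Exec.push).congr ?_) h).mono ?_).congr ?_
      · funext i; simp only [update_apply]; grind
      · simp only [List.length_cons]; omega
      · funext i; simp only [update_apply]; grind
    · refine ((Exec.loopTrue hl ((Exec.push.seq Exec.push).congr ?_) h).mono ?_).congr ?_
      · funext i; simp only [update_apply]; grind
      · simp only [List.length_cons]; omega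
      · funext i; simp only [update_apply]; grind

/-- Copy stack `k` to stack `j`, with the help of stack `s`. -/
def copy (k j s : ℕ) : StackProg := seq (mv k s) (mvTwo s k j)

theorem exec_copy {k j s : ℕ} (hsk : s ≠ k) (hsj : s ≠ j) (hkj : k ≠ j) (S : Store)
    (hs : S s = []) (hj : S j = []) :
    Exec (copy k j s) S (7 * (S k).length + 2) (update S j (S k)) := by
  refine (((exec_mv hsk.symm S).seq (exec_mvTwo hsk hsj hkj _)).mono ?_).congr ?_
  · simp [hs]; omega
  · funext i; simp only [update_apply]; grind

/-- Move stack `k` to the top of stack `j`, in the same order, with the help of stack `s`. -/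
def mvTo (k j s : ℕ) : StackProg := seq (mv k s) (mv s j)

theorem exec_mvTo {k j s : ℕ} (hsk : s ≠ k) (hsj : s ≠ j) (hkj : k ≠ j) (S : Store)
    (hs : S s = []) :
    Exec (mvTo k j s) S (6 * (S k).length + 2)
      (update (update S k []) j (S k ++ S j)) := by
  refine (((exec_mv hsk.symm S).seq (exec_mv hsj _)).mono ?_).congr ?_
  · simp [hs]; omega
  · funext i; simp only [update_apply]; grind

/-- Push a word on stack `k`. -/
def pushAll (k : ℕ) : List Bool → StackProg
  | [] => skip
  | b :: l => seq (pushAll k l) (push k b)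

theorem exec_pushAll (k : ℕ) (l : List Bool) (S : Store) :
    Exec (pushAll k l) S l.length (update S k (l ++ S k)) := by
  induction l with
  | nil => exact Exec.skip.congr (by simp)
  | cons b l ih => exact (ih.seq Exec.push).congr (by simp)

/-- The loop which moves a tree from stack `k` to stack `j`, with counter stack `c`. -/
def splitLoop (k j c : ℕ) : StackProg :=
  loop c skip (pop k skip (push j false)
    (seq (push j true) (seq (push c true) (push c true))))

/-- The counter stack holds one `true` for each subtree still to be moved: every round consumes one,
and an inner node adds two. The statement has continuation form, so that the induction hypotheses
for the two subtrees can be chained. A round costs at most 7: 2 for the loop, 2 for the pop, and up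
to 3 pushes. -/
theorem exec_splitLoop {k j c : ℕ} (hkj : k ≠ j) (hkc : k ≠ c) (hjc : j ≠ c) (x : BinTree) :
    ∀ (S S' : Store) (r cs : List Bool) (n : ℕ), S k = x.str ++ r → S c = true :: cs →
      Exec (splitLoop k j c)
        (update (update (update S k r) j (x.str.reverse ++ S j)) c cs) n S' →
      Exec (splitLoop k j c) S (n + 7 * x.str.length) S' := by
  induction x with
  | nil =>
    intro S S' r cs n hk hc h
    refine (Exec.loopTrue hc (Exec.popFalse (l := r) ?_ (Exec.push.congr ?_)) h).mono ?_
    · simpa [hkc, BinTree.str] using hk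
    · funext i; simp only [update_apply, BinTree.str]; grind
    · simp only [BinTree.str, List.length_cons, List.length_nil]; omega
  | node x y hx hy =>
    intro S S' r cs n hk hc h
    have h1 : Exec (splitLoop k j c) (update (update (update (update (update (update S k r) j
        (y.str.reverse ++ (x.str.reverse ++ true :: S j))) c cs) c cs) c cs) c cs) n S' := by
      convert h using 1
      funext i; simp only [update_apply, BinTree.str]; grind
    have h2 := hy (update (update (update S k (y.str ++ r)) j
        (x.str.reverse ++ true :: S j)) c (true :: cs)) S' r cs n (by grind [update_apply])
        (by grind [update_apply]) (by
          convert h1 using 1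
          funext i; simp only [update_apply]; grind)
    have h3 := hx (update (update (update S k (x.str ++ (y.str ++ r))) j
        (true :: S j)) c (true :: true :: cs)) S' (y.str ++ r) (true :: cs) _
        (by grind [update_apply]) (by grind [update_apply]) (by
          convert h2 using 1
          funext i; simp only [update_apply]; grind)
    refine (Exec.loopTrue (n := 5) hc (Exec.popTrue (n := 3) (l := x.str ++ (y.str ++ r)) ?_
      ((Exec.push.seq (Exec.push.seq Exec.push)).congr ?_)) h3).mono ?_
    · simpa [hkc, BinTree.str] using hk
    · funext i; simp only [update_apply]; grind
    · simp only [BinTree.str, List.length_cons, List.length_append]; omega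

/-- Move a tree from stack `k` to stack `j`, in reversed order, with counter stack `c`. -/
def split (k j c : ℕ) : StackProg := seq (push c true) (splitLoop k j c)

theorem exec_split {k j c : ℕ} (hkj : k ≠ j) (hkc : k ≠ c) (hjc : j ≠ c) (x : BinTree)
    (S : Store) (r : List Bool) (hk : S k = x.str ++ r) (hc : S c = []) :
    Exec (split k j c) S (7 * x.str.length + 2)
      (update (update S k r) j (x.str.reverse ++ S j)) := by
  refine (Exec.push.seq (exec_splitLoop hkj hkc hjc x _ _ r [] 1 ?_ ?_
    ((Exec.loopNil ?_).congr ?_))).mono ?_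
  · simpa [hkc] using hk
  · simp [hc]
  · simp
  · funext i; simp only [update_apply]; grind
  · omega

end StackProg

/-! ### Functions computable in polynomial time, and their closure properties. -/

theorem Polynomial.eval_mono_nat (p : Polynomial ℕ) : Monotone fun n => p.eval n := by
  intro m n h
  simp only [Polynomial.eval_eq_sum_range]
  gcongr

/-- Types whose elements are coded by binary trees. -/
class Data (α : Type*) where
  /-- the code of an element -/
  enc : α → BinTree

namespace Data

variable {α : Type*} [Data α]

/-- The word which codes an element. -/
def code (a : α) : List Bool := (enc a).str

/-- The size of the tree which codes an element. -/
def size (a : α) : ℕ := (enc a).nodes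

theorem length_code (a : α) : (code a).length = 2 * size a + 1 := BinTree.length_str _

instance : Data BinTree := ⟨id⟩

instance {α β : Type*} [Data α] [Data β] : Data (α × β) := ⟨fun x => .node (enc x.1) (enc x.2)⟩

instance {p : α → Prop} : Data (Subtype p) := ⟨fun x => enc x.1⟩

theorem size_prod {β : Type*} [Data β] (x : α × β) : size x = size x.1 + size x.2 + 1 := rfl

end Data

open Data StackProg

section

variable {α β γ δ σ : Type*} [Data α] [Data β] [Data γ] [Data δ] [Data σ]

/-- A quantity which is bounded by a polynomial in the size. -/
def PolyBdd (m : α → ℕ) : Prop := ∃ p : Polynomial ℕ, ∀ a, m a ≤ p.eval (size a)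

theorem PolyBdd.mono {m n : α → ℕ} (h : PolyBdd n) (hmn : ∀ a, m a ≤ n a) : PolyBdd m :=
  let ⟨p, hp⟩ := h
  ⟨p, fun a => (hmn a).trans (hp a)⟩

theorem PolyBdd.const (n : ℕ) : PolyBdd fun _ : α => n := ⟨.C n, fun a => by simp⟩

theorem PolyBdd.size : PolyBdd fun a : α => size a := ⟨.X, fun a => by simp⟩

theorem PolyBdd.add {m n : α → ℕ} (hm : PolyBdd m) (hn : PolyBdd n) :
    PolyBdd fun a => m a + n a :=
  let ⟨p, hp⟩ := hm
  let ⟨q, hq⟩ := hn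
  ⟨p + q, fun a => by simpa using add_le_add (hp a) (hq a)⟩

theorem PolyBdd.mul {m n : α → ℕ} (hm : PolyBdd m) (hn : PolyBdd n) :
    PolyBdd fun a => m a * n a :=
  let ⟨p, hp⟩ := hm
  let ⟨q, hq⟩ := hn
  ⟨p * q, fun a => by simpa using Nat.mul_le_mul (hp a) (hq a)⟩

theorem PolyBdd.eval {m : α → ℕ} (hm : PolyBdd m) (q : Polynomial ℕ) :
    PolyBdd fun a => q.eval (m a) :=
  let ⟨p, hp⟩ := hm
  ⟨q.comp p, fun a => by simpa using q.eval_mono_nat (hp a)⟩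

theorem PolyBdd.comp {m : β → ℕ} (hm : PolyBdd m) {f : α → β}
    (hf : PolyBdd fun a => Data.size (f a)) : PolyBdd fun a => m (f a) :=
  let ⟨p, hp⟩ := hm
  (hf.eval p).mono fun a => hp (f a)

/-- The function `f` is computed by a stack program in polynomial time: from the code of `a` on
stack `b`, where all higher stacks are empty, it obtains the code of `f a` on stack `b`. -/
@[fun_prop]
def PolyTime (f : α → β) : Prop :=
  ∃ (P : ℕ → StackProg) (t : α → ℕ), PolyBdd t ∧ ∀ b a (S : Store), S b = code a →
    (∀ k, b < k → S k = []) → Exec (P b) S (t a) (update S b (code (f a)))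

/-- Stack `b` grows by at most one bit per step. Closure under composition rests on this: the second
program runs on an input of polynomial size. -/
theorem PolyTime.size_bdd {f : α → β} (hf : PolyTime f) : PolyBdd fun a => size (f a) := by
  obtain ⟨P, t, ht, h⟩ := hf
  refine (((PolyBdd.const 2).mul .size).add ((PolyBdd.const 1).add ht)).mono fun a => ?_
  have := (h 0 a (update (fun _ => []) 0 (code a)) (by simp)
    (fun k hk => by simp [hk.ne'])).length_le 0
  simp only [Function.update_self, length_code] at this
  omega

/-- Only the codes matter. An operation that acts on codes like one already treated needs no program
of its own. -/
theorem PolyTime.of_enc {f : α → β} {g : γ → δ} (hg : PolyTime g) (i : α → γ)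
    (hi : ∀ a, enc (i a) = enc a) (h : ∀ a, enc (f a) = enc (g (i a))) : PolyTime f := by
  obtain ⟨P, t, ⟨p, hp⟩, hP⟩ := hg
  have hs : ∀ a, size (i a) = size a := fun a => by rw [size, hi, size]
  refine ⟨P, fun a => t (i a), ⟨p, fun a => hs a ▸ hp (i a)⟩, fun b a S hb hS => ?_⟩
  have := hP b (i a) S (by rw [hb, code, code, hi]) hS
  rwa [code, ← h a] at this

@[fun_prop]
theorem PolyTime.id : PolyTime fun a : α => a :=
  ⟨fun _ => .skip, fun _ => 0, .const 0, fun b a S hb _ => Exec.skip.congr (by simp [← hb])⟩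

/-- A function which does not change the code. -/
theorem PolyTime.cast {f : α → β} (h : ∀ a, enc (f a) = enc a) : PolyTime f :=
  (PolyTime.id (α := α)).of_enc (fun a => a) (fun _ => rfl) h

@[fun_prop]
theorem PolyTime.const (c : β) : PolyTime fun _ : α => c := by
  refine ⟨fun b => .seq (clear b) (pushAll b (code c)),
    fun a => 2 * (2 * size a + 1) + 1 + (code c).length,
    ((((PolyBdd.const 2).mul (((PolyBdd.const 2).mul .size).add (.const 1))).add (.const 1)).add
      (.const _)), fun b a S hb hS => ?_⟩
  refine (((exec_clear b S).seq (exec_pushAll _ _ _)).mono ?_).congr ?_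
  · simp [hb, length_code]
  · simp

@[fun_prop]
theorem PolyTime.comp {g : β → γ} {f : α → β} (hg : PolyTime g) (hf : PolyTime f) :
    PolyTime fun a => g (f a) := by
  have hsize := hf.size_bdd
  obtain ⟨P, t, ht, h⟩ := hf
  obtain ⟨P', t', ht', h'⟩ := hg
  refine ⟨fun b => .seq (P b) (P' b), fun a => t a + t' (f a), ht.add (ht'.comp hsize),
    fun b a S hb hS => ?_⟩
  refine ((h b a S hb hS).seq (h' b (f a) _ (by simp) ?_)).congr (by simp)
  intro k hk
  simp [hk.ne', hS k hk]

@[fun_prop]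
theorem PolyTime.prodMk {f : α → β} {g : α → γ} (hf : PolyTime f) (hg : PolyTime g) :
    PolyTime fun a => (f a, g a) := by
  have hsf := hf.size_bdd
  have hsg := hg.size_bdd
  obtain ⟨P, t, ht, h⟩ := hf
  obtain ⟨P', t', ht', h'⟩ := hg
  -- `f` and `g` run on copies of the input at the bases `b + 1` and `b + 2`; then stack `b` is
  -- rebuilt from the bottom: the code of `g a`, the code of `f a`, and the bit `true` of the root.
  refine ⟨fun b => .seq (copy b (b + 1) (b + 2)) (.seq (P (b + 1)) (.seq (copy b (b + 2) (b + 3))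
    (.seq (P' (b + 2)) (.seq (clear b) (.seq (mvTo (b + 2) b (b + 3)) (.seq (mvTo (b + 1) b (b + 2))
    (.push b true))))))),
    fun a => (16 * (2 * size a + 1) + 6 * (2 * size (f a) + 1) + 6 * (2 * size (g a) + 1) + 10)
      + t a + t' a, ?_, fun b a S hb hS => ?_⟩
  · refine PolyBdd.add (PolyBdd.add ?_ ht) ht'
    have h1 : ∀ {m : α → ℕ}, PolyBdd m → ∀ n, PolyBdd fun a => n * (2 * m a + 1) :=
      fun hm n => (PolyBdd.const n).mul (((PolyBdd.const 2).mul hm).add (.const 1))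
    exact (((h1 .size 16).add (h1 hsf 6)).add (h1 hsg 6)).add (.const 10)
  · have hS1 := hS (b + 1) (by omega)
    have hS2 := hS (b + 2) (by omega)
    have hS3 := hS (b + 3) (by omega)
    have e1 := exec_copy (k := b) (j := b + 1) (s := b + 2) (by omega) (by omega) (by omega)
      S hS2 hS1
    rw [hb] at e1
    have e2 := h (b + 1) a _ (Function.update_self (b + 1) (code a) S) (by
      intro k hk
      rw [update_apply, if_neg (by omega), hS k (by omega)])
    rw [Function.update_idem] at e2
    have e3 := (exec_copy (k := b) (j := b + 2) (s := b + 3) (by omega) (by omega) (by omega)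
      (update S (b + 1) (code (f a))) (by simp [hS3]) (by simp [hS2]))
    rw [Function.update_of_ne (by omega), hb] at e3
    have e4 := h' (b + 2) a _ (Function.update_self (b + 2) (code a) (update S (b + 1) (code (f a))))
      (by
        intro k hk
        rw [update_apply, if_neg (by omega), update_apply, if_neg (by omega), hS k (by omega)])
    rw [Function.update_idem] at e4
    refine ((e1.seq (e2.seq (e3.seq (e4.seq ((exec_clear b _).seq
      ((exec_mvTo (k := b + 2) (j := b) (s := b + 3) (by omega) (by omega) (by omega) _ ?_).seq
      ((exec_mvTo (k := b + 1) (j := b) (s := b + 2) (by omega) (by omega) (by omega) _ ?_).seq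
        .push))))))).mono ?_).congr ?_
    · simp [hS3]
    · simp
    · simp [hb, length_code]; omega
    · have e : code (f a, g a) = true :: (code (f a) ++ code (g a)) := rfl
      rw [e]
      funext i; simp only [update_apply]; grind

theorem exec_fst_split {b : ℕ} {x : α × β} {S : Store} (hb : S b = code x)
    (hS : ∀ k, b < k → S k = []) :
    Exec (.seq (.pop b .skip .skip .skip) (split b (b + 1) (b + 2))) S
      (14 * size x.1 + 11) (update (update S b (code x.2)) (b + 1) (code x.1).reverse) := by
  -- The code of a pair begins with `true`, the bit of the root.
  have e1 : Exec (.pop b .skip .skip .skip) S 2 (update S b (code x.1 ++ code x.2)) :=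
    .popTrue (by rw [hb]; rfl) .skip
  have e2 := exec_split (k := b) (j := b + 1) (c := b + 2) (by omega) (by omega) (by omega)
    (enc x.1) _ (code x.2) (Function.update_self b (code x.1 ++ code x.2) S) (by simp [hS])
  refine ((e1.seq e2).mono ?_).congr ?_
  · rw [BinTree.length_str, size]; omega
  · have := hS (b + 1) (by omega)
    funext i; simp only [update_apply, code]; grind

theorem PolyTime.fst_prod : PolyTime (Prod.fst : α × β → α) := by
  refine ⟨fun b => .seq (.seq (.pop b .skip .skip .skip) (split b (b + 1) (b + 2)))
    (.seq (clear b) (mv (b + 1) b)), fun x => 100 * size x + 100,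
    ((PolyBdd.const _).mul .size).add (.const _), fun b x S hb hS => ?_⟩
  have e1 := exec_fst_split hb hS
  refine ((e1.seq ((exec_clear b _).seq (exec_mv (k := b + 1) (j := b) (by omega) _))).mono
    ?_).congr ?_
  · simp [length_code, size_prod]; omega
  · have := hS (b + 1) (by omega)
    funext i; simp only [update_apply]; grind

theorem PolyTime.snd_prod : PolyTime (Prod.snd : α × β → β) := by
  refine ⟨fun b => .seq (.seq (.pop b .skip .skip .skip) (split b (b + 1) (b + 2)))
    (clear (b + 1)), fun x => 100 * size x + 100,
    ((PolyBdd.const _).mul .size).add (.const _), fun b x S hb hS => ?_⟩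
  have e1 := exec_fst_split hb hS
  refine ((e1.seq (exec_clear (b + 1) _)).mono ?_).congr ?_
  · simp [length_code, size_prod]; omega
  · have := hS (b + 1) (by omega)
    funext i; simp only [update_apply]; grind

@[fun_prop]
theorem PolyTime.fst {f : α → β × γ} (hf : PolyTime f) : PolyTime fun a => (f a).1 :=
  PolyTime.fst_prod.comp hf

@[fun_prop]
theorem PolyTime.snd {f : α → β × γ} (hf : PolyTime f) : PolyTime fun a => (f a).2 :=
  PolyTime.snd_prod.comp hf

theorem PolyTime.val {p : α → Prop} : PolyTime (fun a : Subtype p => a.1) :=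
  PolyTime.cast fun _ => rfl

/-- Case distinction on whether a code is the trivial tree. -/
theorem PolyTime.byCases {c : α → BinTree} (hc : PolyTime c) {f : α → β}
    (hnil : PolyTime fun a : {a // c a = .nil} => f a)
    (hnode : PolyTime fun a : {a // c a ≠ .nil} => f a) : PolyTime f := by
  have hsc := hc.size_bdd
  obtain ⟨P, t, ht, h⟩ := hc
  obtain ⟨P0, t0, ⟨p0, hp0⟩, h0⟩ := hnil
  obtain ⟨P1, t1, ⟨p1, hp1⟩, h1⟩ := hnode
  -- The times of the two branches are defined on subtypes only, so their polynomial bounds enter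
  -- the time bound instead.
  refine ⟨fun b => .seq (copy b (b + 1) (b + 2)) (.seq (P (b + 1)) (.pop (b + 1) .skip (P0 b)
    (.seq (clear (b + 1)) (P1 b)))), fun a => 7 * (2 * size a + 1) + 10 + 2 * (2 * size (c a) + 1)
    + t a + p0.eval (size a) + p1.eval (size a), ?_, fun b a S hb hS => ?_⟩
  · have h1 : ∀ {m : α → ℕ}, PolyBdd m → ∀ n, PolyBdd fun a => n * (2 * m a + 1) :=
      fun hm n => (PolyBdd.const n).mul (((PolyBdd.const 2).mul hm).add (.const 1))
    exact (((((h1 .size 7).add (.const 10)).add (h1 hsc 2)).add ht).add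
      (PolyBdd.size.eval p0)).add (PolyBdd.size.eval p1)
  · have hS1 := hS (b + 1) (by omega)
    have hS2 := hS (b + 2) (by omega)
    have e1 := exec_copy (k := b) (j := b + 1) (s := b + 2) (by omega) (by omega) (by omega)
      S hS2 hS1
    have e2 := h (b + 1) a _ ((Function.update_self (b + 1) (S b) S).trans hb) (by
      intro k hk
      rw [update_apply, if_neg (by omega), hS k (by omega)])
    simp only [Function.update_idem] at e2
    have hl : (code (c a)).length = 2 * size (c a) + 1 := length_code _
    by_cases hca : c a = .nil
    · have e3 := h0 b ⟨a, hca⟩ (update S (b + 1) []) (by rw [update_apply, if_neg (by omega), hb]; rfl)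
        (fun k hk => by rw [update_apply]; split_ifs; exacts [rfl, hS k hk])
      have e4 : Exec (.pop (b + 1) .skip (P0 b) (.seq (clear (b + 1)) (P1 b)))
          (update S (b + 1) (code (c a))) _ _ :=
        .popFalse (l := []) (by rw [Function.update_self, hca]; rfl) (e3.congr rfl |> fun e => by
          rw [Function.update_idem]; exact e)
      refine ((e1.seq (e2.seq e4)).mono ?_).congr ?_
      · have := hp0 ⟨a, hca⟩
        change _ ≤ p0.eval (size a) at this
        beta_reduce
        rw [hb, length_code]; omega
      · funext i; simp only [update_apply]; grind
    · have e3 := h1 b ⟨a, hca⟩ (update S (b + 1) []) (by rw [update_apply, if_neg (by omega), hb]; rfl)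
        (fun k hk => by rw [update_apply]; split_ifs; exacts [rfl, hS k hk])
      obtain ⟨x, y, hxy⟩ : ∃ x y, c a = .node x y := by
        cases hx : c a with
        | nil => exact absurd hx hca
        | node x y => exact ⟨x, y, rfl⟩
      have e4 : Exec (.pop (b + 1) .skip (P0 b) (.seq (clear (b + 1)) (P1 b)))
          (update S (b + 1) (code (c a))) _ _ :=
        .popTrue (l := x.str ++ y.str) (by rw [Function.update_self, hxy]; rfl)
          ((exec_clear (b + 1) _).seq (by
            rw [Function.update_idem, Function.update_idem]; exact e3))
      refine ((e1.seq (e2.seq e4)).mono ?_).congr ?_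
      · have := hp1 ⟨a, hca⟩
        change _ ≤ p1.eval (size a) at this
        beta_reduce
        have hl2 : (x.str ++ y.str).length + 1 = (code (c a)).length := by
          rw [hxy]; rfl
        rw [hb, length_code, Function.update_self]; omega
      · funext i; simp only [update_apply]; grind

/-- Stack `b` is the counter, of which only the bits `true` trigger `f`; stack `b + 1` holds the
state. `N` bounds the cost of `f` along the orbit, for which the sizes of the intermediate states
have to be controlled. -/
theorem exec_iterate {f : σ → σ} {P : ℕ → StackProg} {t : σ → ℕ} {b N : ℕ}
    (h : ∀ b a (S : Store), S b = code a →
      (∀ k, b < k → S k = []) → Exec (P b) S (t a) (update S b (code (f a)))) (l : List Bool) :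
    ∀ (S : Store) (s : σ), S b = l → S (b + 1) = code s → (∀ k, b + 1 < k → S k = []) →
      (∀ i < l.count true, t (f^[i] s) ≤ N) →
      Exec (.loop b .skip (P (b + 1))) S ((N + 2) * l.length + 1)
        (update (update S b []) (b + 1) (code (f^[l.count true] s))) := by
  induction l with
  | nil =>
    intro S s hb hs hS _
    refine (Exec.loopNil hb).mono (by simp) |>.congr ?_
    simp only [List.count_nil, Function.iterate_zero, _root_.id]
    funext i; simp only [update_apply]; grind
  | cons c l ih =>
    intro S s hb hs hS ht
    cases c
    · refine ((Exec.loopFalse hb .skip (ih _ s (by simp) ?_ ?_ ?_)).mono ?_).congr ?_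
      · simp [hs]
      · intro k hk; rw [update_apply, if_neg (by omega), hS k hk]
      · simpa using ht
      · simp only [List.length_cons]; ring_nf; omega
      · funext i; simp only [update_apply]; grind
    · have e1 := h (b + 1) s (update S b l) (by simp [hs])
        (fun k hk => by rw [update_apply, if_neg (by omega), hS k hk])
      refine ((Exec.loopTrue hb e1 (ih _ (f s) ?_ (by simp) ?_ ?_)).mono ?_).congr ?_
      · simp
      · intro k hk; rw [update_apply, if_neg (by omega), update_apply, if_neg (by omega), hS k hk]
      · intro i hi
        exact ht (i + 1) (by simpa using hi)
      · have := ht 0 (by simp)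
        simp only [Function.iterate_zero, _root_.id] at this
        simp only [List.length_cons]; ring_nf; omega
      · simp only [List.count_cons_self, Function.iterate_succ_apply]
        funext i; simp only [update_apply]; grind

/-- Iteration of a function along the nodes of a tree. -/
theorem PolyTime.iterate {f : σ → σ} (hf : PolyTime f) {c : α → BinTree} (hc : PolyTime c)
    {s : α → σ} (hs : PolyTime s) {m : α → ℕ} (hm : PolyBdd m)
    (hfm : ∀ a, ∀ i ≤ (c a).nodes, size (f^[i] (s a)) ≤ m a) :
    PolyTime fun a => f^[(c a).nodes] (s a) := by
  have hi := hc.prodMk hs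
  have hsc := hc.size_bdd
  have hss := hs.size_bdd
  obtain ⟨P, t, ⟨p, hp⟩, h⟩ := hf
  obtain ⟨P', t', ht', h'⟩ := hi
  -- Splitting leaves the state on `b` and the reversed counter on `b + 1`; three moves put the
  -- counter on `b` and the state on `b + 1`, both in the right order. After the loop `b` is empty,
  -- and two moves bring the state back.
  refine ⟨fun b => .seq (P' b) (.seq (.seq (.pop b .skip .skip .skip) (split b (b + 1) (b + 2)))
    (.seq (mv b (b + 2)) (.seq (mv (b + 1) b) (.seq (mv (b + 2) (b + 1))
    (.seq (.loop b .skip (P (b + 1))) (.seq (mv (b + 1) (b + 2)) (mv (b + 2) b))))))),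
    fun a => t' a + (20 * size (c a) + 20 * size (s a) + 20 * m a + 100) +
      (p.eval (m a) + 2) * (2 * size (c a) + 1), ?_, fun b a S hb hS => ?_⟩
  · exact (ht'.add (((((PolyBdd.const 20).mul hsc).add ((PolyBdd.const 20).mul hss)).add
      ((PolyBdd.const 20).mul hm)).add (.const 100))).add
      (((hm.eval p).add (.const 2)).mul (((PolyBdd.const 2).mul hsc).add (.const 1)))
  · have hS1 := hS (b + 1) (by omega)
    have hS2 := hS (b + 2) (by omega)
    have e1 := h' b a S hb hS
    have hS' : ∀ k, b < k → update S b (code (c a, s a)) k = [] := fun k hk => by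
      rw [update_apply, if_neg (by omega), hS k hk]
    have e2 := exec_fst_split (Function.update_self b (code (c a, s a)) S) hS'
    have e6 := exec_iterate (b := b) (N := p.eval (m a)) h (code (c a))
      (update (update S b (code (c a))) (b + 1) (code (s a))) (s a) (by simp) (by simp)
      (fun k hk => by
        rw [update_apply, if_neg (by omega), update_apply, if_neg (by omega), hS k (by omega)])
      (fun i hi => (hp _).trans (p.eval_mono_nat (hfm a i (by
        rw [code, BinTree.count_str] at hi; exact hi.le))))
    have hcnt : (code (c a)).count true = (c a).nodes := BinTree.count_str _
    rw [hcnt] at e6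
    have hlast := hfm a _ le_rfl
    refine ((e1.seq (e2.seq ((exec_mv (k := b) (j := b + 2) (by omega) _).seq
      ((exec_mv (k := b + 1) (j := b) (by omega) _).seq
      (((exec_mv (k := b + 2) (j := b + 1) (by omega) _).congr ?_).seq
      (e6.seq ((exec_mv (k := b + 1) (j := b + 2) (by omega) _).seq
      (exec_mv (k := b + 2) (j := b) (by omega) _)))))))).mono ?_).congr ?_
    · funext i; simp only [update_apply]; grind
    · simp [length_code, hS2]; omega
    · funext i; simp only [update_apply]; grind

end

/-! ### Lists, Booleans and sums; case distinctions and folds. -/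

namespace Data

variable {α β : Type*} [Data α] [Data β]

/-- The code of a list. -/
def encList : List α → BinTree
  | [] => .nil
  | x :: l => .node (enc x) (encList l)

instance : Data (List α) := ⟨encList⟩

instance : Data Bool := ⟨fun b => bif b then .node .nil .nil else .nil⟩

instance : Data (α ⊕ β) :=
  ⟨Sum.elim (fun a => .node .nil (enc a)) (fun b => .node (.node .nil .nil) (enc b))⟩

@[simp] theorem size_nil : size ([] : List α) = 0 := rfl

@[simp] theorem size_cons (x : α) (l : List α) : size (x :: l) = size x + size l + 1 := rfl

@[simp] theorem size_pair (x : α) (y : β) : size (x, y) = size x + size y + 1 := rfl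

@[simp] theorem size_inl (x : α) : size (Sum.inl x : α ⊕ β) = size x + 1 := by
  change 0 + size x + 1 = _
  omega

@[simp] theorem size_inr (x : β) : size (Sum.inr x : α ⊕ β) = size x + 2 := by
  change 0 + 0 + 1 + size x + 1 = _
  omega

theorem size_bool_le (b : Bool) : size b ≤ 1 := by
  cases b
  · exact Nat.zero_le _
  · exact le_rfl

@[simp] theorem size_append (l m : List α) : size (l ++ m) = size l + size m := by
  induction l with
  | nil => simp
  | cons x l ih => simp [ih]; ring

theorem length_le_size (l : List α) : l.length ≤ size l := by
  induction l with
  | nil => simp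
  | cons x l ih => simp; omega

theorem size_reverse (l : List α) : size l.reverse = size l := by
  induction l with
  | nil => simp
  | cons x l ih => simp [ih]; ring

theorem size_le_of_mem {x : α} {l : List α} (h : x ∈ l) : size x ≤ size l := by
  induction l with
  | nil => simp at h
  | cons y l ih =>
    rcases List.mem_cons.1 h with rfl | h
    · simp; omega
    · have := ih h; simp; omega

theorem size_drop_le (i : ℕ) (l : List α) : size (l.drop i) ≤ size l := by
  conv_rhs => rw [← List.take_append_drop i l, size_append]
  omega

theorem size_le_mul {l : List α} {n : ℕ} (h : ∀ x ∈ l, size x ≤ n) :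
    size l ≤ l.length * (n + 1) := by
  induction l with
  | nil => simp
  | cons x l ih =>
    have h1 := h x (by simp)
    have h2 := ih fun y hy => h y (by simp [hy])
    simp only [size_cons, List.length_cons]
    linarith

theorem size_prefix_le {l m : List α} (h : l <+: m) : size l ≤ size m := by
  obtain ⟨r, rfl⟩ := h
  simp

end Data

section

variable {α β γ δ σ : Type*} [Data α] [Data β] [Data γ] [Data δ] [Data σ]

theorem PolyTime.congr {f g : α → β} (hf : PolyTime f) (h : ∀ a, f a = g a) : PolyTime g :=
  funext h ▸ hf

theorem PolyTime.enc {f : α → β} (hf : PolyTime f) : PolyTime fun a => enc (f a) :=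
  hf.of_enc (fun a => a) (fun _ => rfl) (fun _ => rfl)

@[fun_prop]
theorem PolyTime.cons {f : α → β} {g : α → List β} (hf : PolyTime f) (hg : PolyTime g) :
    PolyTime fun a => f a :: g a :=
  (hf.prodMk hg).of_enc (fun a => a) (fun _ => rfl) (fun _ => rfl)

/-- The code of a nonempty list is already the code of the pair of its head and tail, so on the
subtype where `f a` is nonempty the decomposition costs nothing. Describing `F` by equations makes
the lemma fit functions defined by pattern matching. -/
theorem PolyTime.listCases {f : α → List β} (hf : PolyTime f) {g : α → γ} (hg : PolyTime g)
    {h : α → β → List β → γ} (hh : PolyTime fun x : α × β × List β => h x.1 x.2.1 x.2.2)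
    {F : α → γ} (hnil : ∀ a, f a = [] → F a = g a)
    (hcons : ∀ a x l, f a = x :: l → F a = h a x l) : PolyTime F := by
  refine PolyTime.byCases hf.enc ?_ ?_
  · refine (hg.comp .val).congr fun ⟨a, ha⟩ => (hnil a ?_).symm
    cases hl : f a with
    | nil => rfl
    | cons x l => rw [hl] at ha; cases ha
  · have key : ∀ a : {a // Data.enc (f a) ≠ .nil}, ∃ x : β × List β, f a = x.1 :: x.2 := by
      rintro ⟨a, ha⟩
      cases hl : f a with
      | nil => exact absurd (by rw [hl]; rfl) ha
      | cons x l => exact ⟨(x, l), rfl⟩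
    choose x hx using key
    have hx' : PolyTime fun a : {a // Data.enc (f a) ≠ .nil} => (a.1, x a) :=
      (PolyTime.val.prodMk (hf.comp .val)).of_enc (fun a => a) (fun _ => rfl) fun a => by
        change BinTree.node _ _ = BinTree.node _ (Data.enc (f a))
        rw [hx a]; rfl
    exact (hh.comp hx').congr fun a => (hcons _ _ _ (hx a)).symm

@[fun_prop]
theorem PolyTime.inl {f : α → β} (hf : PolyTime f) : PolyTime fun a => (Sum.inl (f a) : β ⊕ γ) :=
  ((PolyTime.const BinTree.nil).prodMk hf).of_enc (fun a => a) (fun _ => rfl) (fun _ => rfl)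

@[fun_prop]
theorem PolyTime.inr {f : α → γ} (hf : PolyTime f) : PolyTime fun a => (Sum.inr (f a) : β ⊕ γ) :=
  ((PolyTime.const (BinTree.node .nil .nil)).prodMk hf).of_enc (fun a => a)
    (fun _ => rfl) (fun _ => rfl)

/-- A sum is coded as the pair of a tag and a value; `f'` exposes this pair, and the tag decides. -/
theorem PolyTime.sumCases {f : α → β ⊕ γ} (hf : PolyTime f)
    {g : α → β → δ} (hg : PolyTime fun x : α × β => g x.1 x.2)
    {h : α → γ → δ} (hh : PolyTime fun x : α × γ => h x.1 x.2)
    {F : α → δ} (hinl : ∀ a x, f a = .inl x → F a = g a x)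
    (hinr : ∀ a x, f a = .inr x → F a = h a x) : PolyTime F := by
  let f' : α → BinTree × BinTree := fun a => Sum.elim (fun x => (.nil, Data.enc x))
    (fun x => (.node .nil .nil, Data.enc x)) (f a)
  have hf' : PolyTime f' := hf.of_enc (fun a => a) (fun _ => rfl) fun a => by
    simp only [f']
    cases f a <;> rfl
  refine PolyTime.byCases (c := fun a => (f' a).1) hf'.fst ?_ ?_
  · have key : ∀ a : {a // (f' a).1 = .nil}, ∃ x : β, f a = .inl x := by
      rintro ⟨a, ha⟩
      cases hl : f a with
      | inl x => exact ⟨x, rfl⟩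
      | inr x => simp [f', hl] at ha
    choose x hx using key
    have hx' : PolyTime x := (hf'.comp .val).snd.of_enc (fun a => a) (fun _ => rfl) fun a => by
      simp only [f', hx a]; rfl
    exact (hg.comp (PolyTime.val.prodMk hx')).congr fun a => (hinl _ _ (hx a)).symm
  · have key : ∀ a : {a // (f' a).1 ≠ .nil}, ∃ x : γ, f a = .inr x := by
      rintro ⟨a, ha⟩
      cases hl : f a with
      | inl x => simp [f', hl] at ha
      | inr x => exact ⟨x, rfl⟩
    choose x hx using key
    have hx' : PolyTime x := (hf'.comp .val).snd.of_enc (fun a => a) (fun _ => rfl) fun a => by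
      simp only [f', hx a]; rfl
    exact (hh.comp (PolyTime.val.prodMk hx')).congr fun a => (hinr _ _ (hx a)).symm

@[fun_prop]
theorem PolyTime.cond {c : α → Bool} (hc : PolyTime c) {f g : α → β} (hf : PolyTime f)
    (hg : PolyTime g) : PolyTime fun a => bif c a then f a else g a := by
  refine PolyTime.byCases hc.enc ?_ ?_
  · refine (hg.comp .val).congr fun ⟨a, ha⟩ => ?_
    cases h : c a
    · rfl
    · rw [h] at ha; cases ha
  · refine (hf.comp .val).congr fun ⟨a, ha⟩ => ?_
    cases h : c a
    · rw [h] at ha; exact absurd rfl ha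
    · rfl

@[fun_prop]
theorem PolyTime.and {f g : α → Bool} (hf : PolyTime f) (hg : PolyTime g) :
    PolyTime fun a => f a && g a :=
  (hf.cond hg (.const false)).congr fun a => by cases f a <;> rfl

@[fun_prop]
theorem PolyTime.or {f g : α → Bool} (hf : PolyTime f) (hg : PolyTime g) :
    PolyTime fun a => f a || g a :=
  (hf.cond (.const true) hg).congr fun a => by cases f a <;> rfl

@[fun_prop]
theorem PolyTime.not {f : α → Bool} (hf : PolyTime f) : PolyTime fun a => !f a :=
  (hf.cond (.const false) (.const true)).congr fun a => by cases f a <;> rfl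

@[fun_prop]
theorem PolyTime.xor {f g : α → Bool} (hf : PolyTime f) (hg : PolyTime g) :
    PolyTime fun a => Bool.xor (f a) (g a) :=
  (hf.cond hg.not hg).congr fun a => by cases f a <;> simp

@[fun_prop]
theorem PolyTime.headD {f : α → List β} (hf : PolyTime f) {d : α → β} (hd : PolyTime d) :
    PolyTime fun a => (f a).headD (d a) :=
  hf.listCases (h := fun _ x _ => x) hd (by fun_prop) (fun a h => by simp [h])
    (fun a x l h => by simp [h])

@[fun_prop]
theorem PolyTime.tail {f : α → List β} (hf : PolyTime f) : PolyTime fun a => (f a).tail :=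
  hf.listCases (h := fun _ _ l => l) (g := fun _ => []) (by fun_prop) (by fun_prop)
    (fun a h => by simp [h]) (fun a x l h => by simp [h])

@[fun_prop]
theorem PolyTime.isEmpty {f : α → List β} (hf : PolyTime f) : PolyTime fun a => (f a).isEmpty :=
  hf.listCases (h := fun _ _ _ => false) (g := fun _ => true) (by fun_prop) (by fun_prop)
    (fun a h => by simp [h]) (fun a x l h => by simp [h])

/-- One step of the computation of a fold: process the first element of the remaining list. -/
def foldStep (h : α → σ → β → σ) : α × List β × σ → α × List β × σ
  | (a, [], s) => (a, [], s)
  | (a, x :: l, s) => (a, l, h a s x)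

-- The step is stationary once the list is empty, so surplus iterations do no harm.
omit [Data α] [Data β] [Data σ] in
theorem foldStep_iterate (h : α → σ → β → σ) (a : α) (i : ℕ) (l : List β) (s : σ) :
    (foldStep h)^[i] (a, l, s) = (a, l.drop i, (l.take i).foldl (h a) s) := by
  induction i generalizing l s with
  | zero => simp
  | succ i ih =>
    rw [Function.iterate_succ_apply]
    cases l with
    | nil => simp [foldStep, ih]
    | cons x l => simp [foldStep, ih]

/-- The tree of a list has at least as many inner nodes as the list has elements, so iteration along
this tree exhausts the list. The bound `hsize` on all intermediate results is essential: without it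
a state could double in each step. -/
theorem PolyTime.foldl {f : α → List β} (hf : PolyTime f) {g : α → σ} (hg : PolyTime g)
    {h : α → σ → β → σ} (hh : PolyTime fun x : α × σ × β => h x.1 x.2.1 x.2.2) {m : α → ℕ}
    (hm : PolyBdd m) (hsize : ∀ a l, l <+: f a → size (l.foldl (h a) (g a)) ≤ m a) :
    PolyTime fun a => (f a).foldl (h a) (g a) := by
  have hstep : PolyTime (foldStep h) := by
    refine PolyTime.listCases (f := fun x : α × List β × σ => x.2.1) (by fun_prop)
      (g := fun x => x) (by fun_prop) (h := fun y x l => (y.1, l, h y.1 y.2.2 x)) ?_ ?_ ?_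
    · have := hh.comp (f := fun y : (α × List β × σ) × β × List β => (y.1.1, y.1.2.2, y.2.1))
        (by fun_prop)
      fun_prop
    · rintro ⟨a, l, s⟩ ⟨⟩; rfl
    · rintro ⟨a, l, s⟩ x l' ⟨⟩; rfl
  have := (hstep.iterate hf.enc (s := fun a => (a, f a, g a)) (by fun_prop)
    (m := fun a => size a + size (f a) + m a + 2)
    (((PolyBdd.size.add hf.size_bdd).add hm).add (.const 2)) ?_).snd.snd
  · refine this.congr fun a => ?_
    have : (f a).length ≤ (Data.enc (f a)).nodes := length_le_size _
    rw [foldStep_iterate, List.take_of_length_le this]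
  · intro a i _
    rw [foldStep_iterate]
    have h1 := size_drop_le i (f a)
    have h2 := hsize a _ (List.take_prefix i (f a))
    simp only [size_pair]
    omega

@[fun_prop]
theorem PolyTime.reverse {f : α → List β} (hf : PolyTime f) : PolyTime fun a => (f a).reverse := by
  have key : ∀ l m : List β, l.foldl (fun s x => x :: s) m = l.reverse ++ m := by
    intro l
    induction l with
    | nil => simp
    | cons x l ih => simp [ih]
  refine (hf.foldl (g := fun _ => []) (by fun_prop) (h := fun _ s x => x :: s) (by fun_prop)
    hf.size_bdd ?_).congr fun a => by rw [key, List.append_nil]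
  intro a l hl
  rw [key, List.append_nil, size_reverse]
  exact size_prefix_le hl

@[fun_prop]
theorem PolyTime.append {f g : α → List β} (hf : PolyTime f) (hg : PolyTime g) :
    PolyTime fun a => f a ++ g a := by
  have key : ∀ l m : List β, l.foldl (fun s x => x :: s) m = l.reverse ++ m := by
    intro l
    induction l with
    | nil => simp
    | cons x l ih => simp [ih]
  refine (hf.reverse.foldl hg (h := fun _ s x => x :: s) (by fun_prop)
    (hf.size_bdd.add hg.size_bdd) ?_).congr fun a => by rw [key, List.reverse_reverse]
  intro a l hl
  have := size_prefix_le hl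
  rw [key, size_append, size_reverse]
  rw [size_reverse] at this
  omega

theorem PolyTime.flatMap {f : α → List β} (hf : PolyTime f) {h : α → β → List γ}
    (hh : PolyTime fun x : α × β => h x.1 x.2) : PolyTime fun a => (f a).flatMap (h a) := by
  have key : ∀ (a : α) (l : List β) (m : List γ),
      l.foldl (fun s x => s ++ h a x) m = m ++ l.flatMap (h a) := by
    intro a l
    induction l with
    | nil => simp
    | cons x l ih => simp [ih]
  obtain ⟨p, hp⟩ := hh.size_bdd
  refine (hf.foldl (g := fun _ => []) (by fun_prop) (h := fun a s x => s ++ h a x) ?_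
    (m := fun a => size (f a) * p.eval (size a + size (f a) + 1))
    (hf.size_bdd.mul (((PolyBdd.size.add hf.size_bdd).add (.const 1)).eval p)) ?_).congr
    fun a => by rw [key, List.nil_append]
  · have := hh.comp (f := fun x : α × List γ × β => (x.1, x.2.2)) (by fun_prop)
    fun_prop
  · intro a l hl
    rw [key, List.nil_append]
    have h1 : ∀ x ∈ l, size (h a x) ≤ p.eval (size a + size (f a) + 1) := by
      intro x hx
      refine (hp (a, x)).trans (p.eval_mono_nat ?_)
      have := size_le_of_mem (hl.subset hx)
      simp only [size_pair]
      omega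
    have h2 : size (l.flatMap (h a)) ≤ l.length * p.eval (size a + size (f a) + 1) := by
      clear hl
      induction l with
      | nil => simp
      | cons x l ih =>
        have := ih fun y hy => h1 y (by simp [hy])
        have := h1 x (by simp)
        simp only [List.flatMap_cons, size_append, List.length_cons]
        linarith
    refine h2.trans (Nat.mul_le_mul_right _ ?_)
    exact (length_le_size l).trans (size_prefix_le hl)

theorem PolyTime.map {f : α → List β} (hf : PolyTime f) {h : α → β → γ}
    (hh : PolyTime fun x : α × β => h x.1 x.2) : PolyTime fun a => (f a).map (h a) := by
  refine (hf.flatMap (h := fun a x => [h a x]) (by fun_prop)).congr fun a => ?_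
  induction f a with
  | nil => rfl
  | cons x l ih => rw [List.flatMap_cons, ih]; rfl

theorem PolyTime.filter {f : α → List β} (hf : PolyTime f) {h : α → β → Bool}
    (hh : PolyTime fun x : α × β => h x.1 x.2) : PolyTime fun a => (f a).filter (h a) := by
  refine (hf.flatMap (h := fun a x => bif h a x then [x] else []) (by fun_prop)).congr fun a => ?_
  induction f a with
  | nil => rfl
  | cons x l ih =>
    rw [List.flatMap_cons, ih, List.filter_cons]
    cases h a x <;> simp

theorem PolyTime.all {f : α → List β} (hf : PolyTime f) {h : α → β → Bool}
    (hh : PolyTime fun x : α × β => h x.1 x.2) : PolyTime fun a => (f a).all (h a) := by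
  refine ((hf.filter (h := fun a x => !h a x) (by fun_prop)).isEmpty).congr fun a => ?_
  rw [Bool.eq_iff_iff]
  simp [List.filter_eq_nil_iff]

end

/-! ### Binary arithmetic in polynomial time. -/

instance : Data ℕ := ⟨fun n => Data.enc n.bits⟩

namespace Data

theorem natSize_le_size (n : ℕ) : n.size ≤ size n := by
  rw [← Nat.size_eq_bits_len]
  exact length_le_size n.bits

theorem size_le_natSize (n : ℕ) : size n ≤ 2 * n.size := by
  rw [← Nat.size_eq_bits_len, mul_comm]
  exact size_le_mul fun b _ => size_bool_le b

/-- The factor 2 is due to the digit `true` being a larger tree than `false`: the size of a number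
lies between its number of digits and twice that. -/
theorem size_nat_mono {m n : ℕ} (h : m ≤ n) : size m ≤ 2 * size n := by
  have h1 := size_le_natSize m
  have h2 := natSize_le_size n
  have h3 := Nat.size_le_size h
  omega

theorem size_nat_le (n : ℕ) : size n ≤ 2 * n := by
  have h1 := size_le_natSize n
  have h2 : n.size ≤ n := Nat.size_le.2 Nat.lt_two_pow_self
  omega

end Data

theorem Nat.bits_isEmpty (n : ℕ) : n.bits.isEmpty = n.beq 0 := by
  rw [Bool.eq_iff_iff, List.isEmpty_iff, ← List.length_eq_zero_iff, Nat.size_eq_bits_len,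
    Nat.size_eq_zero, Nat.beq_eq]

/-- Append binary digits, most significant digit first, to a number. -/
def Nat.appendBits (n : ℕ) (l : List Bool) : ℕ := l.foldl (fun m b => Nat.bit b m) n

/-- Append binary digits, most significant digit first, to an integer. -/
def Int.appendBits (z : ℤ) (l : List Bool) : ℤ := l.foldl (fun z b => 2 * z + b.toNat) z

theorem Nat.cast_appendBits (n : ℕ) (l : List Bool) :
    ((n.appendBits l : ℕ) : ℤ) = Int.appendBits n l := by
  induction l generalizing n with
  | nil => rfl
  | cons b l ih =>
    have := ih (Nat.bit b n)
    simp only [Nat.bit_val] at this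
    push_cast at this
    simpa [Nat.appendBits, Int.appendBits, Nat.bit_val] using this

theorem Int.appendBits_neg {z : ℤ} (hz : z < 0) (l : List Bool) : z.appendBits l < 0 := by
  induction l generalizing z with
  | nil => exact hz
  | cons b l ih => exact ih (by cases b <;> simp <;> omega)

theorem Nat.appendBits_lt (n : ℕ) (l : List Bool) :
    n.appendBits l < (n + 1) * 2 ^ l.length := by
  induction l generalizing n with
  | nil => simp [Nat.appendBits]
  | cons b l ih =>
    refine (ih (Nat.bit b n)).trans_le ?_
    rw [List.length_cons, pow_succ', ← mul_assoc]
    gcongr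
    rw [Nat.bit_val]
    have := Bool.toNat_lt b
    omega

theorem Nat.size_appendBits_le (n : ℕ) (l : List Bool) :
    (n.appendBits l).size ≤ n.size + l.length := by
  rw [Nat.size_le, pow_add]
  refine (Nat.appendBits_lt n l).trans_le ?_
  gcongr
  exact Nat.lt_size_self n

/-- One step of binary addition or subtraction: the two numbers, the carry, and the digits of the
result, most significant digit first. -/
def rippleStep (s : Bool) (x : ℕ × ℕ × Bool × List Bool) : ℕ × ℕ × Bool × List Bool :=
  (x.1.div2, x.2.1.div2,
    ((s ^^ x.1.bodd) && x.2.1.bodd) || ((s ^^ x.1.bodd) && x.2.2.1) || (x.2.1.bodd && x.2.2.1),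
    (x.1.bodd ^^ x.2.1.bodd ^^ x.2.2.1) :: x.2.2.2)

/-- Binary addition or subtraction, with as many steps as a list has elements. -/
def ripple (s : Bool) (n m : ℕ) (l : List Bool) : ℕ × ℕ × Bool × List Bool :=
  l.foldl (fun x _ => rippleStep s x) (n, m, false, [])

theorem ripple_append_singleton (s : Bool) (n m : ℕ) (l : List Bool) (b : Bool) :
    ripple s n m (l ++ [b]) = rippleStep s (ripple s n m l) := by
  simp [ripple]

theorem ripple_fst (s : Bool) (n m : ℕ) (l : List Bool) :
    (ripple s n m l).1 = n / 2 ^ l.length ∧ (ripple s n m l).2.1 = m / 2 ^ l.length := by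
  induction l using List.reverseRecOn with
  | nil => simp [ripple]
  | append_singleton l b ih =>
    rw [ripple_append_singleton, rippleStep, Nat.div2_val, Nat.div2_val, ih.1, ih.2,
      Nat.div_div_eq_div_mul, Nat.div_div_eq_div_mul, List.length_append, List.length_singleton,
      pow_succ]
    exact ⟨rfl, rfl⟩

theorem length_ripple (s : Bool) (n m : ℕ) (l : List Bool) :
    (ripple s n m l).2.2.2.length = l.length := by
  induction l using List.reverseRecOn with
  | nil => rfl
  | append_singleton l b ih => rw [ripple_append_singleton]; simp [rippleStep, ih]

/-- The value which is represented by the state of a binary addition or subtraction. -/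
def rippleVal (s : Bool) (x : ℕ × ℕ × Bool × List Bool) : ℤ :=
  Int.appendBits (x.1 + (bif s then -1 else 1) * (x.2.1 + x.2.2.1.toNat)) x.2.2.2

/-- The invariant of schoolbook arithmetic: the new digit is the parity of the two digits and the
carry, and the new carry is their majority. Complementing the first digit in the majority turns the
carry into a borrow. -/
theorem rippleVal_step (s : Bool) (x : ℕ × ℕ × Bool × List Bool) :
    rippleVal s (rippleStep s x) = rippleVal s x := by
  obtain ⟨n, m, c, out⟩ := x
  simp only [rippleVal, rippleStep, Int.appendBits, List.foldl_cons]
  congr 1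
  have hn := Nat.bit_bodd_div2 n
  have hm := Nat.bit_bodd_div2 m
  rw [Nat.bit_val] at hn hm
  generalize n.div2 = n', n.bodd = n0 at *
  generalize m.div2 = m', m.bodd = m0 at *
  subst hn hm
  cases s <;> cases n0 <;> cases m0 <;> cases c <;> simp <;> ring

theorem rippleVal_ripple (s : Bool) (n m : ℕ) (l : List Bool) :
    rippleVal s (ripple s n m l) = n + (bif s then -1 else 1) * m := by
  induction l using List.reverseRecOn with
  | nil => simp [ripple, rippleVal, Int.appendBits]
  | append_singleton l b ih => rw [ripple_append_singleton, rippleVal_step, ih]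

/-- After as many steps as both numbers have digits together, nothing is left of them, and only the
carry stands in front of the digits. -/
theorem rippleVal_bits (s : Bool) (n m : ℕ) :
    Int.appendBits ((bif s then -1 else 1) * (ripple s n m (n.bits ++ m.bits)).2.2.1.toNat)
      (ripple s n m (n.bits ++ m.bits)).2.2.2 = n + (bif s then -1 else 1) * m := by
  rw [← rippleVal_ripple s n m (n.bits ++ m.bits), rippleVal, (ripple_fst _ _ _ _).1,
    (ripple_fst _ _ _ _).2, List.length_append, Nat.size_eq_bits_len, Nat.size_eq_bits_len,
    Nat.div_eq_of_lt, Nat.div_eq_of_lt]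
  · simp
  · rw [pow_add]
    exact (Nat.lt_size_self m).trans_le (Nat.le_mul_of_pos_left _ (by positivity))
  · rw [pow_add]
    exact (Nat.lt_size_self n).trans_le (Nat.le_mul_of_pos_right _ (by positivity))

theorem add_eq_ripple (n m : ℕ) :
    Nat.appendBits (bif (ripple false n m (n.bits ++ m.bits)).2.2.1 then 1 else 0)
      (ripple false n m (n.bits ++ m.bits)).2.2.2 = n + m := by
  have h := rippleVal_bits false n m
  generalize ripple false n m (n.bits ++ m.bits) = x at *
  zify
  rw [Nat.cast_appendBits]
  cases hc : x.2.2.1 <;> simpa [hc] using h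

/-- A borrow that remains at the end shows that the integer difference is negative, where truncated
subtraction gives 0. -/
theorem sub_eq_ripple (n m : ℕ) :
    (bif (ripple true n m (n.bits ++ m.bits)).2.2.1 then 0 else
      Nat.appendBits 0 (ripple true n m (n.bits ++ m.bits)).2.2.2) = n - m := by
  have h := rippleVal_bits true n m
  generalize ripple true n m (n.bits ++ m.bits) = x at *
  cases hc : x.2.2.1
  · have h2 := Nat.cast_appendBits 0 x.2.2.2
    simp [hc] at h h2 ⊢
    omega
  · simp only [hc, cond_true, Bool.toNat_true] at h ⊢
    have := Int.appendBits_neg (z := -1) (by simp) x.2.2.2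
    simp at h
    omega

section

variable {α β γ δ σ : Type*} [Data α] [Data β] [Data γ] [Data δ] [Data σ]

@[fun_prop]
theorem PolyTime.bits {f : α → ℕ} (hf : PolyTime f) : PolyTime fun a => (f a).bits :=
  hf.of_enc (fun a => a) (fun _ => rfl) (fun _ => rfl)

theorem PolyTime.of_bits {f : α → ℕ} (hf : PolyTime fun a => (f a).bits) : PolyTime f :=
  hf.of_enc (fun a => a) (fun _ => rfl) (fun _ => rfl)

theorem PolyTime.beq_zero {f : α → ℕ} (hf : PolyTime f) : PolyTime fun a => (f a).beq 0 :=
  hf.bits.isEmpty.congr fun _ => Nat.bits_isEmpty _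

@[fun_prop]
theorem PolyTime.bodd {f : α → ℕ} (hf : PolyTime f) : PolyTime fun a => (f a).bodd :=
  (hf.bits.headD (.const false)).congr fun a => by
    rw [Nat.bodd_eq_bits_head]; cases (f a).bits <;> rfl

@[fun_prop]
theorem PolyTime.div2 {f : α → ℕ} (hf : PolyTime f) : PolyTime fun a => (f a).div2 :=
  PolyTime.of_bits (hf.bits.tail.congr fun _ => (Nat.div2_bits_eq_tail _).symm)

@[fun_prop]
theorem PolyTime.bit {f : α → Bool} {g : α → ℕ} (hf : PolyTime f) (hg : PolyTime g) :
    PolyTime fun a => Nat.bit (f a) (g a) := by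
  refine PolyTime.of_bits ((PolyTime.cond (c := fun a => !f a && (g a).beq 0)
    (hf.not.and hg.beq_zero) (.const []) (hf.cons hg.bits)).congr fun a => ?_)
  cases hfa : f a
  · by_cases hga : g a = 0
    · simp [hga]
    · rw [Nat.bits_append_bit _ _ (fun h => absurd h hga)]
      have : (g a).beq 0 = false := by rw [← Bool.not_eq_true, Nat.beq_eq]; exact hga
      rw [this]; rfl
  · rw [Nat.bits_append_bit _ _ (fun _ => rfl)]; rfl

@[fun_prop]
theorem PolyTime.appendBits {f : α → ℕ} {g : α → List Bool} (hf : PolyTime f) (hg : PolyTime g) :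
    PolyTime fun a => (f a).appendBits (g a) := by
  refine hg.foldl hf (h := fun _ m b => Nat.bit b m) (by fun_prop)
    (m := fun a => 2 * (size (f a) + size (g a)))
    ((PolyBdd.const 2).mul (hf.size_bdd.add hg.size_bdd)) fun a l hl => ?_
  have h1 := Nat.size_appendBits_le (f a) l
  have h2 := natSize_le_size (f a)
  have h3 := (length_le_size l).trans (size_prefix_le hl)
  refine (size_le_natSize _).trans ?_
  change 2 * ((f a).appendBits l).size ≤ _
  omega

theorem PolyTime.ripple (s : Bool) {f g : α → ℕ} (hf : PolyTime f) (hg : PolyTime g) :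
    PolyTime fun a => ripple s (f a) (g a) ((f a).bits ++ (g a).bits) := by
  refine PolyTime.foldl (f := fun a => (f a).bits ++ (g a).bits) (by fun_prop)
    (g := fun a => (f a, g a, false, [])) (by fun_prop)
    (h := fun _ x _ => rippleStep s x) (by unfold rippleStep; fun_prop)
    (m := fun a => 4 * size (f a) + 4 * size (g a) + 4)
    ((((PolyBdd.const 4).mul hf.size_bdd).add ((PolyBdd.const 4).mul hg.size_bdd)).add
      (.const 4)) fun a l hl => ?_
  change size (_root_.ripple s (f a) (g a) l) ≤ _
  have h0 := length_le_size l
  have h0' := size_prefix_le hl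
  have h1 := (ripple_fst s (f a) (g a) l).1
  have h2 := (ripple_fst s (f a) (g a) l).2
  have h3 := length_ripple s (f a) (g a) l
  generalize _root_.ripple s (f a) (g a) l = x at *
  obtain ⟨n, m, c, out⟩ := x
  have h4 : size n ≤ 2 * size (f a) := size_nat_mono (h1.trans_le (Nat.div_le_self _ _))
  have h5 : size m ≤ 2 * size (g a) := size_nat_mono (h2.trans_le (Nat.div_le_self _ _))
  have h6 := size_bool_le c
  have h7 := size_le_mul (l := out) (n := 1) fun b _ => size_bool_le b
  have h8 : size (f a).bits = size (f a) := rfl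
  have h9 : size (g a).bits = size (g a) := rfl
  rw [size_append] at h0'
  simp only [size_pair]
  simp only at h3
  omega

@[fun_prop]
theorem PolyTime.add {f g : α → ℕ} (hf : PolyTime f) (hg : PolyTime g) :
    PolyTime fun a => f a + g a := by
  have h := PolyTime.ripple false hf hg
  refine PolyTime.congr ?_ fun a => add_eq_ripple (f a) (g a)
  fun_prop

@[fun_prop]
theorem PolyTime.sub {f g : α → ℕ} (hf : PolyTime f) (hg : PolyTime g) :
    PolyTime fun a => f a - g a := by
  have h := PolyTime.ripple true hf hg
  refine PolyTime.congr ?_ fun a => sub_eq_ripple (f a) (g a)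
  fun_prop

@[fun_prop]
theorem PolyTime.ble {f g : α → ℕ} (hf : PolyTime f) (hg : PolyTime g) :
    PolyTime fun a => (f a).ble (g a) :=
  (hf.sub hg).beq_zero.congr fun a => by
    rw [Bool.eq_iff_iff, Nat.beq_eq, Nat.ble_eq, Nat.sub_eq_zero_iff_le]

@[fun_prop]
theorem PolyTime.beq {f g : α → ℕ} (hf : PolyTime f) (hg : PolyTime g) :
    PolyTime fun a => (f a).beq (g a) :=
  ((hf.ble hg).and (hg.ble hf)).congr fun a => by
    rw [Bool.eq_iff_iff, Bool.and_eq_true, Nat.beq_eq, Nat.ble_eq, Nat.ble_eq]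
    omega

@[fun_prop]
theorem PolyTime.max {f g : α → ℕ} (hf : PolyTime f) (hg : PolyTime g) :
    PolyTime fun a => max (f a) (g a) :=
  ((hf.ble hg).cond hg hf).congr fun a => by
    cases h : (f a).ble (g a)
    · rw [cond_false, max_eq_left]
      by_contra h'
      rw [← Bool.not_eq_true, Nat.ble_eq] at h
      omega
    · rw [cond_true, max_eq_right]
      rw [Nat.ble_eq] at h
      exact h

/-- The remainder of a number given by its digits, most significant digit first. -/
def modBits (p : ℕ) (l : List Bool) : ℕ :=
  l.foldl (fun r b => bif p.ble (Nat.bit b r) then Nat.bit b r - p else Nat.bit b r) 0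

theorem modBits_append_singleton (p : ℕ) (l : List Bool) (b : Bool) :
    modBits p (l ++ [b]) = bif p.ble (Nat.bit b (modBits p l)) then Nat.bit b (modBits p l) - p
      else Nat.bit b (modBits p l) := by
  simp [modBits]

theorem modBits_le (p : ℕ) (l : List Bool) : modBits p l ≤ Nat.appendBits 0 l := by
  induction l using List.reverseRecOn with
  | nil => rfl
  | append_singleton l b ih =>
    have h : Nat.appendBits 0 (l ++ [b]) = Nat.bit b (Nat.appendBits 0 l) := by
      simp [Nat.appendBits]
    rw [modBits_append_singleton, h, Nat.bit_val, Nat.bit_val]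
    cases p.ble (2 * modBits p l + b.toNat) <;> simp only [cond_true, cond_false] <;> omega

/-- Horner's scheme with reduction: a remainder `r < p` gives `2 * r + b < 2 * p`, so one
subtraction suffices. For `p = 0` the comparison always succeeds and 0 is subtracted, in accordance
with `n % 0 = n`. -/
theorem modBits_bits (p n : ℕ) : modBits p n.bits.reverse = n % p := by
  induction n using Nat.binaryRec' with
  | zero => simp [modBits]
  | bit b n h ih =>
    rw [Nat.bits_append_bit _ _ h, List.reverse_cons, modBits_append_singleton, ih, Nat.bit_val,
      Nat.bit_val]
    have hb := Bool.toNat_lt b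
    rcases Nat.eq_zero_or_pos p with rfl | hp
    · have : Nat.ble 0 (2 * (n % 0) + b.toNat) = true := by simp
      rw [this]; simp
    · have h1 := Nat.mod_lt n hp
      have h2 : (2 * n + b.toNat) % p = (2 * (n % p) + b.toNat) % p := by
        simp [Nat.add_mod, Nat.mul_mod]
      rw [h2]
      clear h2
      cases h : p.ble (2 * (n % p) + b.toNat)
      · rw [← Bool.not_eq_true, Nat.ble_eq] at h
        exact (Nat.mod_eq_of_lt (not_le.1 h)).symm
      · rw [Nat.ble_eq] at h
        rw [cond_true, Nat.mod_eq_sub_mod h]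
        exact (Nat.mod_eq_of_lt (by omega)).symm

@[fun_prop]
theorem PolyTime.mod {f g : α → ℕ} (hf : PolyTime f) (hg : PolyTime g) :
    PolyTime fun a => f a % g a := by
  refine PolyTime.congr ?_ fun a => modBits_bits (g a) (f a)
  refine PolyTime.foldl (f := fun a => (f a).bits.reverse) (by fun_prop) (.const 0)
    (h := fun a r b => bif (g a).ble (Nat.bit b r) then Nat.bit b r - g a else Nat.bit b r)
    (by fun_prop) (m := fun a => 2 * size (f a)) ((PolyBdd.const 2).mul hf.size_bdd)
    fun a l hl => (size_le_natSize _).trans ?_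
  have h1 := Nat.size_le_size (modBits_le (g a) l)
  have h2 := Nat.size_appendBits_le 0 l
  have h3 := (length_le_size l).trans (size_prefix_le hl)
  have h4 : size (f a).bits = size (f a) := rfl
  rw [size_reverse, h4] at h3
  rw [Nat.size_zero] at h2
  change 2 * (modBits (g a) l).size ≤ _
  omega

/-- One step of the Euclidean algorithm. -/
def gcdStep (x : ℕ × ℕ) : ℕ × ℕ := bif x.1.beq 0 then x else (x.2 % x.1, x.1)

/-- The Euclidean algorithm, with as many steps as a list has elements. -/
def gcdList (a b : ℕ) (l : List Bool) : ℕ × ℕ := l.foldl (fun x _ => gcdStep x) (a, b)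

theorem gcdStep_zero (b : ℕ) : gcdStep (0, b) = (0, b) := rfl

theorem gcdStep_pos {a : ℕ} (ha : 0 < a) (b : ℕ) : gcdStep (a, b) = (b % a, a) := by
  have : a.beq 0 = false := by rw [← Bool.not_eq_true, Nat.beq_eq]; omega
  simp [gcdStep, this]

theorem gcdList_zero (b : ℕ) (l : List Bool) : gcdList 0 b l = (0, b) := by
  induction l with
  | nil => rfl
  | cons c l ih => rw [gcdList, List.foldl_cons, gcdStep_zero]; exact ih

theorem gcdList_cons {a : ℕ} (ha : 0 < a) (b : ℕ) (c : Bool) (l : List Bool) :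
    gcdList a b (c :: l) = gcdList (b % a) a l := by
  rw [gcdList, List.foldl_cons, gcdStep_pos ha]; rfl

/-- Two steps of the Euclidean algorithm replace `a` by `a % (b % a)`, which is less than `a / 2`
because `a` is at least `b % a` plus this remainder. So `2 * k` steps suffice for `a < 2 ^ k`. -/
theorem gcdList_eq (l : List Bool) : ∀ (k a b : ℕ), a < 2 ^ k → 2 * k ≤ l.length →
    gcdList a b l = (0, Nat.gcd a b) := by
  induction hn : l.length using Nat.strong_induction_on generalizing l with
  | _ n ih =>
    intro k a b ha hk
    subst hn
    rcases Nat.eq_zero_or_pos a with rfl | ha0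
    · rw [gcdList_zero, Nat.gcd_zero_left]
    · obtain ⟨k, rfl⟩ : ∃ j, k = j + 1 :=
        Nat.exists_eq_succ_of_ne_zero (by rintro rfl; simp at ha; omega)
      obtain ⟨c, d, l, rfl⟩ : ∃ c d l', l = c :: d :: l' := by
        match l, hk with
        | c :: d :: l', _ => exact ⟨c, d, l', rfl⟩
      rw [gcdList_cons ha0, Nat.gcd_rec]
      rcases Nat.eq_zero_or_pos (b % a) with h0 | h0
      · rw [h0, gcdList_zero, Nat.gcd_zero_left]
      · rw [gcdList_cons h0, Nat.gcd_rec]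
        refine ih l.length (by simp) l rfl k _ _ ?_ (by simp at hk; omega)
        have h1 := Nat.mod_lt b ha0
        have h2 := Nat.mod_lt a h0
        have h3 := Nat.mod_add_div a (b % a)
        have h4 : 1 ≤ a / (b % a) := Nat.div_pos h1.le h0
        have h5 : b % a ≤ b % a * (a / (b % a)) := Nat.le_mul_of_pos_right _ h4
        rw [pow_succ] at ha
        omega

theorem gcdList_le (a b : ℕ) (l : List Bool) :
    (gcdList a b l).1 ≤ Max.max a b ∧ (gcdList a b l).2 ≤ Max.max a b := by
  induction l generalizing a b with
  | nil => simp [gcdList]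
  | cons c l ih =>
    rcases Nat.eq_zero_or_pos a with rfl | ha0
    · simp [gcdList_zero]
    · rw [gcdList_cons ha0]
      have h1 := Nat.mod_lt b ha0
      have := ih (b % a) a
      omega

@[fun_prop]
theorem PolyTime.gcd {f g : α → ℕ} (hf : PolyTime f) (hg : PolyTime g) :
    PolyTime fun a => (f a).gcd (g a) := by
  -- The digits of `f a`, taken twice, serve as a counter for the two steps needed per digit.
  have key : PolyTime fun a => gcdList (f a) (g a) ((f a).bits ++ (f a).bits) := by
    refine PolyTime.foldl (f := fun a => (f a).bits ++ (f a).bits) (by fun_prop)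
      (g := fun a => (f a, g a)) (by fun_prop) (h := fun _ x _ => gcdStep x)
      (by unfold gcdStep; fun_prop)
      (m := fun a => 4 * (size (f a) + size (g a)) + 1)
      (((PolyBdd.const 4).mul (hf.size_bdd.add hg.size_bdd)).add (.const 1)) fun a l hl => ?_
    have h1 := gcdList_le (f a) (g a) l
    change size (gcdList (f a) (g a) l) ≤ _
    generalize gcdList (f a) (g a) l = x at *
    obtain ⟨x, y⟩ := x
    have h2 := size_nat_mono h1.1
    have h3 := size_nat_mono h1.2
    have h4 : size (Max.max (f a) (g a)) ≤ size (f a) + size (g a) := by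
      rcases max_choice (f a) (g a) with h | h <;> rw [h] <;> omega
    simp only [size_pair]
    dsimp only at h2 h3
    omega
  refine key.snd.congr fun a => ?_
  rw [gcdList_eq _ (f a).size _ _ (Nat.lt_size_self _)]
  rw [List.length_append, Nat.size_eq_bits_len]
  omega

@[fun_prop]
theorem PolyTime.length {f : α → List β} (hf : PolyTime f) : PolyTime fun a => (f a).length := by
  have key : ∀ l : List β, l.foldl (fun n _ => n + 1) 0 = l.length := by
    intro l
    induction l using List.reverseRecOn with
    | nil => rfl
    | append_singleton l b ih => simp
  refine (hf.foldl (.const 0) (h := fun _ n _ => n + 1) (by fun_prop)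
    (m := fun a => 2 * size (f a)) ((PolyBdd.const 2).mul hf.size_bdd) fun a l hl => ?_).congr
    fun a => key (f a)
  have h1 := (length_le_size l).trans (size_prefix_le hl)
  rw [key]
  exact (size_nat_le _).trans (by omega)

@[fun_prop]
theorem PolyTime.natSize {f : α → ℕ} (hf : PolyTime f) : PolyTime fun a => (f a).size :=
  hf.bits.length.congr fun _ => Nat.size_eq_bits_len _

/-- The bound of the range has to be the length of a list: for a number in binary, `List.range`
would have exponential size. -/
theorem PolyTime.rangeLength {f : α → List β} (hf : PolyTime f) :
    PolyTime fun a => List.range (f a).length := by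
  have key : ∀ l : List β, l.foldl (fun s _ => s ++ [s.length]) [] = List.range l.length := by
    intro l
    induction l using List.reverseRecOn with
    | nil => rfl
    | append_singleton l b ih => simp [ih, List.range_succ]
  refine (hf.foldl (.const []) (h := fun _ s _ => s ++ [s.length]) (by fun_prop)
    (m := fun a => size (f a) * (2 * size (f a) + 1))
    (hf.size_bdd.mul (((PolyBdd.const 2).mul hf.size_bdd).add (.const 1))) fun a l hl => ?_).congr
    fun a => key (f a)
  have h1 := (length_le_size l).trans (size_prefix_le hl)
  rw [key]
  refine (size_le_mul (n := 2 * size (f a)) fun x hx => (size_nat_le x).trans ?_).trans ?_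
  · have := List.mem_range.1 hx
    omega
  · rw [List.length_range]
    gcongr

@[fun_prop]
theorem PolyTime.getD {f : α → List β} {g : α → ℕ} {d : α → β} (hf : PolyTime f)
    (hg : PolyTime g) (hd : PolyTime d) : PolyTime fun a => (f a).getD (g a) (d a) := by
  have key : ∀ (i : ℕ) (d : β) (l : List β),
      l.foldl (fun (s : ℕ × β) x => (s.1 + 1, bif s.1.beq i then x else s.2)) (0, d) =
        (l.length, l.getD i d) := by
    intro i d l
    induction l using List.reverseRecOn with
    | nil => rfl
    | append_singleton l b ih =>
      rw [List.foldl_append, ih]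
      rcases lt_trichotomy l.length i with h | h | h
      · have : l.length.beq i = false := by rw [← Bool.not_eq_true, Nat.beq_eq]; omega
        have h2 : (l ++ [b]).length ≤ i := by simp; omega
        rw [List.getD_eq_default _ _ h.le, List.getD_eq_default _ _ h2]
        simp [this]
      · subst h; simp
      · have : l.length.beq i = false := by rw [← Bool.not_eq_true, Nat.beq_eq]; omega
        rw [List.getD_append _ _ _ _ h]
        simp [this]
  refine (hf.foldl (g := fun a => (0, d a)) (by fun_prop)
    (h := fun a s x => (s.1 + 1, bif s.1.beq (g a) then x else s.2)) (by fun_prop)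
    (m := fun a => 3 * size (f a) + size (d a) + 1)
    ((((PolyBdd.const 3).mul hf.size_bdd).add hd.size_bdd).add (.const 1))
    fun a l hl => ?_).snd.congr fun a => congrArg Prod.snd (key (g a) (d a) (f a))
  have h1 := length_le_size l
  have h2 := size_prefix_le hl
  have h3 := size_nat_le l.length
  have h4 : size (l.getD (g a) (d a)) ≤ size l + size (d a) := by
    rcases lt_or_ge (g a) l.length with h | h
    · rw [List.getD_eq_getElem _ _ h]
      have := size_le_of_mem (List.getElem_mem h)
      omega
    · rw [List.getD_eq_default _ _ h]
      omega
  rw [key, size_pair]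
  omega

end

/-! ### Compilation of stack programs to jump instructions. -/

/-- Instructions with explicit addresses on a family of stacks of bits. -/
inductive StackInstr
  | push (k : ℕ) (b : Bool)
  | pop (k a₀ a₁ a₂ : ℕ)
  | jump (a : ℕ)

namespace StackInstr

/-- A bound for the stack index and the target addresses of an instruction. -/
def bound : StackInstr → ℕ
  | push k _ => k
  | pop k a₀ a₁ a₂ => k + a₀ + a₁ + a₂
  | jump a => a

/-- The effect of an instruction at address `i`. -/
def act (i : ℕ) (S : Store) : StackInstr → ℕ × Store
  | push k b => (i + 1, update S k (b :: S k))
  | pop k a₀ a₁ a₂ => (match (S k).head? with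
      | none => a₀
      | some false => a₁
      | some true => a₂, update S k (S k).tail)
  | jump a => (a, S)

/-- `Steps C n x y`: executing the instructions `C`, one gets from `x` to `y` in `n` steps. -/
inductive Steps (C : List StackInstr) : ℕ → ℕ × Store → ℕ × Store → Prop
  | refl (x) : Steps C 0 x x
  | head {i S c n y} : C[i]? = some c → Steps C n (c.act i S) y → Steps C (n + 1) (i, S) y

theorem Steps.trans {C n m x y z} (h : Steps C n x y) (h' : Steps C m y z) :
    Steps C (n + m) x z := by
  induction h with
  | refl => simpa using h'
  | head hc _ ih =>
    rw [Nat.add_right_comm]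
    exact .head hc (ih h')

/-- The list `l` occurs in `C` at position `a`. -/
def Segment (C : List StackInstr) (a : ℕ) (l : List StackInstr) : Prop :=
  ∀ i, i < l.length → C[a + i]? = l[i]?

theorem Segment.left {C a l m} (h : Segment C a (l ++ m)) : Segment C a l := fun i hi => by
  rw [h i (by simp; omega), List.getElem?_append_left hi]

theorem Segment.right {C a l m} (h : Segment C a (l ++ m)) : Segment C (a + l.length) m :=
  fun i hi => by
    rw [add_assoc, h (l.length + i) (by simp; omega), List.getElem?_append_right (by simp)]
    simp

theorem Segment.head {C a c l} (h : Segment C a (c :: l)) : C[a]? = some c := by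
  simpa using h 0 (by simp)

theorem Segment.tail {C a c l} (h : Segment C a (c :: l)) : Segment C (a + 1) l :=
  Segment.right (l := [c]) h

end StackInstr

namespace StackProg

open StackInstr (Segment Steps)

/-- The number of instructions of a compiled program. -/
def len : StackProg → ℕ
  | skip => 0
  | push _ _ => 1
  | seq p q => p.len + q.len
  | pop _ p q r => p.len + q.len + r.len + 4
  | loop _ p q => p.len + q.len + 3

/-- Compilation of a structured program to instructions from address `a` on. -/
def compile : StackProg → ℕ → List StackInstr
  | skip, _ => []
  | push k b, _ => [.push k b]
  | seq p q, a => p.compile a ++ q.compile (a + p.len)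
  | pop k p q r, a =>
    .pop k (a + 1) (a + p.len + 2) (a + p.len + q.len + 3) ::
      (p.compile (a + 1) ++ .jump (a + p.len + q.len + r.len + 4) ::
      (q.compile (a + p.len + 2) ++ .jump (a + p.len + q.len + r.len + 4) ::
      (r.compile (a + p.len + q.len + 3) ++ [.jump (a + p.len + q.len + r.len + 4)])))
  | loop k p q, a =>
    .pop k (a + p.len + q.len + 3) (a + 1) (a + p.len + 2) ::
      (p.compile (a + 1) ++ .jump a :: (q.compile (a + p.len + 2) ++ [.jump a]))

theorem length_compile (p : StackProg) (a : ℕ) : (p.compile a).length = p.len := by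
  induction p generalizing a with
  | skip => rfl
  | push => rfl
  | seq p q hp hq => simp [compile, len, hp, hq]
  | pop k p q r hp hq hr => simp [compile, len, hp, hq, hr]; omega
  | loop k p q hp hq => simp [compile, len, hp, hq]; omega

theorem Segment.right' {C : List StackInstr} {p : StackProg} {a b : ℕ} {m : List StackInstr}
    (h : Segment C a (p.compile b ++ m)) : Segment C (a + p.len) m := by
  have := h.right
  rwa [length_compile] at this

/-- The costs in `Run` are chosen to be those of the compiled code: a branch costs one instruction
for the pop and one for the jump behind it, and leaving a loop costs one. Hence the simulation is
exact. -/
theorem Run.steps {p S t S'} (h : Run p S t S') {C : List StackInstr} {a : ℕ}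
    (hC : Segment C a (p.compile a)) : Steps C t (a, S) (a + p.len, S') := by
  induction h generalizing a with
  | skip S => exact .refl _
  | push k b S => exact .head hC.head (.refl _)
  | seq _ _ h1 h2 =>
    have := (h1 hC.left).trans (h2 (Segment.right' hC))
    rwa [add_assoc] at this
  | @popNil k p q r S S' t hk _ ih =>
    have h1 := hC.tail
    have h2 := (Segment.right' h1).head
    refine .head hC.head ?_
    have hS : update S k (S k).tail = S := by rw [hk, List.tail_nil, ← hk, Function.update_eq_self]
    simp only [StackInstr.act, hS]
    simp only [hk, List.head?_nil]
    refine (ih h1.left).trans (.head h2 ?_)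
    simp only [StackInstr.act, len]
    rw [← add_assoc, ← add_assoc, ← add_assoc]
    exact .refl _
  | @popFalse k p q r S S' t l hk _ ih =>
    have h1 := (Segment.right' hC.tail).tail
    rw [show a + 1 + p.len + 1 = a + p.len + 2 by omega] at h1
    have h2 := (Segment.right' h1).head
    refine .head hC.head ?_
    simp only [StackInstr.act, hk, List.head?_cons, List.tail_cons]
    refine (ih h1.left).trans (.head h2 ?_)
    simp only [StackInstr.act, len]
    rw [← add_assoc, ← add_assoc, ← add_assoc]
    exact .refl _
  | @popTrue k p q r S S' t l hk _ ih =>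
    have h1 := (Segment.right' hC.tail).tail
    rw [show a + 1 + p.len + 1 = a + p.len + 2 by omega] at h1
    have h1 := (Segment.right' h1).tail
    rw [show a + p.len + 2 + q.len + 1 = a + p.len + q.len + 3 by omega] at h1
    have h2 := (Segment.right' h1).head
    refine .head hC.head ?_
    simp only [StackInstr.act, hk, List.head?_cons, List.tail_cons]
    refine (ih h1.left).trans (.head h2 ?_)
    simp only [StackInstr.act, len]
    rw [← add_assoc, ← add_assoc, ← add_assoc]
    exact .refl _
  | @loopNil k p q S hk =>
    refine .head hC.head ?_
    have hS : update S k (S k).tail = S := by rw [hk, List.tail_nil, ← hk, Function.update_eq_self]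
    simp only [StackInstr.act, hS]
    simp only [hk, List.head?_nil, len]
    rw [← add_assoc, ← add_assoc]
    exact .refl _
  | @loopFalse k p q S S' S'' t t' l hk _ _ ih ih' =>
    have h1 := hC.tail
    have h2 := (Segment.right' h1).head
    have h3 := (ih h1.left).trans (.head h2 (.refl _))
    have h4 := h3.trans (ih' hC)
    rw [show t + 2 + t' = (t + (0 + 1) + t') + 1 by omega]
    refine .head hC.head ?_
    simpa only [StackInstr.act, hk, List.head?_cons, List.tail_cons] using h4
  | @loopTrue k p q S S' S'' t t' l hk _ _ ih ih' =>
    have h1 := (Segment.right' hC.tail).tail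
    rw [show a + 1 + p.len + 1 = a + p.len + 2 by omega] at h1
    have h2 := (Segment.right' h1).head
    have h3 := (ih h1.left).trans (.head h2 (.refl _))
    have h4 := h3.trans (ih' hC)
    rw [show t + 2 + t' = (t + (0 + 1) + t') + 1 by omega]
    refine .head hC.head ?_
    simpa only [StackInstr.act, hk, List.head?_cons, List.tail_cons] using h4

end StackProg

/-! ### Execution of instructions by a Turing machine. -/

namespace StraightLineProgram.Token

/-- Tokens as elements of a sum of products of bits. -/
def toSum : Token → Bool ⊕ Bool × Bool
  | bit b => .inl b
  | terminal => .inr (false, false)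
  | nonterminal => .inr (false, true)
  | rule => .inr (true, false)
  | program => .inr (true, true)

instance : Data Token := ⟨fun t => Data.enc t.toSum⟩

theorem size_le (t : Token) : Data.size t ≤ 5 := by
  rcases t with (_ | _) | _ | _ | _ | _ <;> simp [Data.size, Data.enc, toSum, BinTree.nodes]

end StraightLineProgram.Token

namespace StackMachine

open StraightLineProgram (Token)
open Turing TM2

/-- The alphabets of the stacks: tokens for the input stack, bits for the other ones. -/
abbrev Alphabet (L : ℕ) : Option (Fin (L + 1)) → Type
  | none => Token
  | some _ => Bool

/-- Labels: initialization, reading of the input, and the addresses of the instructions. -/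
abbrev Label (L : ℕ) : Type := Option (Option (Fin (L + 1)))

/-- Statements of the machine which executes stack programs. -/
abbrev Statement (L : ℕ) : Type := Stmt (Alphabet L) (Label L) (Option Token)

/-- The label of an address. -/
def addr (L : ℕ) (i : ℕ) : Label L := some (some (Fin.ofNat (L + 1) i))

/-- Push a word on the first working stack, and continue with another statement. -/
def pushWord (L : ℕ) : List Bool → Statement L → Statement L
  | [], q => q
  | b :: l, q => pushWord L l (.push (some 0) (fun _ => b) q)

/-- The statement which executes an instruction at address `i`. -/
def instrStmt (L : ℕ) (i : ℕ) : StackInstr → Statement L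
  | .push k b => .push (some (Fin.ofNat (L + 1) k)) (fun _ => b) (.goto fun _ => addr L (i + 1))
  | .pop k a₀ a₁ a₂ => .pop (some (Fin.ofNat (L + 1) k)) (fun _ o => o.map Token.bit)
      (.goto fun v => match v with
        | none => addr L a₀
        | some (.bit false) => addr L a₁
        | _ => addr L a₂)
  | .jump a => .goto fun _ => addr L a

/-- The statement which handles the token that was read. -/
def readStmt (L : ℕ) : List Token → Statement L
  | [] => .goto fun _ => addr L 0
  | t :: l => .branch (fun v => v = some t)
      (pushWord L (true :: Data.code t) (.goto fun _ => some none)) (readStmt L l)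

/-- All tokens. -/
def tokens : List Token :=
  [.bit false, .bit true, .terminal, .nonterminal, .rule, .program]

/-- The program of the machine which reads the input and then executes instructions. -/
def prog (C : List StackInstr) (L : ℕ) : Label L → Statement L
  | none => .push (some 0) (fun _ => false) (.goto fun _ => some none)
  | some none => .pop none (fun _ o => o) (readStmt L tokens)
  | some (some i) => match C[(i : ℕ)]? with
    | none => .load (fun _ => none) .halt
    | some c => instrStmt L i c

/-- The machine which reads the input and then executes instructions. -/
def machine (C : List StackInstr) (L : ℕ) : FinTM2 where
  K := Option (Fin (L + 1))
  k₀ := none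
  k₁ := some 0
  Γ := Alphabet L
  Λ := Label L
  main := none
  σ := Option Token
  initialState := none
  Γk₀Fin := inferInstanceAs (Fintype Token)
  m := prog C L

/-- The stacks of the machine for a given input and memory. -/
def mem (L : ℕ) (w : List Token) (S : Store) : ∀ k, List (Alphabet L k)
  | none => w
  | some i => S i

theorem update_mem_reg {L k : ℕ} (hk : k ≤ L) (w : List Token) (S : Store) (l : List Bool) :
    update (mem L w S) (some (Fin.ofNat (L + 1) k)) l = mem L w (update S k l) := by
  have hv : (Fin.ofNat (L + 1) k : ℕ) = k := Nat.mod_eq_of_lt (by omega)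
  funext i
  match i with
  | none => simp [mem]
  | some i =>
    by_cases h : i = Fin.ofNat (L + 1) k
    · subst h
      rw [Function.update_self]
      change l = update S k l _
      rw [hv, Function.update_self]
    · rw [Function.update_of_ne (by simpa using h)]
      change S i = update S k l i
      rw [Function.update_of_ne]
      intro h'
      exact h (Fin.ext (h'.trans hv.symm))

theorem mem_reg {L k : ℕ} (hk : k ≤ L) (w : List Token) (S : Store) :
    mem L w S (some (Fin.ofNat (L + 1) k)) = S k := by
  have hv : (Fin.ofNat (L + 1) k : ℕ) = k := Nat.mod_eq_of_lt (by omega)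
  change S _ = S k
  rw [hv]

theorem update_mem_input {L : ℕ} (w w' : List Token) (S : Store) :
    update (mem L w S) none w' = mem L w' S := by
  funext i
  match i with
  | none => rw [Function.update_self]; rfl
  | some i => rw [Function.update_of_ne (by simp)]; rfl

theorem stepAux_pushWord (L : ℕ) (l : List Bool) (q : Statement L) (v : Option Token)
    (w : List Token) (S : Store) :
    stepAux (pushWord L l q) v (mem L w S) =
      stepAux q v (mem L w (update S 0 (l ++ S 0))) := by
  induction l generalizing q with
  | nil => simp [pushWord]
  | cons b l ih =>
    rw [pushWord, ih, stepAux]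
    have h := update_mem_reg (L := L) (k := 0) (by omega) w (update S 0 (l ++ S 0))
      (b :: (l ++ S 0))
    have h2 := mem_reg (L := L) (k := 0) (by omega) w (update S 0 (l ++ S 0))
    change update _ (some 0) _ = _ at h
    change mem L w _ (some 0) = _ at h2
    rw [h2, Function.update_self, h, Function.update_idem]
    rfl

theorem stepAux_readStmt_none (L : ℕ) (l : List Token) (S) :
    stepAux (readStmt L l) none S = ⟨some (addr L 0), none, S⟩ := by
  induction l with
  | nil => rfl
  | cons t l ih => rw [readStmt, stepAux]; simpa using ih

theorem stepAux_readStmt_some (L : ℕ) {t : Token} {l : List Token} (ht : t ∈ l) (w : List Token)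
    (S : Store) : stepAux (readStmt L l) (some t) (mem L w S) =
      ⟨some (some none), some t, mem L w (update S 0 (true :: Data.code t ++ S 0))⟩ := by
  induction l with
  | nil => simp at ht
  | cons t' l ih =>
    rw [readStmt, stepAux]
    by_cases h : t = t'
    · subst h
      simp only [decide_true, cond_true]
      rw [stepAux_pushWord, stepAux]
    · have : decide (some t = some t') = false := by simpa using h
      rw [this, cond_false]
      exact ih ((List.mem_cons.1 ht).resolve_left h)

variable {C : List StackInstr} {L : ℕ}

/-- The machine gets from one configuration to another one in `n` steps. -/
def Reach (C : List StackInstr) (L n : ℕ) (c d : (machine C L).Cfg) : Prop :=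
  (flip bind (machine C L).step)^[n] (some c) = some d

theorem Reach.trans {n m : ℕ} {c d e : (machine C L).Cfg} (h : Reach C L n c d)
    (h' : Reach C L m d e) : Reach C L (n + m) c e := by
  rw [Reach, add_comm, Function.iterate_add_apply, h, h']

theorem Reach.single {c d : (machine C L).Cfg} (h : (machine C L).step c = some d) :
    Reach C L 1 c d := h

/-- A configuration of the machine. -/
def config (C : List StackInstr) (L : ℕ) (l : Option (Label L)) (v : Option Token)
    (w : List Token) (S : Store) : (machine C L).Cfg :=
  ⟨l, v, mem L w S⟩

/-- Pushing `true` and the code of a token in front of the code of a list is `List.cons`, so the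
input arrives reversed. Each token costs one step, and one more step notices the end. -/
theorem reach_read (w : List Token) (l : List Token) (v : Option Token) (S : Store)
    (hS : S 0 = Data.code l) :
    Reach C L (w.length + 1) (config C L (some (some none)) v w S)
      (config C L (some (addr L 0)) none [] (update S 0 (Data.code (w.reverse ++ l)))) := by
  induction w generalizing l v S with
  | nil =>
    refine Reach.single ?_
    change some (stepAux (readStmt L tokens) none (update (mem L [] S) none [])) = _
    rw [stepAux_readStmt_none, update_mem_input, List.reverse_nil, List.nil_append, ← hS,
      Function.update_eq_self]
    rfl
  | cons t w ih =>
    rw [List.length_cons, Nat.add_right_comm, add_comm]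
    have ht : t ∈ tokens := by rcases t with (_ | _) | _ | _ | _ | _ <;> simp [tokens]
    have h1 : Reach C L 1 (config C L (some (some none)) v (t :: w) S)
        (config C L (some (some none)) (some t) w
          (update S 0 (true :: Data.code t ++ S 0))) := by
      refine Reach.single ?_
      change some (stepAux (readStmt L tokens) (some t) (update (mem L (t :: w) S) none w)) = _
      rw [update_mem_input, stepAux_readStmt_some L ht]
      rfl
    have h2 := ih (t :: l) (some t) (update S 0 (true :: Data.code t ++ S 0)) (by
      rw [Function.update_self, hS]; rfl)
    have h3 := h1.trans h2
    rw [Function.update_idem] at h3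
    rw [List.reverse_cons, List.append_assoc]
    rw [add_comm 1] at h3 ⊢
    exact h3

theorem stepAux_instrStmt {c : StackInstr} (hc : c.bound ≤ L) {i : ℕ} (hi : i < L) (S : Store)
    (v : Option Token) : ∃ v', stepAux (instrStmt L i c) v (mem L [] S) =
      ⟨some (addr L (c.act i S).1), v', mem L [] (c.act i S).2⟩ ∧ (c.act i S).1 ≤ L := by
  cases c with
  | push k b =>
    change k ≤ L at hc
    refine ⟨v, ?_, by simp only [StackInstr.act]; omega⟩
    rw [instrStmt, stepAux, mem_reg hc, update_mem_reg hc]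
    rfl
  | pop k a₀ a₁ a₂ =>
    simp only [StackInstr.bound] at hc
    refine ⟨(S k).head?.map Token.bit, ?_, ?_⟩
    · rw [instrStmt, stepAux, mem_reg (by omega), update_mem_reg (by omega)]
      rcases hk : S k with _ | ⟨_ | _, l⟩ <;> simp [StackInstr.act, hk]
    · rcases hk : S k with _ | ⟨_ | _, l⟩ <;> simp [StackInstr.act, hk] <;> omega
  | jump a => exact ⟨v, rfl, hc⟩

/-- One instruction is one step of the machine. Stack indices and addresses are stored modulo `L +
1`; the bounds by `L` make this reduction harmless. -/
theorem reach_steps (hL : ∀ c ∈ C, c.bound ≤ L) (hC : C.length ≤ L) {n : ℕ} {x y : ℕ × Store}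
    (h : StackInstr.Steps C n x y) (hx : x.1 ≤ L) (v : Option Token) : ∃ v',
      Reach C L n (config C L (some (addr L x.1)) v [] x.2)
        (config C L (some (addr L y.1)) v' [] y.2) := by
  induction h generalizing v with
  | refl x => exact ⟨v, rfl⟩
  | @head i S c n y hc _ ih =>
    have hcL := hL c (List.mem_of_getElem? hc)
    have hi : i < C.length := (List.getElem?_eq_some_iff.1 hc).1
    have hiL : (Fin.ofNat (L + 1) i : ℕ) = i := Nat.mod_eq_of_lt (by omega)
    have hstep : ∀ v, (machine C L).step (config C L (some (addr L i)) v [] S) =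
        some (stepAux (instrStmt L i c) v (mem L [] S)) := by
      intro v
      change some (stepAux (prog C L (addr L i)) v _) = _
      rw [addr, prog]
      simp only [hiL, hc]
    obtain ⟨v', h1, h2⟩ := stepAux_instrStmt hcL (i := i) (by omega) S v
    obtain ⟨v'', h3⟩ := ih h2 v'
    refine ⟨v'', ?_⟩
    rw [add_comm]
    exact (Reach.single ((hstep v).trans (congrArg some h1))).trans h3

theorem reach_halt (hC : C.length ≤ L) (v : Option Token) (w : List Token) (S : Store) :
    Reach C L 1 (config C L (some (addr L C.length)) v w S) (config C L none none w S) := by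
  refine Reach.single ?_
  have hiL : (Fin.ofNat (L + 1) C.length : ℕ) = C.length := Nat.mod_eq_of_lt (by omega)
  change some (stepAux (prog C L (addr L C.length)) v _) = _
  rw [addr, prog]
  simp only [hiL, List.getElem?_eq_none le_rfl]
  rfl

/-- Replace the code of a Boolean value by this value. -/
def outputProg : StackProg :=
  .pop 0 .skip (.push 0 false) (.seq (clear 0) (.push 0 true))

theorem exec_outputProg (b : Bool) (S : Store) (hS : S 0 = Data.code b) :
    Exec outputProg S 8 (update S 0 [b]) := by
  cases b
  · exact ((Exec.popFalse (l := []) hS (Exec.push)).mono (by omega)).congr (by simp)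
  -- The code of `true` is `[true, false, false]`: 2 steps for the pop, 5 for clearing the remaining
  -- two bits, and 1 for the push.
  · exact ((Exec.popTrue (l := [false, false]) hS ((exec_clear 0 _).seq Exec.push)).mono
      (by simp)).congr (by simp)

/-- A decision problem which is solved in polynomial time on reversed inputs is solved in
polynomial time by a Turing machine. -/
theorem nonempty_computable {α : Type} {c : α → List Token} {f : α → Bool}
    {g : List Token → Bool} (hg : PolyTime g) (hgf : ∀ a, g (c a).reverse = f a) :
    Nonempty (TM2ComputableInPolyTime c Computability.encodeBool f) := by
  obtain ⟨P, t, ⟨p, hp⟩, hP⟩ := hg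
  let C := (StackProg.seq (P 0) outputProg).compile 0
  obtain ⟨L, hL, hCL⟩ : ∃ L, (∀ c ∈ C, c.bound ≤ L) ∧ C.length ≤ L := by
    have : ∀ C : List StackInstr, ∃ L, ∀ c ∈ C, c.bound ≤ L := by
      intro C
      induction C with
      | nil => exact ⟨0, by simp⟩
      | cons c C ih =>
        obtain ⟨L, hL⟩ := ih
        refine ⟨L + c.bound, fun d hd => ?_⟩
        rcases List.mem_cons.1 hd with rfl | hd
        · omega
        · exact (hL d hd).trans (by omega)
    obtain ⟨L, hL⟩ := this C
    exact ⟨L + C.length, fun c hc => (hL c hc).trans (by omega), by omega⟩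
  -- A token has size at most 5 and its list cell adds 1, whence the factor 6. The constant 11
  -- consists of 1 step for initialization, 1 for the end of the input, 8 for the output and 1 for
  -- halting.
  refine ⟨⟨⟨machine C L, Equiv.refl _, Equiv.refl _⟩, p.comp (.C 6 * .X) + .X + .C 11,
    fun a => Classical.choice ?_⟩⟩
  set S₀ : Store := update (fun _ => []) 0 [false] with hS₀
  set S₁ : Store := update S₀ 0 (Data.code (c a).reverse) with hS₁
  obtain ⟨n, hn, hrun⟩ := (hP 0 (c a).reverse S₁ (by simp [hS₁])
    (fun k hk => by simp [hS₁, hS₀, hk.ne'])).seq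
    (exec_outputProg (g (c a).reverse) _ (Function.update_self _ _ _))
  have hsteps := hrun.steps (C := C) (a := 0) (fun i _ => by rw [zero_add])
  rw [zero_add, ← length_compile _ 0] at hsteps
  change StackInstr.Steps C n _ (C.length, _) at hsteps
  obtain ⟨v, hreach⟩ := reach_steps hL hCL hsteps (Nat.zero_le _) none
  have h1 : Reach C L 1 (initList (machine C L) (c a))
      (config C L (some (some none)) none (c a) S₀) := by
    refine Reach.single ?_
    have : initList (machine C L) (c a) = config C L (some none) none (c a) (fun _ => []) := by
      refine congrArg (Cfg.mk (some none) none) (funext fun k => ?_)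
      match k with
      | none => rfl
      | some k => rfl
    rw [this]
    change some (stepAux (prog C L none) none (mem L (c a) fun _ => [])) = _
    rw [prog, stepAux, stepAux]
    have h := update_mem_reg (L := L) (k := 0) (by omega) (c a) (fun _ => []) [false]
    change update _ (some 0) _ = _ at h
    exact congrArg (fun S => some (Cfg.mk (some (some none)) none S)) h
  have h2 := reach_read (C := C) (L := L) (c a) [] none S₀ (by simp [hS₀]; rfl)
  rw [List.append_nil] at h2
  have h3 := (h1.trans h2).trans (hreach.trans (reach_halt hCL v [] _))
  refine ⟨⟨⟨1 + ((c a).length + 1) + (n + 1), ?_⟩, ?_⟩⟩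
  · have e : (List.map (Equiv.refl Token).invFun (c a)) = c a := List.map_id _
    refine (congrArg (fun w => (flip bind (machine C L).step)^[_] (some (initList (machine C L) w)))
      e).trans (Eq.trans h3 ?_)
    refine congrArg (fun S => some (Cfg.mk none none S)) (funext fun k => ?_)
    match k with
    | none => rfl
    | some ⟨0, _⟩ =>
      rw [← hgf a]
      rfl
    | some ⟨k + 1, hk⟩ =>
      have : (some ⟨k + 1, hk⟩ : Option (Fin (L + 1))) ≠ some 0 := by simp [Fin.ext_iff]
      -- A final configuration has to be empty outside the output stack; it is, since the net effect
      -- of the program is confined to stack 0.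
      have h4 : ∀ u v, update (update S₁ 0 u) 0 v (k + 1) = [] := by simp [hS₁, hS₀]
      refine (h4 (Data.code (g (c a).reverse)) [g (c a).reverse]).trans (Eq.symm ?_)
      apply dif_neg
      exact this
  · have h4 := hp (c a).reverse
    have h5 : Data.size (c a).reverse ≤ 6 * (c a).length := by
      rw [Data.size_reverse, mul_comm]
      exact Data.size_le_mul fun t _ => t.size_le
    have h6 := p.eval_mono_nat h5
    simp only [Polynomial.eval_add, Polynomial.eval_comp, Polynomial.eval_mul, Polynomial.eval_C,
      Polynomial.eval_X]
    dsimp only at h6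
    omega

end StackMachine

/-! ### The equality test for words given by straight line programs. -/

namespace WordTest

/-- A table of a straight line program in normal form: the length of the word and the production of
each non-terminal. -/
abbrev Table := List (ℕ × (ℕ ⊕ ℕ × ℕ))

/-- A constraint `(a, b, i)` says that the word of `a` without its first `i` letters agrees with the
word of `b`, as far as both are defined. -/
abbrev Constraint := ℕ × ℕ × ℕ

/-- The length of the word of a non-terminal. -/
def len (E : Table) (a : ℕ) : ℕ := (E.getD a (0, .inl 0)).1

/-- The production of a non-terminal. -/
def rule (E : Table) (a : ℕ) : ℕ ⊕ ℕ × ℕ := (E.getD a (0, .inl 0)).2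

/-- Apply the production of the first non-terminal of a constraint. -/
def splitLeft (E : Table) (c : Constraint) : List Constraint :=
  (rule E c.1).elim (fun _ => [c]) fun pq =>
    bif (len E pq.1).ble c.2.2 then [(pq.2, c.2.1, c.2.2 - len E pq.1)]
    else [(pq.1, c.2.1, c.2.2), (c.2.1, pq.2, len E pq.1 - c.2.2)]

/-- Apply the production of the second non-terminal of a constraint. -/
def splitRight (E : Table) (c : Constraint) : List Constraint :=
  (rule E c.2.1).elim (fun _ => [c]) fun pq =>
    [(c.1, pq.1, c.2.2), (c.1, pq.2, c.2.2 + len E pq.1)]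

/-- The constraint says that the second word occurs in the first one, before its end. -/
def inner (E : Table) (c : Constraint) : Bool := !(len E c.1 - c.2.2).ble (len E c.2.1)

/-- If the second word of a constraint occurs inside one factor of the first word, pass to this
factor. -/
def descend (E : Table) (c : Constraint) : Constraint :=
  bif inner E c then
    (rule E c.1).elim (fun _ => c) fun pq =>
      bif (len E pq.1).ble c.2.2 then (pq.2, c.2.1, c.2.2 - len E pq.1)
      else bif (len E c.2.1).ble (len E pq.1 - c.2.2) then (pq.1, c.2.1, c.2.2) else c
  else c

/-- Descend as long as possible. -/
def descendAll (E : Table) (c : Constraint) : Constraint :=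
  E.foldl (fun c _ => descend E c) c

/-- Replace a constraint by constraints which relate a suffix to a prefix. -/
def normalize (E : Table) (c : Constraint) : List Constraint :=
  bif inner E (descendAll E c) then splitLeft E (descendAll E c) else [descendAll E c]

/-- The largest element of a list. -/
def maxOf (l : List ℕ) : ℕ := l.foldl max 0

/-- The greatest common divisor of the differences to `m`. -/
def gcdOf (m : ℕ) (l : List ℕ) : ℕ := l.foldl (fun g o => g.gcd (m - o)) 0

/-- Two overlaps which are equivalent to a list of overlaps of similar lengths. -/
def compress (l : List ℕ) : List ℕ :=
  bif l.isEmpty then [] else [maxOf l, maxOf l - gcdOf (maxOf l) l]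

/-- The possible pairs of non-terminals and binary lengths of overlaps. -/
def keys (E : Table) : List (ℕ × ℕ × ℕ) :=
  (List.range E.length).flatMap fun a => (List.range E.length).flatMap fun b =>
    (List.range E.length).map fun s => (a, b, s + 1)

/-- The length of the overlap of the two words of a constraint which relates a suffix to a
prefix. -/
def overlap (E : Table) (c : Constraint) : ℕ := len E c.1 - c.2.2

/-- The constraints for a given key. -/
def select (E : Table) (L : List Constraint) (k : ℕ × ℕ × ℕ) : List Constraint :=
  L.filter fun c => c.1.beq k.1 && (c.2.1.beq k.2.1 && (overlap E c).size.beq k.2.2)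

/-- Reduce the number of constraints. -/
def compact (E : Table) (L : List Constraint) : List Constraint :=
  (keys E).flatMap fun k =>
    (compress ((select E L k).map (overlap E))).map fun o => (k.1, k.2.1, len E k.1 - o)

/-- Apply the production of `k` to the first non-terminals of constraints. -/
def splitLeftAll (E : Table) (k : ℕ) (L : List Constraint) : List Constraint :=
  L.flatMap fun c => bif c.1.beq k then splitLeft E c else [c]

/-- Apply the production of `k` to the second non-terminals of constraints. -/
def splitRightAll (E : Table) (k : ℕ) (L : List Constraint) : List Constraint :=
  L.flatMap fun c => bif c.2.1.beq k then splitRight E c else [c]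

/-- Eliminate the non-terminal `k`. -/
def stage (E : Table) (L : List Constraint) (k : ℕ) : List Constraint :=
  compact E ((splitRightAll E k (splitLeftAll E k (splitLeftAll E k L))).flatMap (normalize E))

/-- Eliminate all non-terminals which do not produce a terminal. -/
def stages (E : Table) (L : List Constraint) : List Constraint :=
  (List.range E.length).reverse.foldl (stage E) L

/-- Two non-terminals produce the same terminal. -/
def check (E : Table) (c : Constraint) : Bool :=
  (rule E c.1).elim (fun a => (rule E c.2.1).elim (fun b => a.beq b) fun _ => false) fun _ => false

/-- The table of a list of productions. -/
def table (R : List (ℕ ⊕ ℕ × ℕ)) : Table :=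
  R.foldl (fun E r => E ++ [(r.elim (fun _ => 1) fun pq => len E pq.1 + len E pq.2, r)]) []

/-- Shift the indices of non-terminals in a production. -/
def shift (k : ℕ) (r : ℕ ⊕ ℕ × ℕ) : ℕ ⊕ ℕ × ℕ :=
  r.elim .inl fun pq => .inr (pq.1 + k, pq.2 + k)

/-- The equality test for the words of two non-terminals of a table. -/
def test (E : Table) (a b : ℕ) : Bool :=
  (len E a).beq (len E b) && (stages E [(a, b, 0)]).all (check E)

/-- The equality test for two lists of productions. -/
def testRules (R R' : List (ℕ ⊕ ℕ × ℕ)) : Bool :=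
  test (table (R ++ R'.map (shift R.length))) (R.length - 1) (R.length + R'.length - 1)

/-! ### The test runs in polynomial time. -/

section

variable {α : Type*} [Data α]

@[fun_prop]
theorem polyTime_len {E : α → Table} {a : α → ℕ} (hE : PolyTime E) (ha : PolyTime a) :
    PolyTime fun x => len (E x) (a x) := by
  unfold len; fun_prop

@[fun_prop]
theorem polyTime_rule {E : α → Table} {a : α → ℕ} (hE : PolyTime E) (ha : PolyTime a) :
    PolyTime fun x => rule (E x) (a x) := by
  unfold rule; fun_prop

@[fun_prop]
theorem polyTime_inner {E : α → Table} {c : α → Constraint} (hE : PolyTime E) (hc : PolyTime c) :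
    PolyTime fun x => inner (E x) (c x) := by
  unfold inner; fun_prop

@[fun_prop]
theorem polyTime_overlap {E : α → Table} {c : α → Constraint} (hE : PolyTime E)
    (hc : PolyTime c) : PolyTime fun x => overlap (E x) (c x) := by
  unfold overlap; fun_prop

theorem polyTime_elim {β γ δ : Type*} [Data β] [Data γ] [Data δ] {f : α → β ⊕ γ}
    (hf : PolyTime f) {g : α → β → δ} (hg : PolyTime fun x : α × β => g x.1 x.2)
    {h : α → γ → δ} (hh : PolyTime fun x : α × γ => h x.1 x.2) :
    PolyTime fun a => (f a).elim (g a) (h a) :=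
  hf.sumCases hg hh (fun a x h => by rw [h]; rfl) (fun a x h => by rw [h]; rfl)

@[fun_prop]
theorem polyTime_splitLeft {E : α → Table} {c : α → Constraint} (hE : PolyTime E)
    (hc : PolyTime c) : PolyTime fun x => splitLeft (E x) (c x) := by
  unfold splitLeft
  exact polyTime_elim (by fun_prop) (by fun_prop) (by fun_prop)

@[fun_prop]
theorem polyTime_splitRight {E : α → Table} {c : α → Constraint} (hE : PolyTime E)
    (hc : PolyTime c) : PolyTime fun x => splitRight (E x) (c x) := by
  unfold splitRight
  exact polyTime_elim (by fun_prop) (by fun_prop) (by fun_prop)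

@[fun_prop]
theorem polyTime_descend {E : α → Table} {c : α → Constraint} (hE : PolyTime E)
    (hc : PolyTime c) : PolyTime fun x => descend (E x) (c x) := by
  unfold descend
  exact (polyTime_inner hE hc).cond (polyTime_elim (by fun_prop) (by fun_prop) (by fun_prop)) hc

theorem size_getD_le {β : Type*} [Data β] (l : List β) (i : ℕ) (d : β) :
    size (l.getD i d) ≤ size l + size d := by
  rcases lt_or_ge i l.length with h | h
  · rw [List.getD_eq_getElem _ _ h]
    exact (size_le_of_mem (List.getElem_mem h)).trans (Nat.le_add_right _ _)
  · rw [List.getD_eq_default _ _ h]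
    exact Nat.le_add_left _ _

theorem size_rule_le (E : Table) (a : ℕ) : size (rule E a) ≤ size E + 2 := by
  have h1 := size_getD_le E a (0, .inl 0)
  have h2 : size ((0, .inl 0) : ℕ × (ℕ ⊕ ℕ × ℕ)) = 2 := rfl
  have h3 := size_prod (E.getD a (0, .inl 0))
  simp only [rule]
  omega

theorem size_len_le (E : Table) (a : ℕ) : size (len E a) ≤ size E + 2 := by
  have h1 := size_getD_le E a (0, .inl 0)
  have h2 : size ((0, .inl 0) : ℕ × (ℕ ⊕ ℕ × ℕ)) = 2 := rfl
  have h3 := size_prod (E.getD a (0, .inl 0))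
  simp only [len]
  omega

/-- For the fold in `descendAll`: the first index is the old one or one stored in the table, and the
offset never increases, so nothing accumulates. -/
theorem descend_bounds (E : Table) (c : Constraint) :
    size (descend E c).1 ≤ max (size c.1) (size E + 2) ∧ (descend E c).2.1 = c.2.1 ∧
      (descend E c).2.2 ≤ c.2.2 := by
  rw [descend]
  have hr := size_rule_le E c.1
  cases inner E c
  · simp
  · cases h : rule E c.1 with
    | inl a => simp
    | inr pq =>
      obtain ⟨p, q⟩ := pq
      simp only [h, size_inr, size_pair] at hr
      simp only [cond_true, Sum.elim_inr]
      cases (len E p).ble c.2.2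
      · cases (len E c.2.1).ble (len E p - c.2.2)
        · simp
        · simp only [cond_false, cond_true]
          exact ⟨by omega, trivial, le_rfl⟩
      · simp only [cond_true]
        exact ⟨by omega, trivial, Nat.sub_le _ _⟩

@[fun_prop]
theorem polyTime_descendAll {E : α → Table} {c : α → Constraint} (hE : PolyTime E)
    (hc : PolyTime c) : PolyTime fun x => descendAll (E x) (c x) := by
  refine hE.foldl hc (h := fun x c _ => descend (E x) c) (by fun_prop)
    (m := fun x => 2 * size (c x) + size (E x) + 10)
    ((((PolyBdd.const 2).mul hc.size_bdd).add hE.size_bdd).add (.const 10)) fun x l hl => ?_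
  clear hl
  have key : size (l.foldl (fun c _ => descend (E x) c) (c x)).1 ≤
      max (size (c x).1) (size (E x) + 2) ∧
      (l.foldl (fun c _ => descend (E x) c) (c x)).2.1 = (c x).2.1 ∧
      (l.foldl (fun c _ => descend (E x) c) (c x)).2.2 ≤ (c x).2.2 := by
    induction l using List.reverseRecOn with
    | nil => exact ⟨le_max_left _ _, rfl, le_rfl⟩
    | append_singleton l r ih =>
      rw [List.foldl_append]
      obtain ⟨h1, h2, h3⟩ := descend_bounds (E x) (l.foldl (fun c _ => descend (E x) c) (c x))
      obtain ⟨h4, h5, h6⟩ := ih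
      exact ⟨by change size (descend _ _).1 ≤ _; omega, h2.trans h5, h3.trans h6⟩
  generalize l.foldl (fun c _ => descend (E x) c) (c x) = d at key
  obtain ⟨h1, h2, h3⟩ := key
  have h4 := size_nat_mono h3
  rw [size_prod, size_prod d.2, h2]
  rw [size_prod (c x), size_prod (c x).2]
  omega

@[fun_prop]
theorem polyTime_normalize {E : α → Table} {c : α → Constraint} (hE : PolyTime E)
    (hc : PolyTime c) : PolyTime fun x => normalize (E x) (c x) := by
  unfold normalize; fun_prop

theorem maxOf_mem_or (l : List ℕ) : maxOf l = 0 ∨ maxOf l ∈ l := by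
  induction l using List.reverseRecOn with
  | nil => exact .inl rfl
  | append_singleton l o ih =>
    have : maxOf (l ++ [o]) = max (maxOf l) o := by simp [maxOf]
    rw [this]
    rcases max_choice (maxOf l) o with h | h <;> rw [h]
    · simp; tauto
    · simp

theorem gcdOf_append_singleton (m : ℕ) (l : List ℕ) (o : ℕ) :
    gcdOf m (l ++ [o]) = (gcdOf m l).gcd (m - o) := by
  simp [gcdOf]

theorem gcdOf_le (m : ℕ) (l : List ℕ) : gcdOf m l ≤ m := by
  induction l using List.reverseRecOn with
  | nil => exact Nat.zero_le _
  | append_singleton l o ih =>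
    rw [gcdOf_append_singleton]
    rcases Nat.eq_zero_or_pos (gcdOf m l) with h | h
    · rw [h, Nat.gcd_zero_left]; exact Nat.sub_le _ _
    · exact (Nat.gcd_le_left _ h).trans ih

@[fun_prop]
theorem polyTime_maxOf {l : α → List ℕ} (hl : PolyTime l) : PolyTime fun x => maxOf (l x) := by
  refine hl.foldl (.const 0) (h := fun _ m o => max m o) (by fun_prop)
    (m := fun x => size (l x)) hl.size_bdd fun x l' hl' => ?_
  change size (maxOf l') ≤ _
  rcases maxOf_mem_or l' with h | h
  · rw [h]; exact Nat.zero_le _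
  · exact (size_le_of_mem h).trans (size_prefix_le hl')

@[fun_prop]
theorem polyTime_gcdOf {m : α → ℕ} {l : α → List ℕ} (hm : PolyTime m) (hl : PolyTime l) :
    PolyTime fun x => gcdOf (m x) (l x) := by
  refine hl.foldl (.const 0) (h := fun x g o => g.gcd (m x - o)) (by fun_prop)
    (m := fun x => 2 * size (m x)) ((PolyBdd.const 2).mul hm.size_bdd) fun x l' _ => ?_
  exact size_nat_mono (gcdOf_le (m x) l')

@[fun_prop]
theorem polyTime_compress {l : α → List ℕ} (hl : PolyTime l) :
    PolyTime fun x => compress (l x) := by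
  unfold compress; fun_prop

@[fun_prop]
theorem polyTime_keys {E : α → Table} (hE : PolyTime E) : PolyTime fun x => keys (E x) := by
  have h := hE.rangeLength
  refine h.flatMap (PolyTime.flatMap ?_ (PolyTime.map ?_ ?_))
  · exact h.comp (by fun_prop)
  · exact h.comp (f := fun y : (α × ℕ) × ℕ => y.1.1) (by fun_prop)
  · fun_prop

@[fun_prop]
theorem polyTime_select {E : α → Table} {L : α → List Constraint} {k : α → ℕ × ℕ × ℕ}
    (hE : PolyTime E) (hL : PolyTime L) (hk : PolyTime k) :
    PolyTime fun x => select (E x) (L x) (k x) :=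
  hL.filter (by fun_prop)

@[fun_prop]
theorem polyTime_compact {E : α → Table} {L : α → List Constraint}
    (hE : PolyTime E) (hL : PolyTime L) : PolyTime fun x => compact (E x) (L x) := by
  have h1 : PolyTime fun y : α × ℕ × ℕ × ℕ =>
      (select (E y.1) (L y.1) y.2).map (overlap (E y.1)) :=
    PolyTime.map (by fun_prop) (by fun_prop)
  have h2 : PolyTime fun y : α × ℕ × ℕ × ℕ =>
      (compress ((select (E y.1) (L y.1) y.2).map (overlap (E y.1)))).map
        fun o => (y.2.1, y.2.2.1, len (E y.1) y.2.1 - o) :=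
    PolyTime.map (polyTime_compress h1) (by fun_prop)
  exact (polyTime_keys hE).flatMap h2

/-- The bound does not involve `L`: each key yields at most two constraints, with offsets bounded by
lengths from the table. Therefore the lists do not grow from stage to stage. -/
theorem size_compact_le (E : Table) (L : List Constraint) :
    size (compact E L) ≤ (2 * size (keys E)) * (size (keys E) + 2 * size E + 10) := by
  have h1 : ∀ c ∈ compact E L, size c ≤ size (keys E) + 2 * size E + 9 := by
    intro c hc
    rw [compact] at hc
    obtain ⟨k, hk, hc⟩ := List.mem_flatMap.1 hc
    obtain ⟨o, -, rfl⟩ := List.mem_map.1 hc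
    have h2 := size_le_of_mem hk
    have h3 := size_nat_mono (Nat.sub_le (len E k.1) o)
    have h4 := size_len_le E k.1
    rw [size_prod, size_prod k.2] at h2
    simp only [size_pair]
    omega
  have h2 : (compact E L).length ≤ 2 * (keys E).length := by
    rw [compact, List.length_flatMap, mul_comm, ← smul_eq_mul, ← List.length_map]
    refine List.sum_le_card_nsmul _ _ fun n hn => ?_
    obtain ⟨k, -, rfl⟩ := List.mem_map.1 hn
    rw [List.length_map, compress]
    cases List.isEmpty _ <;> simp
  refine (size_le_mul h1).trans (Nat.mul_le_mul (h2.trans ?_) le_rfl)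
  have := length_le_size (keys E)
  omega

@[fun_prop]
theorem polyTime_splitLeftAll {E : α → Table} {k : α → ℕ} {L : α → List Constraint}
    (hE : PolyTime E) (hk : PolyTime k) (hL : PolyTime L) :
    PolyTime fun x => splitLeftAll (E x) (k x) (L x) :=
  hL.flatMap (by fun_prop)

@[fun_prop]
theorem polyTime_splitRightAll {E : α → Table} {k : α → ℕ} {L : α → List Constraint}
    (hE : PolyTime E) (hk : PolyTime k) (hL : PolyTime L) :
    PolyTime fun x => splitRightAll (E x) (k x) (L x) :=
  hL.flatMap (by fun_prop)

@[fun_prop]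
theorem polyTime_stage {E : α → Table} {L : α → List Constraint} {k : α → ℕ}
    (hE : PolyTime E) (hL : PolyTime L) (hk : PolyTime k) :
    PolyTime fun x => stage (E x) (L x) (k x) :=
  polyTime_compact hE (PolyTime.flatMap (by fun_prop) (by fun_prop))

@[fun_prop]
theorem polyTime_stages {E : α → Table} {L : α → List Constraint}
    (hE : PolyTime E) (hL : PolyTime L) : PolyTime fun x => stages (E x) (L x) := by
  have hk := (polyTime_keys hE).size_bdd
  refine (hE.rangeLength).reverse.foldl hL (h := fun x L k => stage (E x) L k) (by fun_prop)
    (m := fun x => size (L x) +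
      (2 * size (keys (E x))) * (size (keys (E x)) + 2 * size (E x) + 10))
    (hL.size_bdd.add (((PolyBdd.const 2).mul hk).mul ((hk.add ((PolyBdd.const 2).mul
      hE.size_bdd)).add (.const 10)))) fun x l _ => ?_
  induction l using List.reverseRecOn with
  | nil => simp
  | append_singleton l k ih =>
    rw [List.foldl_append]
    -- Only the compaction at the end of the last stage matters.
    exact (size_compact_le _ _).trans (Nat.le_add_left _ _)

@[fun_prop]
theorem polyTime_check {E : α → Table} {c : α → Constraint} (hE : PolyTime E) (hc : PolyTime c) :
    PolyTime fun x => check (E x) (c x) := by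
  have h : PolyTime fun y : α × ℕ => (rule (E y.1) (c y.1).2.1).elim (fun b => y.2.beq b)
      fun _ => false := polyTime_elim (by fun_prop) (by fun_prop) (by fun_prop)
  exact polyTime_elim (f := fun x => rule (E x) (c x).1) (by fun_prop) h (by fun_prop)

theorem table_append_singleton (R : List (ℕ ⊕ ℕ × ℕ)) (r : ℕ ⊕ ℕ × ℕ) :
    table (R ++ [r]) = table R ++
      [(r.elim (fun _ => 1) fun pq => len (table R) pq.1 + len (table R) pq.2, r)] := by
  simp [table]

theorem length_table (R : List (ℕ ⊕ ℕ × ℕ)) : (table R).length = R.length := by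
  induction R using List.reverseRecOn with
  | nil => rfl
  | append_singleton R r ih => rw [table_append_singleton]; simp [ih]

/-- A production at most doubles the maximal length, and invalid indices have length 0. So all
lengths have linearly many digits. -/
theorem len_table_le (R : List (ℕ ⊕ ℕ × ℕ)) (a : ℕ) : len (table R) a ≤ 2 ^ R.length := by
  induction R using List.reverseRecOn generalizing a with
  | nil => exact Nat.zero_le _
  | append_singleton R r ih =>
    rw [table_append_singleton, List.length_append, List.length_singleton, pow_succ]
    have h0 := ih a
    rcases lt_trichotomy a R.length with h | h | h
    · rw [len, List.getD_append _ _ _ _ (by rwa [length_table])]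
      rw [len] at h0
      omega
    · rw [len, List.getD_append_right _ _ _ _ (by rw [length_table]; omega), length_table, h,
        Nat.sub_self]
      cases r with
      | inl a =>
        have := Nat.one_le_two_pow (n := R.length)
        simp; omega
      | inr pq =>
        have h1 := ih pq.1
        have h2 := ih pq.2
        simp; omega
    · rw [len, List.getD_eq_default _ _ (by simp [length_table]; omega)]
      exact Nat.zero_le _

theorem size_table_le (R : List (ℕ ⊕ ℕ × ℕ)) :
    size (table R) ≤ size R + R.length * (2 * R.length + 8) := by
  induction R using List.reverseRecOn with
  | nil => exact Nat.zero_le _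
  | append_singleton R r ih =>
    rw [table_append_singleton, size_append, size_append, size_cons, size_cons, size_pair]
    have h : size (r.elim (fun _ => 1) fun pq => len (table R) pq.1 + len (table R) pq.2 : ℕ) ≤
        2 * (R.length + 2) := by
      refine (size_le_natSize _).trans (Nat.mul_le_mul_left _ (Nat.size_le.2 ?_))
      rw [pow_succ, pow_succ]
      have := Nat.one_le_two_pow (n := R.length)
      cases r with
      | inl a => simp; omega
      | inr pq =>
        have h1 := len_table_le R pq.1
        have h2 := len_table_le R pq.2
        simp; omega
    rw [List.length_append, List.length_singleton]
    simp only [size_nil]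
    nlinarith

@[fun_prop]
theorem polyTime_table {R : α → List (ℕ ⊕ ℕ × ℕ)} (hR : PolyTime R) :
    PolyTime fun x => table (R x) := by
  refine hR.foldl (.const [])
    (h := fun _ E r => E ++ [(r.elim (fun _ => 1) fun pq => len E pq.1 + len E pq.2, r)]) ?_
    (m := fun x => size (R x) + size (R x) * (2 * size (R x) + 8))
    (hR.size_bdd.add (hR.size_bdd.mul (((PolyBdd.const 2).mul hR.size_bdd).add (.const 8))))
    fun x l hl => ?_
  · have : PolyTime fun x : α × Table × (ℕ ⊕ ℕ × ℕ) =>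
        x.2.2.elim (fun _ => 1) fun pq => len x.2.1 pq.1 + len x.2.1 pq.2 :=
      polyTime_elim (by fun_prop) (by fun_prop) (by fun_prop)
    fun_prop
  · refine (size_table_le l).trans ?_
    have h1 := size_prefix_le hl
    have h2 := (length_le_size l).trans h1
    gcongr

@[fun_prop]
theorem polyTime_shift {k : α → ℕ} {r : α → ℕ ⊕ ℕ × ℕ} (hk : PolyTime k) (hr : PolyTime r) :
    PolyTime fun x => shift (k x) (r x) := by
  refine polyTime_elim hr ?_ ?_ <;> fun_prop

@[fun_prop]
theorem polyTime_test {E : α → Table} {a b : α → ℕ} (hE : PolyTime E) (ha : PolyTime a)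
    (hb : PolyTime b) : PolyTime fun x => test (E x) (a x) (b x) := by
  have : PolyTime fun x => (stages (E x) [(a x, b x, 0)]).all (check (E x)) :=
    PolyTime.all (by fun_prop) (by fun_prop)
  unfold test
  fun_prop

@[fun_prop]
theorem polyTime_testRules {R R' : α → List (ℕ ⊕ ℕ × ℕ)} (hR : PolyTime R) (hR' : PolyTime R') :
    PolyTime fun x => testRules (R x) (R' x) := by
  have : PolyTime fun x => (R' x).map (shift (R x).length) := hR'.map (by fun_prop)
  unfold testRules
  fun_prop

end

end WordTest

/-! ### Combinatorics on words: overlaps and periods. -/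

namespace WordTest

/-- The word `u` without its first `i` letters agrees with `v`, as far as both are defined. -/
def Agree (u v : List ℕ) (i : ℕ) : Prop :=
  ∀ t, i + t < u.length → t < v.length → u[i + t]? = v[t]?

theorem agree_of_length_le {u v : List ℕ} {i : ℕ} (h : u.length ≤ i) : Agree u v i :=
  fun t h1 _ => absurd h1 (by omega)

theorem agree_append_left_of_le {p q v : List ℕ} {i : ℕ} (h : p.length ≤ i) :
    Agree (p ++ q) v i ↔ Agree q v (i - p.length) := by
  have key : ∀ t, (p ++ q)[i + t]? = q[i - p.length + t]? := fun t => by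
    rw [List.getElem?_append_right (by omega), Nat.sub_add_comm h]
  refine ⟨fun H t h1 h2 => ?_, fun H t h1 h2 => ?_⟩
  · rw [← key, H t (by rw [List.length_append]; omega) h2]
  · rw [List.length_append] at h1
    rw [key, H t (by omega) h2]

/-- The factor `q` begins at position `p.length - i` of `v`. From there on `v` is compared with `q`,
so `v` becomes the first word of the new constraint. -/
theorem agree_append_left_of_lt {p q v : List ℕ} {i : ℕ} (h : i < p.length) :
    Agree (p ++ q) v i ↔ Agree p v i ∧ Agree v q (p.length - i) := by
  refine ⟨fun H => ⟨fun t h1 h2 => ?_, fun t h1 h2 => ?_⟩, fun H t h1 h2 => ?_⟩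
  · rw [← H t (by rw [List.length_append]; omega) h2, List.getElem?_append_left h1]
  · rw [← H _ (by rw [List.length_append]; omega) h1, List.getElem?_append_right (by omega)]
    congr 1
    omega
  · rw [List.length_append] at h1
    rcases lt_or_ge (i + t) p.length with h3 | h3
    · rw [List.getElem?_append_left h3, H.1 t h3 h2]
    · have := H.2 (i + t - p.length) (by omega) (by omega)
      rw [List.getElem?_append_right h3, ← this]
      congr 1
      omega

theorem agree_append_right {u p q : List ℕ} {i : ℕ} :
    Agree u (p ++ q) i ↔ Agree u p i ∧ Agree u q (i + p.length) := by
  refine ⟨fun H => ⟨fun t h1 h2 => ?_, fun t h1 h2 => ?_⟩, fun H t h1 h2 => ?_⟩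
  · rw [H t h1 (by rw [List.length_append]; omega), List.getElem?_append_left h2]
  · rw [add_assoc, H _ (by omega) (by rw [List.length_append]; omega),
      List.getElem?_append_right (by omega), Nat.add_sub_cancel_left]
  · rw [List.length_append] at h2
    rcases lt_or_ge t p.length with h3 | h3
    · rw [List.getElem?_append_left h3, H.1 t h1 h3]
    · have := H.2 (t - p.length) (by omega) (by omega)
      rw [List.getElem?_append_right h3, ← this]
      congr 1
      omega

theorem agree_zero_iff {u v : List ℕ} (h : u.length = v.length) : Agree u v 0 ↔ u = v := by
  refine ⟨fun H => List.ext_getElem? fun t => ?_, fun H => ?_⟩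
  · rcases lt_or_ge t u.length with h1 | h1
    · simpa using H t (by omega) (by omega)
    · rw [List.getElem?_eq_none h1, List.getElem?_eq_none (by omega)]
  · subst H
    intro t _ _
    rw [Nat.zero_add]

/-- The function `f` on `{0, …, m - 1}` has period `p`. -/
def HasPeriod (f : ℕ → Option ℕ) (m p : ℕ) : Prop := ∀ t, p + t < m → f (p + t) = f t

theorem HasPeriod.mul {f : ℕ → Option ℕ} {m p : ℕ} (h : HasPeriod f m p) (n : ℕ) :
    HasPeriod f m (p * n) := by
  induction n with
  | zero => intro t _; simp
  | succ n ih =>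
    intro t ht
    rw [Nat.mul_succ] at ht ⊢
    rw [show p * n + p + t = p + (p * n + t) by ring, h _ (by omega), ih t (by omega)]

theorem HasPeriod.of_dvd {f : ℕ → Option ℕ} {m p q : ℕ} (h : HasPeriod f m p) (hpq : p ∣ q) :
    HasPeriod f m q := by
  obtain ⟨n, rfl⟩ := hpq
  exact h.mul n

/-- Go forward by `q` and then back by `p` if there is room for this; otherwise go back by `p`
first, which is possible since then `t ≥ m - q ≥ p`. -/
theorem HasPeriod.sub {f : ℕ → Option ℕ} {m p q : ℕ} (hp : HasPeriod f m p)
    (hq : HasPeriod f m q) (hpq : p ≤ q) (h : p + q ≤ m) : HasPeriod f m (q - p) := by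
  intro t ht
  rcases lt_or_ge (q + t) m with h1 | h1
  · rw [← hq t h1, ← hp _ (by omega)]
    congr 1
    omega
  · have h2 := hp (t - p) (by omega)
    have h3 := hq (t - p) (by omega)
    rw [show p + (t - p) = t by omega] at h2
    rw [h2, ← h3]
    congr 1
    omega

/-- The periodicity theorem of Fine and Wilf, in a weak form. -/
theorem HasPeriod.gcd {f : ℕ → Option ℕ} {m p q : ℕ} (hp : HasPeriod f m p)
    (hq : HasPeriod f m q) (h : p + q ≤ m) : HasPeriod f m (p.gcd q) := by
  -- Subtractive Euclidean algorithm: replacing the larger period by the difference preserves the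
  -- gcd and lowers the sum, so the length condition persists.
  induction hs : p + q using Nat.strong_induction_on generalizing p q with
  | _ s ih =>
    subst hs
    rcases Nat.eq_zero_or_pos p with rfl | hp0
    · rwa [Nat.gcd_zero_left]
    rcases Nat.eq_zero_or_pos q with rfl | hq0
    · rwa [Nat.gcd_zero_right]
    rcases le_total p q with hpq | hpq
    · have := ih (p + (q - p)) (by omega) hp (hp.sub hq hpq h) (by omega) rfl
      rwa [Nat.gcd_sub_self_right hpq] at this
    · have := ih (p - q + q) (by omega) (hq.sub hp hpq (by omega)) hq (by omega) rfl
      rwa [Nat.gcd_sub_self_left hpq] at this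

/-- Keeps the accumulated gcd at most `m / 2`, so that `HasPeriod.gcd` applies to it and the next
period. The value 0, at the start of the fold, needs the separate case. -/
theorem two_mul_gcd_le {m p q : ℕ} (hp : 2 * p ≤ m) (hq : 2 * q ≤ m) : 2 * p.gcd q ≤ m := by
  rcases Nat.eq_zero_or_pos p with rfl | h
  · rwa [Nat.gcd_zero_left]
  · have := Nat.gcd_le_left q h
    omega

theorem gcdOf_spec {f : ℕ → Option ℕ} {m : ℕ} {l : List ℕ} (hl : ∀ o ∈ l, 2 * (m - o) ≤ m) :
    2 * gcdOf m l ≤ m ∧ (HasPeriod f m (gcdOf m l) ↔ ∀ o ∈ l, HasPeriod f m (m - o)) := by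
  induction l using List.reverseRecOn with
  | nil =>
    refine ⟨Nat.zero_le _, fun _ o ho => by simp at ho, fun _ t _ => ?_⟩
    simp [gcdOf]
  | append_singleton l o ih =>
    obtain ⟨h1, h2⟩ := ih fun o ho => hl o (by simp [ho])
    have h3 := hl o (by simp)
    rw [gcdOf_append_singleton]
    refine ⟨two_mul_gcd_le h1 h3, fun h x hx => ?_, fun h => ?_⟩
    · rcases List.mem_append.1 hx with hx | hx
      · exact h2.1 (h.of_dvd (Nat.gcd_dvd_left _ _)) x hx
      · rw [List.mem_singleton.1 hx]
        exact h.of_dvd (Nat.gcd_dvd_right _ _)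
    · exact (h2.2 fun x hx => h x (by simp [hx])).gcd (h o (by simp)) (by omega)

/-- By `h` the last `m` letters of `u` are the first `m` letters of `v`. So the last `o` letters of
`u` can be read in `v` from position `m - o` on, and comparing them with the beginning of `v` is a
statement about a period. -/
theorem agree_suffix_iff {u v : List ℕ} {m o : ℕ} (hu : m ≤ u.length) (hv : m ≤ v.length)
    (ho : o ≤ m) (h : Agree u v (u.length - m)) :
    Agree u v (u.length - o) ↔ HasPeriod (fun t => v[t]?) m (m - o) := by
  have key : ∀ t < o, u[u.length - o + t]? = v[m - o + t]? := fun t ht => by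
    rw [← h (m - o + t) (by omega) (by omega)]
    congr 1
    omega
  refine ⟨fun H t ht => ?_, fun H t h1 h2 => ?_⟩
  · change v[m - o + t]? = v[t]?
    rw [← key t (by omega), H t (by omega) (by omega)]
  · rw [key t (by omega)]
    exact H t (by omega)

theorem le_maxOf {l : List ℕ} {o : ℕ} (h : o ∈ l) : o ≤ maxOf l := by
  induction l using List.reverseRecOn with
  | nil => simp at h
  | append_singleton l x ih =>
    have hm : maxOf (l ++ [x]) = max (maxOf l) x := by simp [maxOf]
    rw [hm]
    rcases List.mem_append.1 h with h | h
    · exact (ih h).trans (le_max_left _ _)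
    · rw [List.mem_singleton.1 h]
      exact le_max_right _ _

theorem maxOf_mem {l : List ℕ} (hl : l ≠ []) : maxOf l ∈ l := by
  rcases maxOf_mem_or l with h | h
  · obtain ⟨o, ho⟩ := List.exists_mem_of_ne_nil l hl
    have := le_maxOf ho
    rw [h] at this ⊢
    rwa [Nat.le_zero.1 this] at ho
  · exact h

/-- A list of overlaps is equivalent to its compressed list. -/
theorem compress_spec {u v : List ℕ} {l : List ℕ} (hu : ∀ o ∈ l, o ≤ u.length)
    (hv : ∀ o ∈ l, o ≤ v.length) (hl : ∀ o ∈ l, ∀ o' ∈ l, o' < 2 * o) :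
    (∀ o ∈ compress l, Agree u v (u.length - o)) ↔ ∀ o ∈ l, Agree u v (u.length - o) := by
  rcases eq_or_ne l [] with rfl | hne
  · rfl
  have hm := maxOf_mem hne
  have hemp : l.isEmpty = false := by simpa using hne
  rw [compress, hemp, cond_false]
  -- Since the maximum is less than `2 * o`, the period `maxOf l - o` is at most half the maximum.
  have hg := gcdOf_spec (f := fun t => v[t]?) (m := maxOf l) (l := l) fun o ho => by
    have := hl o ho _ hm
    omega
  have hgle := gcdOf_le (maxOf l) l
  simp only [List.mem_cons, List.not_mem_nil, or_false, forall_eq_or_imp, forall_eq]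
  refine ⟨fun ⟨h1, h2⟩ o ho => ?_, fun h => ⟨h _ hm, ?_⟩⟩
  · rw [agree_suffix_iff (hu _ hm) (hv _ hm) (Nat.sub_le _ _) h1, Nat.sub_sub_self hgle] at h2
    exact (agree_suffix_iff (hu _ hm) (hv _ hm) (le_maxOf ho) h1).2 (hg.2.1 h2 o ho)
  · rw [agree_suffix_iff (hu _ hm) (hv _ hm) (Nat.sub_le _ _) (h _ hm), Nat.sub_sub_self hgle]
    exact hg.2.2 fun o ho =>
      (agree_suffix_iff (hu _ hm) (hv _ hm) (le_maxOf ho) (h _ hm)).1 (h o ho)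

theorem compress_pos {l : List ℕ} (h0 : ∀ o ∈ l, 0 < o) (hl : ∀ o ∈ l, ∀ o' ∈ l, o' < 2 * o)
    {o : ℕ} (ho : o ∈ compress l) : 0 < o ∧ o ≤ maxOf l := by
  rcases eq_or_ne l [] with rfl | hne
  · simp [compress] at ho
  have hm := maxOf_mem hne
  have hemp : l.isEmpty = false := by simpa using hne
  rw [compress, hemp, cond_false] at ho
  -- The function is a dummy; only the bound `2 * gcdOf (maxOf l) l ≤ maxOf l` is needed.
  have hg := gcdOf_spec (f := fun _ => none) (m := maxOf l) (l := l) fun o ho => by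
    have := hl o ho _ hm
    omega
  have := h0 _ hm
  rcases List.mem_cons.1 ho with rfl | ho
  · exact ⟨this, le_rfl⟩
  · rw [List.mem_singleton.1 ho]
    omega

/-! ### Correctness of the equality test. -/

/-- The table `E` describes the words `W`. -/
def IsTable (E : Table) (W : ℕ → List ℕ) : Prop :=
  ∀ a < E.length, len E a = (W a).length ∧ ((∃ x, rule E a = .inl x ∧ W a = [x]) ∨
    ∃ p q, rule E a = .inr (p, q) ∧ p < a ∧ q < a ∧ W a = W p ++ W q)

/-- The words `W` satisfy a constraint. -/
def Holds (W : ℕ → List ℕ) (c : Constraint) : Prop := Agree (W c.1) (W c.2.1) c.2.2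

/-- The index `a` is valid, and if it is at least `k` then its production is a terminal. -/
def Low (E : Table) (k a : ℕ) : Prop := a < E.length ∧ (a < k ∨ ∃ x, rule E a = .inl x)

theorem Low.of_ne {E : Table} {k a : ℕ} (h : Low E (k + 1) a) (hk : a ≠ k) : Low E k a :=
  ⟨h.1, h.2.imp_left fun h => by omega⟩

theorem Low.of_lt {E : Table} {k a b : ℕ} (h : Low E k a) {x} (hr : rule E a = .inr x)
    (hb : b < a) : Low E k b := by
  refine ⟨hb.trans h.1, .inl (hb.trans ?_)⟩
  rcases h.2 with h | ⟨y, h⟩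
  · exact h
  · rw [hr] at h
    cases h

namespace IsTable

variable {E : Table} {W : ℕ → List ℕ} (hE : IsTable E W)

include hE

theorem length_pos {a : ℕ} (ha : a < E.length) : 0 < (W a).length := by
  induction a using Nat.strong_induction_on with
  | _ a ih =>
    rcases (hE a ha).2 with ⟨x, -, h⟩ | ⟨p, q, -, hp, -, h⟩
    · simp [h]
    · have := ih p hp (hp.trans ha)
      rw [h, List.length_append]
      omega

theorem length_le {a : ℕ} (ha : a < E.length) : (W a).length ≤ 2 ^ a := by
  induction a using Nat.strong_induction_on with
  | _ a ih =>
    rcases (hE a ha).2 with ⟨x, -, h⟩ | ⟨p, q, -, hp, hq, h⟩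
    · rw [h]
      exact Nat.one_le_two_pow
    · have h1 := ih p hp (hp.trans ha)
      have h2 := ih q hq (hq.trans ha)
      obtain ⟨b, rfl⟩ : ∃ b, a = b + 1 := ⟨a - 1, by omega⟩
      have h3 : 2 ^ p ≤ 2 ^ b := Nat.pow_le_pow_right (by omega) (by omega)
      have h4 : 2 ^ q ≤ 2 ^ b := Nat.pow_le_pow_right (by omega) (by omega)
      rw [h, List.length_append, pow_succ]
      omega

theorem splitLeft_holds {c : Constraint} (hc : c.1 < E.length) :
    (∀ d ∈ splitLeft E c, Holds W d) ↔ Holds W c := by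
  rcases (hE c.1 hc).2 with ⟨x, h, -⟩ | ⟨p, q, h, hp, hq, hw⟩
  · simp [splitLeft, h]
  · have hlen := (hE p (hp.trans hc)).1
    simp only [splitLeft, h, Sum.elim_inr, Holds, hw, hlen]
    cases hle : (W p).length.ble c.2.2
    · rw [← Bool.not_eq_true, Nat.ble_eq, not_le] at hle
      simp [agree_append_left_of_lt hle]
    · rw [Nat.ble_eq] at hle
      simp [agree_append_left_of_le hle]

theorem splitRight_holds {c : Constraint} (hc : c.2.1 < E.length) :
    (∀ d ∈ splitRight E c, Holds W d) ↔ Holds W c := by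
  rcases (hE c.2.1 hc).2 with ⟨x, h, -⟩ | ⟨p, q, h, hp, hq, hw⟩
  · simp [splitRight, h]
  · have hlen := (hE p (hp.trans hc)).1
    simp [splitRight, h, Holds, hw, hlen, agree_append_right]

theorem splitLeft_low {c d : Constraint} {k : ℕ} (h1 : Low E k c.1)
    (hr : ¬ ∃ x, rule E c.1 = .inl x) (hd : d ∈ splitLeft E c) :
    (d.1 < c.1 ∧ Low E k d.1 ∧ d.2.1 = c.2.1) ∨ (d.1 = c.2.1 ∧ d.2.1 < c.1 ∧ Low E k d.2.1) := by
  rcases (hE c.1 h1.1).2 with ⟨x, h, -⟩ | ⟨p, q, h, hp, hq, -⟩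
  · exact absurd ⟨x, h⟩ hr
  · have hp' := h1.of_lt h hp
    have hq' := h1.of_lt h hq
    simp only [splitLeft, h, Sum.elim_inr] at hd
    cases hle : (len E p).ble c.2.2
    · simp only [hle, cond_false, List.mem_cons, List.not_mem_nil, or_false] at hd
      rcases hd with rfl | rfl
      · exact .inl ⟨hp, hp', rfl⟩
      · exact .inr ⟨rfl, hq, hq'⟩
    · simp only [hle, cond_true, List.mem_singleton] at hd
      subst hd
      exact .inl ⟨hq, hq', rfl⟩

theorem splitRight_low {c d : Constraint} {k : ℕ} (h2 : Low E k c.2.1)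
    (hr : ¬ ∃ x, rule E c.2.1 = .inl x) (hd : d ∈ splitRight E c) :
    d.1 = c.1 ∧ d.2.1 < c.2.1 ∧ Low E k d.2.1 := by
  rcases (hE c.2.1 h2.1).2 with ⟨x, h, -⟩ | ⟨p, q, h, hp, hq, -⟩
  · exact absurd ⟨x, h⟩ hr
  · have hp' := h2.of_lt h hp
    have hq' := h2.of_lt h hq
    simp only [splitRight, h, Sum.elim_inr, List.mem_cons, List.not_mem_nil, or_false] at hd
    rcases hd with rfl | rfl
    · exact ⟨rfl, hp, hp'⟩
    · exact ⟨rfl, hq, hq'⟩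

/-- If the second word ends within the factor `p`, then the constraint with the other factor `q` is
vacuous and may be dropped. -/
theorem descend_spec {c : Constraint} {k : ℕ} (h1 : Low E k c.1) (h2 : Low E k c.2.1) :
    Low E k (descend E c).1 ∧ (descend E c).2.1 = c.2.1 ∧
      (Holds W (descend E c) ↔ Holds W c) ∧ (descend E c = c ∨ (descend E c).1 < c.1) := by
  rw [descend]
  cases inner E c
  · exact ⟨h1, rfl, .rfl, .inl rfl⟩
  · rcases (hE c.1 h1.1).2 with ⟨x, h, -⟩ | ⟨p, q, h, hp, hq, hw⟩
    · rw [h]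
      exact ⟨h1, rfl, .rfl, .inl rfl⟩
    · have hlen := (hE p (hp.trans h1.1)).1
      have hlen2 := (hE _ h2.1).1
      simp only [h, Sum.elim_inr, cond_true]
      cases hle : (len E p).ble c.2.2
      · rw [← Bool.not_eq_true, Nat.ble_eq, not_le, hlen] at hle
        cases hle2 : (len E c.2.1).ble (len E p - c.2.2)
        · exact ⟨h1, rfl, .rfl, .inl rfl⟩
        · rw [Nat.ble_eq, hlen, hlen2] at hle2
          refine ⟨h1.of_lt h hp, rfl, ?_, .inr hp⟩
          simp only [cond_false, cond_true, Holds, hw]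
          rw [agree_append_left_of_lt hle]
          exact ⟨fun h => ⟨h, agree_of_length_le hle2⟩, fun h => h.1⟩
      · rw [Nat.ble_eq, hlen] at hle
        refine ⟨h1.of_lt h hq, rfl, ?_, .inr hq⟩
        simp only [cond_true, Holds, hw, hlen]
        rw [agree_append_left_of_le hle]

/-- A descent that changes the constraint lowers the first index, so as many steps as the table has
entries lead to a fixed point: for `l = E` the last alternative is impossible. -/
theorem foldl_descend_spec {c : Constraint} {k : ℕ} (h1 : Low E k c.1) (h2 : Low E k c.2.1)
    (l : Table) {d : Constraint} (hd : l.foldl (fun c _ => descend E c) c = d) :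
    Low E k d.1 ∧ d.2.1 = c.2.1 ∧ (Holds W d ↔ Holds W c) ∧
      (descend E d = d ∨ d.1 + l.length ≤ c.1) := by
  induction l using List.reverseRecOn generalizing d with
  | nil =>
    subst hd
    exact ⟨h1, rfl, .rfl, .inr le_rfl⟩
  | append_singleton l r ih =>
    rw [List.foldl_append] at hd
    change descend E (l.foldl (fun c _ => descend E c) c) = d at hd
    generalize hx : l.foldl (fun c _ => descend E c) c = x at hd
    obtain ⟨h3, h4, h5, h6⟩ := ih hx
    obtain ⟨h7, h8, h9, h10⟩ := hE.descend_spec h3 (by rwa [h4])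
    rw [hd] at h7 h8 h9 h10
    refine ⟨h7, h8.trans h4, h9.trans h5, ?_⟩
    rcases h10 with h10 | h10
    · left
      rw [h10, hd, h10]
    · rcases h6 with h6 | h6
      · rw [← hd, h6] at h10
        exact absurd h10 (lt_irrefl _)
      · right
        rw [List.length_append, List.length_singleton]
        omega

/-- A constraint relates a suffix of the first word to a prefix of the second one. -/
theorem normalize_spec {c : Constraint} {k : ℕ} (h1 : Low E k c.1) (h2 : Low E k c.2.1) :
    ((∀ d ∈ normalize E c, Holds W d) ↔ Holds W c) ∧ ∀ d ∈ normalize E c,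
      Low E k d.1 ∧ Low E k d.2.1 ∧ (W d.1).length - d.2.2 ≤ (W d.2.1).length := by
  obtain ⟨h3, h4, h5, h6⟩ := hE.foldl_descend_spec h1 h2 E rfl
  change Low E k (descendAll E c).1 at h3
  change (descendAll E c).2.1 = c.2.1 at h4
  change Holds W (descendAll E c) ↔ _ at h5
  change descend E (descendAll E c) = descendAll E c ∨ (descendAll E c).1 + _ ≤ _ at h6
  have h6 : descend E (descendAll E c) = descendAll E c :=
    h6.resolve_right fun h => by have := h1.1; omega
  rw [normalize]
  generalize descendAll E c = x at *
  rw [← h4] at h2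
  have hl1 := (hE _ h3.1).1
  have hl2 := (hE _ h2.1).1
  cases hin : inner E x
  · rw [inner, Bool.not_eq_false', Nat.ble_eq, hl1, hl2] at hin
    simp only [cond_false, List.mem_singleton, forall_eq]
    exact ⟨h5, h3, h2, hin⟩
  -- The second word still ends inside the first one, but in neither factor alone: the border of the
  -- factors lies strictly inside its occurrence. Splitting there compares a suffix of `p` with a
  -- prefix of the second word, and a suffix of the second word with a prefix of `q`.
  · rw [cond_true, hE.splitLeft_holds h3.1]
    refine ⟨h5, ?_⟩
    rw [descend, hin, cond_true] at h6
    rw [inner, Bool.not_eq_true', ← Bool.not_eq_true, Nat.ble_eq, hl1, hl2, not_le] at hin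
    have hpos := hE.length_pos h2.1
    rcases (hE x.1 h3.1).2 with ⟨y, h, hw⟩ | ⟨p, q, h, hp, hq, hw⟩
    · rw [hw, List.length_singleton] at hin
      omega
    · have hlp := (hE p (hp.trans h3.1)).1
      have hlq := (hE q (hq.trans h3.1)).1
      rw [hw, List.length_append] at hin
      simp only [h, Sum.elim_inr] at h6
      cases hle : (len E p).ble x.2.2
      · rw [hle, cond_false] at h6
        simp only [splitLeft, h, Sum.elim_inr, hle, cond_false, List.mem_cons, List.not_mem_nil,
          or_false, forall_eq_or_imp, forall_eq]
        rw [← Bool.not_eq_true, Nat.ble_eq, not_le, hlp] at hle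
        cases hle2 : (len E x.2.1).ble (len E p - x.2.2)
        · rw [← Bool.not_eq_true, Nat.ble_eq, not_le, hlp, hl2] at hle2
          refine ⟨⟨h3.of_lt h hp, h2, hle2.le⟩, h2, h3.of_lt h hq, ?_⟩
          rw [hlp]
          omega
        · rw [hle2, cond_true] at h6
          -- A fixed point would give `p = x.1`, contrary to `p < x.1`.
          have := congrArg Prod.fst h6
          simp only at this
          omega
      · rw [hle, cond_true] at h6
        have := congrArg Prod.fst h6
        simp only at this
        omega

/-- Ensures that `keys` covers all nonempty overlaps. -/
theorem natSize_overlap {c : Constraint} (hc : c.1 < E.length) :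
    overlap E c = (W c.1).length - c.2.2 ∧ (overlap E c).size ≤ E.length := by
  have h1 : overlap E c = (W c.1).length - c.2.2 := by rw [overlap, (hE _ hc).1]
  refine ⟨h1, Nat.size_le.2 ?_⟩
  have h2 := hE.length_le hc
  have h3 : 2 ^ c.1 < 2 ^ E.length := Nat.pow_lt_pow_right (by omega) hc
  omega

omit hE in
theorem mem_select {L : List Constraint} {a b s : ℕ} {c : Constraint} :
    c ∈ select E L (a, b, s) ↔ c ∈ L ∧ c.1 = a ∧ c.2.1 = b ∧ (overlap E c).size = s := by
  rw [select, List.mem_filter, Bool.and_eq_true, Bool.and_eq_true, Nat.beq_eq, Nat.beq_eq,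
    Nat.beq_eq]

omit hE in
theorem mem_keys {a b s : ℕ} :
    (a, b, s) ∈ keys E ↔ a < E.length ∧ b < E.length ∧ 0 < s ∧ s ≤ E.length := by
  simp only [keys, List.mem_flatMap, List.mem_map, List.mem_range, Prod.mk.injEq]
  constructor
  · rintro ⟨a', ha, b', hb, s', hs, rfl, rfl, rfl⟩
    exact ⟨ha, hb, by omega, by omega⟩
  · rintro ⟨ha, hb, h0, hs⟩
    exact ⟨a, ha, b, hb, s - 1, by omega, rfl, rfl, by omega⟩

/-- Compaction of a list of constraints which relate suffixes to prefixes. -/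
theorem compact_spec {L : List Constraint} {k : ℕ} (hL : ∀ c ∈ L, Low E k c.1 ∧ Low E k c.2.1 ∧
      (W c.1).length - c.2.2 ≤ (W c.2.1).length) :
    ((∀ d ∈ compact E L, Holds W d) ↔ ∀ c ∈ L, Holds W c) ∧ ∀ d ∈ compact E L,
      Low E k d.1 ∧ Low E k d.2.1 ∧ d.2.2 < (W d.1).length := by
  -- A number with `s > 0` binary digits lies between `2 ^ (s - 1)` and `2 ^ s`, so any overlap of a
  -- class is less than twice any other.
  have hsel : ∀ a b s, 0 < s → ∀ o ∈ (select E L (a, b, s)).map (overlap E), ∃ i,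
      (a, b, i) ∈ L ∧ o = (W a).length - i ∧ o < 2 ^ s ∧ 2 ^ s ≤ 2 * o := by
    intro a b s hs o ho
    obtain ⟨⟨a', b', i⟩, hc, rfl⟩ := List.mem_map.1 ho
    obtain ⟨hcL, rfl, rfl, rfl⟩ := mem_select.1 hc
    refine ⟨i, hcL, (hE.natSize_overlap (hL _ hcL).1.1).1, Nat.lt_size_self _, ?_⟩
    obtain ⟨t, ht⟩ : ∃ t, (overlap E (a', b', i)).size = t + 1 :=
      ⟨(overlap E (a', b', i)).size - 1, by omega⟩
    have := Nat.lt_size.1 (show t < (overlap E (a', b', i)).size by omega)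
    rw [ht, pow_succ]
    omega
  have hkey : ∀ a b s, a < E.length → 0 < s →
      ((∀ o ∈ compress ((select E L (a, b, s)).map (overlap E)),
        Agree (W a) (W b) ((W a).length - o)) ↔ ∀ c ∈ select E L (a, b, s), Holds W c) ∧
      ∀ o ∈ compress ((select E L (a, b, s)).map (overlap E)),
        Low E k a ∧ Low E k b ∧ 0 < o := by
    intro a b s ha hs
    have h0 := hsel a b s hs
    have hlt : ∀ o ∈ (select E L (a, b, s)).map (overlap E),
        ∀ o' ∈ (select E L (a, b, s)).map (overlap E), o' < 2 * o := by
      intro o ho o' ho'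
      obtain ⟨i, -, -, -, h1⟩ := h0 o ho
      obtain ⟨i', -, -, h2, -⟩ := h0 o' ho'
      omega
    have hpos : ∀ o ∈ (select E L (a, b, s)).map (overlap E), 0 < o := by
      intro o ho
      obtain ⟨i, -, -, -, h1⟩ := h0 o ho
      have := Nat.pow_pos (n := s) (show 0 < 2 by omega)
      omega
    constructor
    · rw [compress_spec _ _ hlt]
      · rw [List.forall_mem_map]
        refine forall₂_congr fun c hc => ?_
        obtain ⟨a', b', i⟩ := c
        obtain ⟨hcL, rfl, rfl, rfl⟩ := mem_select.1 hc
        have h1 := (hE.natSize_overlap (hL _ hcL).1.1).1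
        have h2 := hpos _ (List.mem_map_of_mem hc)
        change overlap E (a', b', i) = (W a').length - i at h1
        rw [h1] at h2 ⊢
        rw [Nat.sub_sub_self (show i ≤ (W a').length by omega)]
        rfl
      · intro o ho
        obtain ⟨i, -, h1, -⟩ := h0 o ho
        omega
      · intro o ho
        obtain ⟨i, hi, h1, -⟩ := h0 o ho
        have h2 : (W a).length - i ≤ (W b).length := (hL _ hi).2.2
        omega
    · intro o ho
      refine ⟨?_, ?_, (compress_pos hpos hlt ho).1⟩
      all_goals
        -- A class with nonempty compression is itself nonempty, and any of its members shows that
        -- `a` and `b` are low.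
        rcases eq_or_ne ((select E L (a, b, s)).map (overlap E)) [] with h | h
        · rw [h] at ho
          simp [compress] at ho
        · obtain ⟨i, hi, -⟩ := h0 _ (maxOf_mem h)
          first | exact (hL _ hi).1 | exact (hL _ hi).2.1
  refine ⟨⟨fun H c hc => ?_, fun H d hd => ?_⟩, fun d hd => ?_⟩
  · obtain ⟨a, b, i⟩ := c
    obtain ⟨h1, h2, h3⟩ := hL _ hc
    obtain ⟨h4, h5⟩ := hE.natSize_overlap h1.1
    -- An empty overlap belongs to no key; such a constraint is dropped, but it holds trivially.
    rcases Nat.eq_zero_or_pos (overlap E (a, b, i)) with h0 | h0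
    · rw [h4] at h0
      exact agree_of_length_le (Nat.sub_eq_zero_iff_le.1 h0)
    · have hs := Nat.size_pos.2 h0
      refine (hkey a b _ h1.1 hs).1.1 (fun o ho => ?_) _ (mem_select.2 ⟨hc, rfl, rfl, rfl⟩)
      have h6 := H (a, b, len E a - o) (List.mem_flatMap.2
        ⟨_, mem_keys.2 ⟨h1.1, h2.1, hs, h5⟩, List.mem_map.2 ⟨o, ho, rfl⟩⟩)
      rw [(hE a h1.1).1] at h6
      exact h6
  · obtain ⟨⟨a, b, s⟩, hk, hd⟩ := List.mem_flatMap.1 hd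
    obtain ⟨o, ho, rfl⟩ := List.mem_map.1 hd
    obtain ⟨ha, hb, hs, -⟩ := mem_keys.1 hk
    change Agree (W a) (W b) (len E a - o)
    rw [(hE a ha).1]
    exact (hkey a b s ha hs).1.2 (fun c hc => H c (mem_select.1 hc).1) o ho
  · obtain ⟨⟨a, b, s⟩, hk, hd⟩ := List.mem_flatMap.1 hd
    obtain ⟨o, ho, rfl⟩ := List.mem_map.1 hd
    obtain ⟨ha, hb, hs, -⟩ := mem_keys.1 hk
    obtain ⟨h1, h2, h3⟩ := (hkey a b s ha hs).2 o ho
    refine ⟨h1, h2, ?_⟩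
    change len E a - o < (W a).length
    rw [(hE a ha).1]
    have := hE.length_pos ha
    omega

omit hE in
theorem forall_mem_flatMap {L : List Constraint} {f : Constraint → List Constraint}
    (h : ∀ c ∈ L, (∀ d ∈ f c, Holds W d) ↔ Holds W c) :
    (∀ d ∈ L.flatMap f, Holds W d) ↔ ∀ c ∈ L, Holds W c := by
  simp only [List.mem_flatMap, forall_exists_index, and_imp]
  exact ⟨fun H c hc => (h c hc).1 fun d hd => H d c hc hd,
    fun H d c hc hd => (h c hc).2 (H c hc) d hd⟩

theorem splitLeftAll_holds {L : List Constraint} {k : ℕ} (hL : ∀ c ∈ L, c.1 < E.length) :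
    (∀ d ∈ splitLeftAll E k L, Holds W d) ↔ ∀ c ∈ L, Holds W c :=
  forall_mem_flatMap fun c hc => by
    cases c.1.beq k
    · simp
    · exact hE.splitLeft_holds (hL c hc)

theorem splitRightAll_holds {L : List Constraint} {k : ℕ} (hL : ∀ c ∈ L, c.2.1 < E.length) :
    (∀ d ∈ splitRightAll E k L, Holds W d) ↔ ∀ c ∈ L, Holds W c :=
  forall_mem_flatMap fun c hc => by
    cases c.2.1.beq k
    · simp
    · exact hE.splitRight_holds (hL c hc)

/-- Splitting `(k, k, i)` on the left may give one constraint with `k` in second place and, with the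
words exchanged, one with `k` in first place. After one pass `k` survives in at most one place, and
after a second pass no longer in first place. Hence `stage` splits twice on the left before it
splits on the right. -/
theorem splitLeftAll_low {L : List Constraint} {k : ℕ}
    (hL : ∀ c ∈ L, Low E (k + 1) c.1 ∧ Low E (k + 1) c.2.1) :
    ∀ d ∈ splitLeftAll E k L, (Low E (k + 1) d.1 ∧ Low E (k + 1) d.2.1) ∧
      ((Low E k d.1) ∨ Low E k d.2.1) ∧ ((∀ c ∈ L, Low E k c.1 ∨ Low E k c.2.1) → Low E k d.1) := by
  intro d hd
  obtain ⟨c, hc, hd⟩ := List.mem_flatMap.1 hd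
  obtain ⟨h1, h2⟩ := hL c hc
  by_cases hk : Low E k c.1
  · cases hck : c.1.beq k
    · rw [hck, cond_false, List.mem_singleton] at hd
      subst hd
      exact ⟨⟨h1, h2⟩, .inl hk, fun _ => hk⟩
    · rw [Nat.beq_eq] at hck
      -- The index `k` itself is low only if its production is a terminal, and then splitting does
      -- nothing.
      obtain ⟨x, hx⟩ := hk.2.resolve_left (by omega)
      have : (bif c.1.beq k then splitLeft E c else [c]) = [c] := by
        cases c.1.beq k <;> simp [splitLeft, hx]
      rw [this, List.mem_singleton] at hd
      subst hd
      exact ⟨⟨h1, h2⟩, .inl hk, fun _ => hk⟩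
  · have hck : c.1 = k := by
      by_contra h
      exact hk (h1.of_ne h)
    have hr : ¬ ∃ x, rule E c.1 = .inl x := fun h => hk ⟨h1.1, .inr h⟩
    have hb : c.1.beq k = true := by rw [Nat.beq_eq]; exact hck
    rw [hb, cond_true] at hd
    rcases hE.splitLeft_low h1 hr hd with ⟨h3, h4, h5⟩ | ⟨h3, h4, h5⟩
    · have h6 : Low E k d.1 := ⟨h4.1, .inl (by omega)⟩
      exact ⟨⟨h4, h5 ▸ h2⟩, .inl h6, fun _ => h6⟩
    · have h6 : Low E k d.2.1 := ⟨h5.1, .inl (by omega)⟩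
      refine ⟨⟨h3 ▸ h2, h5⟩, .inr h6, fun h => ?_⟩
      rw [h3]
      exact (h c hc).resolve_left hk

theorem splitRightAll_low {L : List Constraint} {k : ℕ}
    (hL : ∀ c ∈ L, Low E k c.1 ∧ Low E (k + 1) c.2.1) :
    ∀ d ∈ splitRightAll E k L, Low E k d.1 ∧ Low E k d.2.1 := by
  intro d hd
  obtain ⟨c, hc, hd⟩ := List.mem_flatMap.1 hd
  obtain ⟨h1, h2⟩ := hL c hc
  by_cases hk : Low E k c.2.1
  · have : (bif c.2.1.beq k then splitRight E c else [c]) = [c] := by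
      cases hck : c.2.1.beq k
      · rfl
      · rw [Nat.beq_eq] at hck
        obtain ⟨x, hx⟩ := hk.2.resolve_left (by omega)
        simp [splitRight, hx]
    rw [this, List.mem_singleton] at hd
    subst hd
    exact ⟨h1, hk⟩
  · have hck : c.2.1 = k := by
      by_contra h
      exact hk (h2.of_ne h)
    have hr : ¬ ∃ x, rule E c.2.1 = .inl x := fun h => hk ⟨h2.1, .inr h⟩
    have hb : c.2.1.beq k = true := by rw [Nat.beq_eq]; exact hck
    rw [hb, cond_true] at hd
    obtain ⟨h3, h4, h5⟩ := hE.splitRight_low h2 hr hd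
    exact ⟨h3 ▸ h1, h5.1, .inl (by omega)⟩

theorem stage_spec {L : List Constraint} {k : ℕ}
    (hL : ∀ c ∈ L, Low E (k + 1) c.1 ∧ Low E (k + 1) c.2.1) :
    ((∀ d ∈ stage E L k, Holds W d) ↔ ∀ c ∈ L, Holds W c) ∧ ∀ d ∈ stage E L k,
      Low E k d.1 ∧ Low E k d.2.1 ∧ d.2.2 < (W d.1).length := by
  have h1 := hE.splitLeftAll_low hL
  have h2 := hE.splitLeftAll_low fun c hc => (h1 c hc).1
  have h3 := hE.splitRightAll_low fun c hc =>
    ⟨(h2 c hc).2.2 fun c hc => (h1 c hc).2.1, (h2 c hc).1.2⟩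
  have h4 : ∀ c ∈ (splitRightAll E k (splitLeftAll E k (splitLeftAll E k L))).flatMap (normalize E),
      Low E k c.1 ∧ Low E k c.2.1 ∧ (W c.1).length - c.2.2 ≤ (W c.2.1).length := by
    intro d hd
    obtain ⟨c, hc, hd⟩ := List.mem_flatMap.1 hd
    exact (hE.normalize_spec (h3 c hc).1 (h3 c hc).2).2 d hd
  obtain ⟨h5, h6⟩ := hE.compact_spec h4
  refine ⟨h5.trans ?_, h6⟩
  rw [forall_mem_flatMap fun c hc => (hE.normalize_spec (h3 c hc).1 (h3 c hc).2).1,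
    hE.splitRightAll_holds fun c hc => (h2 c hc).1.2.1,
    hE.splitLeftAll_holds fun c hc => (h1 c hc).1.1.1,
    hE.splitLeftAll_holds fun c hc => (hL c hc).1.1]

/-- The reversed range starts with the largest non-terminal; its elimination introduces only smaller
ones, so no stage has to be repeated. -/
theorem foldl_stage_spec (n : ℕ) {L : List Constraint}
    (hL : ∀ c ∈ L, Low E n c.1 ∧ Low E n c.2.1 ∧ c.2.2 < (W c.1).length) :
    ((∀ d ∈ (List.range n).reverse.foldl (stage E) L, Holds W d) ↔ ∀ c ∈ L, Holds W c) ∧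
      ∀ d ∈ (List.range n).reverse.foldl (stage E) L,
        Low E 0 d.1 ∧ Low E 0 d.2.1 ∧ d.2.2 < (W d.1).length := by
  induction n generalizing L with
  | zero => exact ⟨.rfl, hL⟩
  | succ n ih =>
    rw [List.range_succ, List.reverse_append, List.reverse_singleton, List.singleton_append,
      List.foldl_cons]
    obtain ⟨h1, h2⟩ := hE.stage_spec fun c hc => ⟨(hL c hc).1, (hL c hc).2.1⟩
    obtain ⟨h3, h4⟩ := ih h2
    exact ⟨h3.trans h1, h4⟩

/-- The strict bound on the offset is needed here: both words are single letters, so the offset is 0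
and the constraint is not vacuous. -/
theorem check_iff {c : Constraint} (h1 : Low E 0 c.1) (h2 : Low E 0 c.2.1)
    (h3 : c.2.2 < (W c.1).length) : check E c = true ↔ Holds W c := by
  obtain ⟨x, hx⟩ := h1.2.resolve_left (Nat.not_lt_zero _)
  obtain ⟨y, hy⟩ := h2.2.resolve_left (Nat.not_lt_zero _)
  have hwx : W c.1 = [x] := by
    rcases (hE _ h1.1).2 with ⟨z, h, hw⟩ | ⟨p, q, h, -⟩ <;> rw [hx] at h <;> cases h
    exact hw
  have hwy : W c.2.1 = [y] := by
    rcases (hE _ h2.1).2 with ⟨z, h, hw⟩ | ⟨p, q, h, -⟩ <;> rw [hy] at h <;> cases h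
    exact hw
  have h0 : c.2.2 = 0 := by simpa [hwx] using h3
  rw [check, hx, hy, Holds, h0, hwx, hwy, agree_zero_iff (u := [x]) (v := [y]) rfl]
  simp

/-- A constraint compares words only up to the end of the shorter one; the separate comparison of
lengths turns agreement at offset 0 into equality. -/
theorem test_iff {a b : ℕ} (ha : a < E.length) (hb : b < E.length) :
    test E a b = true ↔ W a = W b := by
  rw [test, Bool.and_eq_true, Nat.beq_eq, (hE a ha).1, (hE b hb).1, List.all_eq_true]
  have hL : ∀ c ∈ [((a, b, 0) : Constraint)],
      Low E E.length c.1 ∧ Low E E.length c.2.1 ∧ c.2.2 < (W c.1).length := by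
    simp only [List.mem_singleton, forall_eq]
    exact ⟨⟨ha, .inl ha⟩, ⟨hb, .inl hb⟩, hE.length_pos ha⟩
  obtain ⟨h1, h2⟩ := hE.foldl_stage_spec E.length hL
  change ((∀ d ∈ stages E [(a, b, 0)], Holds W d) ↔ _) at h1
  change ∀ d ∈ stages E [(a, b, 0)], _ at h2
  have h3 : (∀ c ∈ stages E [(a, b, 0)], check E c = true) ↔ Agree (W a) (W b) 0 := by
    rw [forall₂_congr fun c hc => hE.check_iff (h2 c hc).1 (h2 c hc).2.1 (h2 c hc).2.2, h1]
    simp [Holds]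
  rw [h3]
  exact ⟨fun h => (agree_zero_iff h.1).1 h.2, fun h => by
    rw [h]; exact ⟨rfl, (agree_zero_iff rfl).2 rfl⟩⟩

end IsTable

theorem table_spec {R : List (ℕ ⊕ ℕ × ℕ)} {W : ℕ → List ℕ}
    (hR : ∀ a r, R[a]? = some r → (∃ x, r = .inl x ∧ W a = [x]) ∨
      ∃ p q, r = .inr (p, q) ∧ p < a ∧ q < a ∧ W a = W p ++ W q) : IsTable (table R) W := by
  induction R using List.reverseRecOn with
  | nil => intro a ha; exact absurd ha (Nat.not_lt_zero _)
  | append_singleton R r ih =>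
    have hT : IsTable (table R) W := ih fun a r' h => hR a r' (by
      rw [List.getElem?_append_left (List.getElem?_eq_some_iff.1 h).1, h])
    rw [table_append_singleton]
    intro a ha
    rcases lt_or_ge a R.length with h | h
    · have := hT a (by rwa [length_table])
      rw [len, rule] at this ⊢
      rwa [List.getD_append _ _ _ _ (by rwa [length_table])]
    · obtain rfl : a = R.length := by
        simp [length_table] at ha
        omega
      have h1 := hR R.length r (by simp)
      rw [len, rule, List.getD_append_right _ _ _ _ (by rw [length_table]), length_table,
        Nat.sub_self]
      rcases h1 with ⟨x, rfl, hx⟩ | ⟨p, q, rfl, hp, hq, hw⟩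
      · exact ⟨by simp [hx], .inl ⟨x, rfl, hx⟩⟩
      · have h2 := (hT p (by rwa [length_table])).1
        have h3 := (hT q (by rwa [length_table])).1
        exact ⟨by simp [hw, h2, h3], .inr ⟨p, q, rfl, hp, hq, hw⟩⟩

end WordTest

/-! ### Parsing the reversed input. -/

namespace StraightLineProgram

/-- The state of the parser, which reads a code from its end: the digits which are not yet part of a
symbol, the symbols which are not yet part of a production, the productions which are not yet part of
a program, and the programs. -/
abbrev ParseState : Type :=
  List Bool × List (ℕ ⊕ ℕ) × List (List (ℕ ⊕ ℕ)) × List (List (List (ℕ ⊕ ℕ)))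

/-- One step of the parser. -/
def parseStep (s : ParseState) : Token → ParseState
  | .bit b => (b :: s.1, s.2)
  | .terminal => ([], .inl (Nat.appendBits 0 s.1.reverse) :: s.2.1, s.2.2)
  | .nonterminal => ([], .inr (Nat.appendBits 0 s.1.reverse) :: s.2.1, s.2.2)
  | .rule => ([], [], s.2.1 :: s.2.2.1, s.2.2.2)
  | .program => ([], [], [], s.2.2.1 :: s.2.2.2)

/-- The programs of a reversed code. -/
def parse (l : List Token) : List (List (List (ℕ ⊕ ℕ))) :=
  (l.foldl parseStep ([], [], [], [])).2.2.2

theorem appendBits_reverse_encodeNat (n : ℕ) :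
    Nat.appendBits 0 (Computability.encodeNat n).reverse = n := by
  have key : ∀ p : PosNum,
      (Computability.encodePosNum p).foldr (fun b m => Nat.bit b m) 0 = (p : ℕ) := by
    intro p
    induction p with
    | one => rfl
    | bit1 p ih =>
      rw [Computability.encodePosNum, List.foldr_cons, ih, Nat.bit_val, PosNum.cast_bit1]
      simp; omega
    | bit0 p ih =>
      rw [Computability.encodePosNum, List.foldr_cons, ih, Nat.bit_val, PosNum.cast_bit0]
      simp; omega
  rw [Nat.appendBits, List.foldl_reverse, Computability.encodeNat]
  conv_rhs => rw [← Num.to_of_nat n]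
  cases (n : Num) with
  | zero => rfl
  | pos p => exact key p

theorem foldr_natCode (k : ℕ) (b : List Bool) (s) :
    (natCode k).foldr (fun t s => parseStep s t) (b, s) = (Computability.encodeNat k ++ b, s) := by
  rw [natCode, List.foldr_map]
  induction Computability.encodeNat k with
  | nil => rfl
  | cons c l ih => rw [List.foldr_cons, ih]; rfl

theorem foldr_symbolCode (x : ℕ ⊕ ℕ) (w s) :
    (symbolCode x).foldr (fun t s => parseStep s t) ([], w, s) = ([], x :: w, s) := by
  cases x <;> rw [symbolCode, List.foldr_cons, foldr_natCode, List.append_nil] <;>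
    simp only [parseStep, appendBits_reverse_encodeNat]

theorem foldr_flatMap_symbolCode (v w : List (ℕ ⊕ ℕ)) (s) :
    (v.flatMap symbolCode).foldr (fun t s => parseStep s t) ([], w, s) = ([], v ++ w, s) := by
  induction v with
  | nil => rfl
  | cons x v ih => rw [List.flatMap_cons, List.foldr_append, ih, foldr_symbolCode]; rfl

theorem foldr_flatMap_ruleCode (R S : List (List (ℕ ⊕ ℕ))) (s) :
    (R.flatMap ruleCode).foldr (fun t s => parseStep s t) ([], [], S, s) = ([], [], R ++ S, s) := by
  induction R with
  | nil => rfl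
  | cons w R ih =>
    rw [List.flatMap_cons, List.foldr_append, ih, ruleCode, List.foldr_cons,
      foldr_flatMap_symbolCode, List.append_nil]
    rfl

/-- The number of terminals is irrelevant to the word: its digits are pending when the marker
`program` is reached, and are discarded. -/
theorem foldr_code (A : StraightLineProgram) (P) :
    A.code.foldr (fun t s => parseStep s t) ([], [], [], P) = ([], [], [], A.rules :: P) := by
  rw [code, List.foldr_cons, List.foldr_append, foldr_flatMap_ruleCode, foldr_natCode,
    List.append_nil, List.append_nil]
  rfl

theorem parse_pairCode (p : Normal × Normal) :
    parse (pairCode p).reverse = [p.1.1.rules, p.2.1.rules] := by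
  rw [parse, List.foldl_reverse, pairCode, List.foldr_append, foldr_code, foldr_code]

theorem polyTime_parseStep : PolyTime fun x : ParseState × Token => parseStep x.1 x.2 := by
  have h : PolyTime fun x : ParseState × Token => x.2.toSum :=
    (PolyTime.cast fun _ => rfl).comp PolyTime.snd_prod
  refine h.sumCases (g := fun x b => (b :: x.1.1, x.1.2))
    (h := fun x b => bif b.1 then
      bif b.2 then ([], [], [], x.1.2.2.1 :: x.1.2.2.2)
      else ([], [], x.1.2.1 :: x.1.2.2.1, x.1.2.2.2)
    else
      bif b.2 then ([], .inr (Nat.appendBits 0 x.1.1.reverse) :: x.1.2.1, x.1.2.2)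
      else ([], .inl (Nat.appendBits 0 x.1.1.reverse) :: x.1.2.1, x.1.2.2))
    (by fun_prop) ?_ ?_ ?_
  · fun_prop
  · rintro ⟨s, _ | _ | _ | _ | _⟩ b ⟨⟩
    rfl
  · rintro ⟨s, _ | _ | _ | _ | _⟩ b ⟨⟩ <;> rfl

/-- A potential argument: each token adds at most 4. A pending digit has weight 4, more than the 2
nodes it may occupy in a number, and the markers add at most 3 nodes. The constant 2 is the size of
the three empty lists. -/
theorem parse_bound (l : List Token) :
    4 * (l.foldl parseStep ([], [], [], [])).1.length + size (l.foldl parseStep ([], [], [], [])).2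
      ≤ 4 * l.length + 2 := by
  induction l using List.reverseRecOn with
  | nil => rfl
  | append_singleton l t ih =>
    rw [List.foldl_append, List.foldl_cons, List.foldl_nil]
    generalize l.foldl parseStep ([], [], [], []) = s at ih ⊢
    obtain ⟨b, w, R, P⟩ := s
    have h1 := size_le_natSize (Nat.appendBits 0 b.reverse)
    have h2 := Nat.size_appendBits_le 0 b.reverse
    rw [Nat.size_zero, List.length_reverse] at h2
    simp only [size_pair] at ih
    cases t <;> simp [parseStep] <;> omega

@[fun_prop]
theorem polyTime_parse : PolyTime parse := by
  have h : PolyTime fun l : List Token => l.foldl parseStep ([], [], [], []) := by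
    refine PolyTime.foldl (f := fun l : List Token => l) (g := fun _ => ([], [], [], []))
      (by fun_prop) (by fun_prop) (h := fun _ s t => parseStep s t)
      (polyTime_parseStep.comp (by fun_prop)) (m := fun l => 6 * size l + 3)
      (((PolyBdd.const 6).mul .size).add (.const 3)) fun l l' hl => ?_
    have h1 := parse_bound l'
    have h2 := (length_le_size l').trans (size_prefix_le hl)
    change size (l'.foldl parseStep ([], [], [], [])) ≤ _
    generalize l'.foldl parseStep ([], [], [], []) = s at h1
    have h3 : size s.1 ≤ s.1.length * 2 := by
      refine (size_le_mul (n := 1) fun b _ => size_bool_le b).trans ?_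
      omega
    rw [size_prod]
    omega
  unfold parse
  fun_prop

/-- A production of a program in normal form as an element of a sum. -/
def toRule (w : List (ℕ ⊕ ℕ)) : ℕ ⊕ ℕ × ℕ :=
  (w.headD (.inl 0)).elim .inl fun j => .inr (j, (w.tail.headD (.inl 0)).elim id id)

@[fun_prop]
theorem polyTime_toRule {α : Type*} [Data α] {f : α → List (ℕ ⊕ ℕ)} (hf : PolyTime f) :
    PolyTime fun a => toRule (f a) := by
  have h : PolyTime fun a => ((f a).tail.headD (.inl 0)).elim id id :=
    WordTest.polyTime_elim (by fun_prop) (g := fun _ x => x) (by fun_prop) (h := fun _ x => x)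
      (by fun_prop)
  have h' : PolyTime fun x : α × ℕ => ((f x.1).tail.headD (.inl 0)).elim id id :=
    h.comp PolyTime.fst_prod
  exact WordTest.polyTime_elim (f := fun a => (f a).headD (.inl 0)) (by fun_prop) (by fun_prop)
    (h := fun a j => Sum.inr (j, ((f a).tail.headD (.inl 0)).elim id id))
    (PolyTime.inr (PolyTime.snd_prod.prodMk h'))

/-- The equality test for the two programs of a reversed code. -/
def testParsed (l : List Token) : Bool :=
  WordTest.testRules (((parse l).headD []).map toRule) (((parse l).tail.headD []).map toRule)

theorem polyTime_testParsed : PolyTime testParsed := by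
  have h1 : PolyTime fun l => ((parse l).headD []).map toRule :=
    PolyTime.map (by fun_prop) (h := fun _ w => toRule w) (by fun_prop)
  have h2 : PolyTime fun l => ((parse l).tail.headD []).map toRule :=
    PolyTime.map (by fun_prop) (h := fun _ w => toRule w) (by fun_prop)
  exact WordTest.polyTime_testRules h1 h2

/-! ### Correctness for pairs of programs, and the theorem. -/

/-- The words of the non-terminals. -/
def wordAt (A : StraightLineProgram) (i : ℕ) : List ℕ :=
  if h : i < A.numNonterminals then (A.wordOf ⟨i, h⟩).map Fin.val else []

theorem wordAt_root (A : StraightLineProgram) : A.wordAt (A.numNonterminals - 1) = A.word :=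
  dif_pos A.root.2

/-- In normal form the default values in `toRule` never come into play. -/
theorem wordAt_of_toRule {A : StraightLineProgram} (hA : A.IsNormal) {i : ℕ} {r : ℕ ⊕ ℕ × ℕ}
    (h : (A.rules.map toRule)[i]? = some r) : (∃ x, r = .inl x ∧ A.wordAt i = [x]) ∨
      ∃ p q, r = .inr (p, q) ∧ p < i ∧ q < i ∧ A.wordAt i = A.wordAt p ++ A.wordAt q := by
  obtain ⟨hi, rfl⟩ := List.getElem?_eq_some_iff.1 h
  replace hi : i < A.numNonterminals := by simpa [rules] using hi
  have hw : A.wordAt i = (A.wordOf ⟨i, hi⟩).map Fin.val := dif_pos hi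
  rw [hw, wordOf_eq]
  rcases hA ⟨i, hi⟩ with ⟨a, ha⟩ | ⟨j, k, hjk⟩
  · exact .inl ⟨a, by simp [rules, toRule, ha], by simp [ha]⟩
  · have hj : j.1 < i := A.lt_of_mem_production ⟨i, hi⟩ j (by simp [hjk])
    have hk : k.1 < i := A.lt_of_mem_production ⟨i, hi⟩ k (by simp [hjk])
    exact .inr ⟨j, k, by simp [rules, toRule, hjk], hj, hk, by simp [hjk, wordAt]⟩

theorem testRules_rules {A X : StraightLineProgram} (hA : A.IsNormal) (hX : X.IsNormal) :
    WordTest.testRules (A.rules.map toRule) (X.rules.map toRule) = decide (A.word = X.word) := by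
  have lA : (A.rules.map toRule).length = A.numNonterminals := by simp [rules]
  have lX : (X.rules.map toRule).length = X.numNonterminals := by simp [rules]
  have posA := A.numNonterminals_pos
  have posX := X.numNonterminals_pos
  -- The words of the joint table: the non-terminals of `X` follow those of `A`, as arranged by
  -- `WordTest.shift`.
  let W : ℕ → List ℕ := fun i =>
    if i < A.numNonterminals then A.wordAt i else X.wordAt (i - A.numNonterminals)
  have hW1 : ∀ i < A.numNonterminals, W i = A.wordAt i := fun i hi => if_pos hi
  have hW2 : ∀ i, W (i + A.numNonterminals) = X.wordAt i := fun i => by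
    simp [W, show ¬ i + A.numNonterminals < A.numNonterminals by omega]
  have hE : WordTest.IsTable (WordTest.table (A.rules.map toRule ++
      (X.rules.map toRule).map (WordTest.shift A.numNonterminals))) W := by
    refine WordTest.table_spec fun i r hr => ?_
    rcases lt_or_ge i A.numNonterminals with hi | hi
    · rw [List.getElem?_append_left (by omega)] at hr
      rw [hW1 i hi]
      rcases wordAt_of_toRule hA hr with h | ⟨p, q, rfl, hp, hq, h⟩
      · exact .inl h
      · exact .inr ⟨p, q, rfl, hp, hq, by rw [h, hW1 p (by omega), hW1 q (by omega)]⟩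
    · obtain ⟨i, rfl⟩ := Nat.exists_eq_add_of_le' hi
      rw [List.getElem?_append_right (by omega), lA, Nat.add_sub_cancel, List.getElem?_map,
        Option.map_eq_some_iff] at hr
      obtain ⟨r, hr, rfl⟩ := hr
      rw [hW2]
      rcases wordAt_of_toRule hX hr with ⟨x, rfl, h⟩ | ⟨p, q, rfl, hp, hq, h⟩
      · exact .inl ⟨x, rfl, h⟩
      · exact .inr ⟨_, _, rfl, by omega, by omega, by rw [hW2, hW2, h]⟩
  rw [WordTest.testRules, lA, lX, Bool.eq_iff_iff, decide_eq_true_iff, hE.test_iff, hW1 _ (by omega),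
    show A.numNonterminals + X.numNonterminals - 1 =
      X.numNonterminals - 1 + A.numNonterminals by omega, hW2, wordAt_root, wordAt_root]
  all_goals
    simp only [WordTest.length_table, List.length_append, List.length_map]
    simp only [List.length_map] at lA lX
    omega

end StraightLineProgram

theorem theorem8p1 :
    Nonempty (Turing.TM2ComputableInPolyTime
      StraightLineProgram.pairCode
      Computability.encodeBool
      (fun p : StraightLineProgram.Normal × StraightLineProgram.Normal =>
        decide (p.1.1.word = p.2.1.word))) := by
  refine StackMachine.nonempty_computable StraightLineProgram.polyTime_testParsed fun p => ?_
  rw [StraightLineProgram.testParsed, StraightLineProgram.parse_pairCode]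
  exact StraightLineProgram.testRules_rules p.1.2 p.2.2
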